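/- **Setting.** Write $w^\times$ for the cross-product matrix of $w\in\mathbb R^3$. A flexible spacecraft has attitude quaternion $q=(q_v,q_4)$ with $q_v^Tq_v+q_4^2=1$, angular velocity $\omega\in\mathbb R^3$ and modal coordinates $\eta\in\mathbb R^n$, with $$\dot q_v=\tfrac12(q_v^\times+q_4I_3)\omega,\quad \dot q_4=-\tfrac12 q_v^T\omega,\quad J\dot\omega+\omega^\times J\omega+\delta\ddot\eta=u+d,\quad \ddot\eta+C\dot\eta+K\eta=-\delta^T\dot\omega .$$ The matrices $C,K\in\mathbb R^{n\times n}$ (symmetric positive definite) and $\delta\in\mathbb R^{3\times n}$ are known. The inertia matrix $J$ and $J_{mb}=J-\delta\delta^T$ are symmetric positive definite, and $J$ is partly unknown: $(J_{11},J_{22},J_{33},J_{23},J_{13},J_{12})^T=\bar L_1\mu+\bar L_0$ with $\bar L_1,\bar L_0$ known and $\mu\in\mathbb R^{n_\mu}$ unknown. With $L(x)$ the $3\times6$ matrix such that $Jx=L(x)(J_{11},J_{22},J_{33},J_{23},J_{13},J_{12})^T$, put $L_i(x)=L(x)\bar L_i$ and $F_i(x)=-x^\times L_i(x)$, $i=0,1$.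 The disturbance is $d_i(t)=C_{i0}+\sum_{j=1}^{N_i}C_{ij}\sin(b_{ij}t+l_{ij})$, $i=1,2,3$, with unknown amplitudes, frequencies and phases. Let $\sigma\in\mathcal S\subseteq\mathbb R^{n_\sigma}$ be the vector of unknown frequencies, $\mathcal S$ the set of its possible values. For known integers $r_i\ge1$ and functions $a_{ij}$ on $\mathcal S$, the signal $d_i$ satisfies $d_i^{(r_i)}=\sum_{j=1}^{r_i}a_{ij}(\sigma)d_i^{(j-1)}$, where for each $\sigma\in\mathcal S$ all roots of $\lambda^{r_i}-\sum_j a_{ij}(\sigma)\lambda^{j-1}$ are distinct with zero real part. Let $\Phi_i(\sigma)$ be the companion matrix with last row $(a_{i1}(\sigma),\dots,a_{ir_i}(\sigma))$, and $\Psi_i=(1,0,\dots,0)$. Choose $(M_i,N_i)$ controllable with $M_i\in\mathbb R^{r_i\times r_i}$ Hurwitz and $N_i\in\mathbb R^{r_i}$; let $T_i(\sigma)$ be the nonsingular solution of $T_i\Phi_i(\sigma)-M_iT_i=N_i\Psi_i$; let $M,N,\Psi,T(\sigma)$ be the block diagonal matrices with these blocks, and $r=r_1+r_2+r_3$. Let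 $E_0,E^1,\dots,E^\ell\in\mathbb R^{3\times r}$ be constant matrices and $\Omega_1,\dots,\Omega_\ell$ real functions on $\mathcal S$ with $$\Psi T^{-1}(\sigma)=E_0+\sum_{j=1}^{\ell}\Omega_j(\sigma)E^j\qquad(\sigma\in\mathcal S),$$ without redundant terms: $c_0+\sum_jc_j\Omega_j=0$ on $\mathcal S$ only if $c_1=\dots=c_\ell=0$. For a matrix or vector $X$ with $r$ rows write $E\circ X=[E^1X,\dots,E^\ell X]$. Let $q_d=(q_{dv},q_{d4})$ be a constant unit quaternion (the desired attitude; the desired angular velocity is $0$), $q_{ev}=q_{d4}q_v-q_{dv}^\times q_v-q_4q_{dv}$, and $\omega_e=\omega$. With $\rho=[\rho_1,\rho_2,\rho_3]$, $\rho_1=F_1(\omega_e)+E_0(NL_1(\omega_e)+\zeta)$, $\rho_2=E\circ(\zeta+NL_1(\omega_e))$, $\rho_3=E\circ(NL_0(\omega_e)-v)$, consider the control law with states $v\in\mathbb R^r$, $\zeta\in\mathbb R^{r\times n_\mu}$ and $\hat R\in\mathbb R^{n_\mu+\ell n_\mu+\ell}$: $$\begin{aligned}u&=-k_1q_{ev}-k_2\omega_e-\rho\hat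 R-E_0NL_0(\omega_e)+\delta C\delta^T\omega_e+E_0v-F_0(\omega_e),\\ \dot v&=Mv+Nu+NF_0(\omega_e)-MNL_0(\omega_e),\qquad \dot{\hat R}=k\rho^T\omega_e,\\ \dot\zeta&=M\zeta+MNL_1(\omega_e)-NF_1(\omega_e).\end{aligned}$$ **Theorem.** 1. The design is always possible. For any finite list of frequencies there are an integer $r'\ge1$ and coefficients $a'_1,\dots,a'_{r'}$ such that all roots of $\lambda^{r'}-\sum_ja'_j\lambda^{j-1}$ are distinct with zero real part, and every multi-tone signal with these frequencies satisfies the corresponding differential equation. For each $\sigma\in\mathcal S$ the nonsingular $T_i(\sigma)$ exists and is unique. Some integer $\ell\ge0$, matrices $E_0,E^j$ and functions $\Omega_j$ as above exist. 2. For any $E_0,E^j,\Omega_j$ as above the control law solves the rest-to-rest attitude tracking problem, in the following sense. Let $\Sigma\subseteq\mathcal S$ be a set on which $\Omega_1,\dots,\Omega_\ell$ are bounded (for instance one frequency vector or, if the $\Omega_j$ are continuous, a compact set). There is $\kappa>0$ such that, for all $k_1>0$, $k_2\ge\kappa$, $k>0$, all unit $q_d$, all $\mu$ for which $J$ and $J_{mb}$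 are positive definite, all $\sigma\in\Sigma$, all disturbances $d$ as above for this $\sigma$, and all initial states with $q(0)$ a unit quaternion, the closed-loop system has a unique solution on $[0,\infty)$; all its states $q,\omega,\eta,\dot\eta,v,\hat R,\zeta$ are bounded; and $$\lim_{t\to\infty}\big(q_{ev}(t),\omega_e(t),\eta(t)\big)=0 .$$ In particular $q(t)$ converges to $q_d$ or to $-q_d$, which represent the same attitude. -/

import Mathlib

open Filter Topology Matrix

noncomputable section

namespace FlexSpacecraft

/-- The cross-product matrix of a vector of `ℝ³`. -/
def skew (w : Fin 3 → ℝ) : Matrix (Fin 3) (Fin 3) ℝ :=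
  !![0, -(w 2), w 1;
     w 2, 0, -(w 0);
     -(w 1), w 0, 0]

/-- The symmetric inertia matrix with entries `p = (J₁₁, J₂₂, J₃₃, J₂₃, J₁₃, J₁₂)`. -/
def inertia (p : Fin 6 → ℝ) : Matrix (Fin 3) (Fin 3) ℝ :=
  !![p 0, p 5, p 4;
     p 5, p 1, p 3;
     p 4, p 3, p 2]

/-- The matrix `L(x)` with `J x = L(x) (J₁₁, J₂₂, J₃₃, J₂₃, J₁₃, J₁₂)`. -/
def regressor (x : Fin 3 → ℝ) : Matrix (Fin 3) (Fin 6) ℝ :=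
  !![x 0, 0, 0, 0, x 2, x 1;
     0, x 1, 0, x 2, 0, x 0;
     0, 0, x 2, x 1, x 0, 0]

/-! ### Disturbances and their exosystems -/

/-- The multi-tone signal `C₀ + ∑ⱼ Cⱼ sin (bⱼ t + lⱼ)`. -/
def multiTone {m : ℕ} (C0 : ℝ) (C b l : Fin m → ℝ) (t : ℝ) : ℝ :=
  C0 + ∑ j, C j * Real.sin (b j * t + l j)

/-- `f` is a multi-tone sinusoidal signal with a step component. -/
def IsMultiTone (f : ℝ → ℝ) : Prop :=
  ∃ (m : ℕ) (C0 : ℝ) (C b l : Fin m → ℝ), f = multiTone C0 C b l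

/-- The characteristic polynomial `λ ^ r - ∑ⱼ aⱼ λ ^ j`. -/
def exoPoly {r : ℕ} (a : Fin r → ℝ) : Polynomial ℝ :=
  Polynomial.X ^ r - ∑ j, Polynomial.C (a j) * Polynomial.X ^ (j : ℕ)

/-- All complex roots of the characteristic polynomial are distinct and have zero real part. -/
def IsExosystem {r : ℕ} (a : Fin r → ℝ) : Prop :=
  ((exoPoly a).map (algebraMap ℝ ℂ)).roots.Nodup ∧
    ∀ z ∈ ((exoPoly a).map (algebraMap ℝ ℂ)).roots, z.re = 0

/-- `f` solves the linear differential equation `f⁽ʳ⁾ = ∑ⱼ aⱼ f⁽ʲ⁾`. -/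
def SolvesExosystem {r : ℕ} (a : Fin r → ℝ) (f : ℝ → ℝ) : Prop :=
  ∀ t, iteratedDeriv r f t = ∑ j : Fin r, a j * iteratedDeriv (j : ℕ) f t

/-- The companion matrix of the exosystem, with last row `a`. -/
def companion {r : ℕ} (a : Fin r → ℝ) : Matrix (Fin r) (Fin r) ℝ :=
  Matrix.of fun j k =>
    if (j : ℕ) + 1 = r then a k else if (k : ℕ) = (j : ℕ) + 1 then 1 else 0

/-- The output row `(1, 0, …, 0)` of the exosystem. -/
def outRow (r : ℕ) : Fin r → ℝ := fun k => if (k : ℕ) = 0 then 1 else 0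

/-! ### The internal model -/

/-- All eigenvalues have negative real part. -/
def IsHurwitz {r : ℕ} (M : Matrix (Fin r) (Fin r) ℝ) : Prop :=
  ∀ z ∈ spectrum ℂ (M.map (algebraMap ℝ ℂ)), z.re < 0

/-- The controllability matrix `[N, M N, …, M ^ (r - 1) N]` has full rank. -/
def IsControllable {r : ℕ} (M : Matrix (Fin r) (Fin r) ℝ) (N : Fin r → ℝ) : Prop :=
  (Matrix.of fun j k : Fin r => ((M ^ (k : ℕ)) *ᵥ N) j).rank = r

/-- `T` is a nonsingular solution of the Sylvester equation `T Φ - M T = N Ψ`. -/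
def IsSylvesterSol {r : ℕ} (a : Fin r → ℝ) (M : Matrix (Fin r) (Fin r) ℝ) (N : Fin r → ℝ)
    (T : Matrix (Fin r) (Fin r) ℝ) : Prop :=
  IsUnit T.det ∧ T * companion a - M * T = vecMulVec N (outRow r)

/-- Index set of the stacked internal model state `col(v₁, v₂, v₃)`. -/
abbrev IMIdx (r : Fin 3 → ℕ) : Type := (i : Fin 3) × Fin (r i)

/-- Index set of `R = (μ, Ω ⊗ μ, Ω)`. -/
abbrev ParIdx (nμ ℓ : ℕ) : Type := (Fin nμ ⊕ (Fin ℓ × Fin nμ)) ⊕ Fin ℓ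

/-- The block diagonal matrix with the columns `N₁, N₂, N₃` as blocks. -/
def blockCols {r : Fin 3 → ℕ} (N : (i : Fin 3) → Fin (r i) → ℝ) : Matrix (IMIdx r) (Fin 3) ℝ :=
  Matrix.of fun p k => if p.1 = k then N p.1 p.2 else 0

/-- The block diagonal matrix `Ψ T⁻¹`, with the rows `Ψᵢ Tᵢ⁻¹` as blocks. -/
def psiTinv {r : Fin 3 → ℕ} (T : (i : Fin 3) → Matrix (Fin (r i)) (Fin (r i)) ℝ) :
    Matrix (Fin 3) (IMIdx r) ℝ :=
  Matrix.of fun k p => if k = p.1 then (outRow (r p.1) ᵥ* (T p.1)⁻¹) p.2 else 0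

/-- `Ψ T(σ)⁻¹ = E₀ + ∑ⱼ Ωⱼ(σ) Eʲ` for every possible frequency vector `σ ∈ S`, where `T(σ)` is the
nonsingular solution of the Sylvester equation, and the parametrization has no redundant term:
the functions `1, Ω₁, …, Ω_ℓ` satisfy no nontrivial linear relation on `S`. -/
def IsParametrization {nσ ℓ : ℕ} {r : Fin 3 → ℕ} (S : Set (Fin nσ → ℝ))
    (a : (i : Fin 3) → (Fin nσ → ℝ) → Fin (r i) → ℝ)
    (M : (i : Fin 3) → Matrix (Fin (r i)) (Fin (r i)) ℝ) (N : (i : Fin 3) → Fin (r i) → ℝ)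
    (E0 : Matrix (Fin 3) (IMIdx r) ℝ) (E : Fin ℓ → Matrix (Fin 3) (IMIdx r) ℝ)
    (Ω : (Fin nσ → ℝ) → Fin ℓ → ℝ) : Prop :=
  (∀ σ ∈ S, ∀ T : (i : Fin 3) → Matrix (Fin (r i)) (Fin (r i)) ℝ,
    (∀ i, IsSylvesterSol (a i σ) (M i) (N i) (T i)) → psiTinv T = E0 + ∑ j, Ω σ j • E j) ∧
  ∀ (c0 : ℝ) (c : Fin ℓ → ℝ), (∀ σ ∈ S, c0 + ∑ j, c j * Ω σ j = 0) → c = 0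

/-! ### The plant, the controller and the closed loop -/

/-- Known data of the flexible structure: coupling, damping and stiffness matrices. -/
structure Flex (n : ℕ) where
  δ : Matrix (Fin 3) (Fin n) ℝ
  C : Matrix (Fin n) (Fin n) ℝ
  K : Matrix (Fin n) (Fin n) ℝ

/-- The data from which the control law is built. Neither the inertia parameters nor the
frequencies, amplitudes and phases of the disturbance enter. -/
structure Controller (nμ ℓ : ℕ) (r : Fin 3 → ℕ) where
  k1 : ℝ
  k2 : ℝ
  k : ℝ
  Lbar1 : Matrix (Fin 6) (Fin nμ) ℝ
  Lbar0 : Fin 6 → ℝ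
  M : (i : Fin 3) → Matrix (Fin (r i)) (Fin (r i)) ℝ
  N : (i : Fin 3) → Fin (r i) → ℝ
  E0 : Matrix (Fin 3) (IMIdx r) ℝ
  E : Fin ℓ → Matrix (Fin 3) (IMIdx r) ℝ
  /-- desired attitude, vector part -/
  qdv : Fin 3 → ℝ
  /-- desired attitude, scalar part -/
  qd4 : ℝ

/-- The closed-loop state: attitude quaternion `(qv, q4)`, angular velocity, modal coordinates and
their velocities, internal model state, parameter estimate and dynamic compensator. -/
@[ext]
structure State (n nμ ℓ : ℕ) (r : Fin 3 → ℕ) where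
  qv : Fin 3 → ℝ
  q4 : ℝ
  ω : Fin 3 → ℝ
  η : Fin n → ℝ
  ηdot : Fin n → ℝ
  v : IMIdx r → ℝ
  Rhat : ParIdx nμ ℓ → ℝ
  ζ : Matrix (IMIdx r) (Fin nμ) ℝ

namespace Controller

variable {n nμ ℓ : ℕ} {r : Fin 3 → ℕ} (c : Controller nμ ℓ r)

/-- The block diagonal matrix `M`. -/
def Mb : Matrix (IMIdx r) (IMIdx r) ℝ := Matrix.blockDiagonal' c.M

/-- The block diagonal matrix `N`. -/
def Nb : Matrix (IMIdx r) (Fin 3) ℝ := blockCols c.N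

def L0 (w : Fin 3 → ℝ) : Fin 3 → ℝ := regressor w *ᵥ c.Lbar0

def L1 (w : Fin 3 → ℝ) : Matrix (Fin 3) (Fin nμ) ℝ := regressor w * c.Lbar1

def F0 (w : Fin 3 → ℝ) : Fin 3 → ℝ := -(skew w *ᵥ c.L0 w)

def F1 (w : Fin 3 → ℝ) : Matrix (Fin 3) (Fin nμ) ℝ := -(skew w * c.L1 w)

/-- Vector part of the quaternion error. -/
def qev (x : State n nμ ℓ r) : Fin 3 → ℝ :=
  c.qd4 • x.qv - skew c.qdv *ᵥ x.qv - x.q4 • c.qdv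

/-- `ρ₁ = F₁(ω) + E₀ (N L₁(ω) + ζ)`. -/
def rho1 (x : State n nμ ℓ r) : Matrix (Fin 3) (Fin nμ) ℝ :=
  c.F1 x.ω + c.E0 * (c.Nb * c.L1 x.ω + x.ζ)

/-- `ρ₂ = [E¹ (ζ + N L₁(ω)), …, E^ℓ (ζ + N L₁(ω))]`. -/
def rho2 (x : State n nμ ℓ r) : Matrix (Fin 3) (Fin ℓ × Fin nμ) ℝ :=
  Matrix.of fun i p => (c.E p.1 * (x.ζ + c.Nb * c.L1 x.ω)) i p.2

/-- `ρ₃ = [E¹ (N L₀(ω) - v), …, E^ℓ (N L₀(ω) - v)]`. -/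
def rho3 (x : State n nμ ℓ r) : Matrix (Fin 3) (Fin ℓ) ℝ :=
  Matrix.of fun i j => (c.E j *ᵥ (c.Nb *ᵥ c.L0 x.ω - x.v)) i

/-- `ρ = [ρ₁, ρ₂, ρ₃]`. -/
def rho (x : State n nμ ℓ r) : Matrix (Fin 3) (ParIdx nμ ℓ) ℝ :=
  Matrix.fromCols (Matrix.fromCols (c.rho1 x) (c.rho2 x)) (c.rho3 x)

/-- The control torque. -/
def u (P : Flex n) (x : State n nμ ℓ r) : Fin 3 → ℝ :=
  -(c.k1 • c.qev x) - c.k2 • x.ω - c.rho x *ᵥ x.Rhat - c.E0 *ᵥ (c.Nb *ᵥ c.L0 x.ω)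
    + (P.δ * P.C * P.δᵀ) *ᵥ x.ω + c.E0 *ᵥ x.v - c.F0 x.ω

end Controller

/-- `x` solves on `[0, ∞)` the closed loop formed by the attitude kinematics, the rigid-flexible
dynamics with inertia matrix `J` and disturbance `d`, and the adaptive dynamic control law.
Here `α` and `β` are the angular acceleration and the modal acceleration at time `t`. -/
def IsClosedLoopSolution {n nμ ℓ : ℕ} {r : Fin 3 → ℕ} (P : Flex n)
    (J : Matrix (Fin 3) (Fin 3) ℝ) (d : Fin 3 → ℝ → ℝ) (c : Controller nμ ℓ r)
    (x : ℝ → State n nμ ℓ r) : Prop :=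
  ∀ t, 0 ≤ t →
    HasDerivWithinAt (fun s => (x s).qv)
      ((1 / 2 : ℝ) • ((skew (x t).qv + (x t).q4 • (1 : Matrix (Fin 3) (Fin 3) ℝ)) *ᵥ (x t).ω))
      (Set.Ici 0) t ∧
    HasDerivWithinAt (fun s => (x s).q4) (-(1 / 2 : ℝ) * ((x t).qv ⬝ᵥ (x t).ω)) (Set.Ici 0) t ∧
    (∃ (α : Fin 3 → ℝ) (β : Fin n → ℝ),
      HasDerivWithinAt (fun s => (x s).ω) α (Set.Ici 0) t ∧
      HasDerivWithinAt (fun s => (x s).η) (x t).ηdot (Set.Ici 0) t ∧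
      HasDerivWithinAt (fun s => (x s).ηdot) β (Set.Ici 0) t ∧
      J *ᵥ α + skew (x t).ω *ᵥ (J *ᵥ (x t).ω) + P.δ *ᵥ β = c.u P (x t) + (fun i => d i t) ∧
      β + P.C *ᵥ (x t).ηdot + P.K *ᵥ (x t).η = -(P.δᵀ *ᵥ α)) ∧
    HasDerivWithinAt (fun s => (x s).v)
      (c.Mb *ᵥ (x t).v + c.Nb *ᵥ c.u P (x t) + c.Nb *ᵥ c.F0 (x t).ω
        - c.Mb *ᵥ (c.Nb *ᵥ c.L0 (x t).ω))
      (Set.Ici 0) t ∧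
    HasDerivWithinAt (fun s => (x s).Rhat) (c.k • ((c.rho (x t))ᵀ *ᵥ (x t).ω)) (Set.Ici 0) t ∧
    ∀ p m, HasDerivWithinAt (fun s => (x s).ζ p m)
      ((c.Mb * (x t).ζ + (c.Mb * c.Nb * c.L1 (x t).ω - c.Nb * c.F1 (x t).ω)) p m) (Set.Ici 0) t

/-- All closed-loop states are bounded on `[0, ∞)`. -/
def IsBoundedTrajectory {n nμ ℓ : ℕ} {r : Fin 3 → ℕ} (x : ℝ → State n nμ ℓ r) : Prop :=
  ∃ B : ℝ, ∀ t, 0 ≤ t →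
    ‖(x t).qv‖ ≤ B ∧ |(x t).q4| ≤ B ∧ ‖(x t).ω‖ ≤ B ∧ ‖(x t).η‖ ≤ B ∧ ‖(x t).ηdot‖ ≤ B ∧
    ‖(x t).v‖ ≤ B ∧ ‖(x t).Rhat‖ ≤ B ∧ ∀ p m, |(x t).ζ p m| ≤ B

/-- Attitude tracking: the attitude error, the angular velocity and the modal coordinates tend to
zero, and the quaternion tends to one of the two unit quaternions `q_d`, `-q_d` that represent the
desired attitude. -/
def AchievesTracking {n nμ ℓ : ℕ} {r : Fin 3 → ℕ} (c : Controller nμ ℓ r)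
    (x : ℝ → State n nμ ℓ r) : Prop :=
  Tendsto (fun t => c.qev (x t)) atTop (𝓝 0) ∧
  Tendsto (fun t => (x t).ω) atTop (𝓝 0) ∧
  Tendsto (fun t => (x t).η) atTop (𝓝 0) ∧
  (Tendsto (fun t => ((x t).qv, (x t).q4)) atTop (𝓝 (c.qdv, c.qd4)) ∨
    Tendsto (fun t => ((x t).qv, (x t).q4)) atTop (𝓝 (-c.qdv, -c.qd4)))

end FlexSpacecraft

end

noncomputable section

namespace FlexSpacecraft

section

/-! ### Asymptotics of functions on a half-line -/

section HalfLine

variable {E : Type*} [NormedAddCommGroup E] [NormedSpace ℝ E]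

/-! Let `θ` be the exosystem state in the coordinates of the internal model, so that `θ' = M θ + N
d` and `Ψ T⁻¹ θ = d`. The states `v` and `ζ` are designed so that `z = v + θ - N J ω - ζ μ - N δ η'`
(`imError`) satisfies `z' = M z + M N δ η'`: torque, disturbance and inertia all drop out. In terms
of `z` the momentum equation contains the unknown parameters only through `ρ (Rhat - R)`, linearly
in `R = (μ, Ω ⊗ μ, Ω)` (`momentum_eq`).

The Lyapunov function adds to the mechanical energy the potential `2 k₁ (1 - q_e4)`, the squared
parameter error and `γ zᵀ Q z`, where `Q` comes from Lyapunov's theorem for `M`. In its derivative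
the potential and adaptation terms cancel, leaving a quadratic form in `(ω, η', z)` that a large
`k₂` makes negative definite (`exists_gain`). Neither `J` nor `μ` occurs in this form, and `σ` only
through the entries of `Ψ T⁻¹`, so one threshold `κ` serves all plants and all frequencies for which
`Ω` is bounded. Adding a small multiple of the energy of `ζ` gives `exists_lyapunov_certificate`.
Its bounds prevent finite escape, and a Barbalat argument sends `ω`, `η'`, `z` and `ζ` to zero.

For `η` and `q_ev` a second tool is used: a slowly varying signal that is, up to a vanishing term,
the derivative of a bounded function must vanish (`tendsto_zero_of_slow`). For `η` it applies
directly. For `q_ev` the obstacle is that `ρ` does not vanish: `v` approaches `-θ`, so `ρ (Rhat -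
R)` approaches the sum over `j` of the `Ω_j` component of the parameter error times `Eʲ θ`. As
`Rhat' → 0`, this averages out as soon as each `Eʲ θ` has a bounded primitive, that is, zero mean.

Zero mean is what the absence of redundant terms provides. A constant component of `d_i` requires
the eigenvalue zero in the `i`-th exosystem. Its roots are simple and imaginary, so this happens
exactly when `r_i` is odd, independently of `σ`. Then the constant response `τ = -M_i⁻¹ N_i`
satisfies `Ψ_i T_i(σ)⁻¹ τ = 1` for every `σ`; inserting the parametrization gives a linear relation
among `1, Ω₁, …, Ω_ℓ`, which forces `Eʲ τ = 0` (`IsParametrization.mulVec_const_eq_zero`). -/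

theorem norm_sub_le_of_hasDerivWithinAt_Ici {f f' : ℝ → E} {a b L : ℝ} (ha : 0 ≤ a) (hab : a ≤ b)
    (hf : ∀ t, 0 ≤ t → HasDerivWithinAt f (f' t) (Set.Ici 0) t)
    (hL : ∀ t ∈ Set.Icc a b, ‖f' t‖ ≤ L) : ‖f b - f a‖ ≤ L * (b - a) := by
  have h := (convex_Icc a b).norm_image_sub_le_of_norm_hasDerivWithin_le (f := f) (f' := f')
    (C := L) (fun t ht => (hf t (ha.trans ht.1)).mono fun s hs => ha.trans hs.1) hL
    (Set.left_mem_Icc.2 hab) (Set.right_mem_Icc.2 hab)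
  rwa [Real.norm_of_nonneg (sub_nonneg.2 hab)] at h

theorem antitoneOn_of_hasDerivWithinAt_le_zero {D : Set ℝ} (hD : Convex ℝ D) {V V' : ℝ → ℝ}
    (hV : ∀ t ∈ D, HasDerivWithinAt V (V' t) D t) (hV' : ∀ t ∈ D, V' t ≤ 0) :
    AntitoneOn V D :=
  antitoneOn_of_hasDerivWithinAt_nonpos hD (fun t ht => (hV t ht).continuousWithinAt)
    (fun t ht => (hV t (interior_subset ht)).mono interior_subset)
    (fun t ht => hV' t (interior_subset ht))

/-- A version of Barbalat's lemma: if a function bounded below decreases at least at the rate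
`ε ‖y‖²`, where `y` has bounded derivative, then `y` tends to zero. -/
theorem tendsto_zero_of_dissipation {V V' : ℝ → ℝ} {y y' : ℝ → E} {ε m L : ℝ} (hε : 0 < ε)
    (hV : ∀ t, 0 ≤ t → HasDerivWithinAt V (V' t) (Set.Ici 0) t)
    (hV' : ∀ t, 0 ≤ t → V' t ≤ -ε * ‖y t‖ ^ 2) (hm : ∀ t, 0 ≤ t → m ≤ V t)
    (hy : ∀ t, 0 ≤ t → HasDerivWithinAt y (y' t) (Set.Ici 0) t)
    (hL : ∀ t, 0 ≤ t → ‖y' t‖ ≤ L) : Tendsto y atTop (𝓝 0) := by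
  have hL0 : 0 ≤ L := (norm_nonneg _).trans (hL 0 le_rfl)
  have hanti : AntitoneOn V (Set.Ici 0) :=
    antitoneOn_of_hasDerivWithinAt_le_zero (convex_Ici 0) hV fun t ht =>
      (hV' t ht).trans (by nlinarith [sq_nonneg ‖y t‖])
  rw [Metric.tendsto_atTop]
  intro e he
  -- A window so short that `y`, with speed at most `L`, cannot fall from `e` to below `e / 2`
  -- inside it; `L + 1` avoids division by zero.
  set h : ℝ := e / (2 * (L + 1)) with hh
  have hh0 : 0 < h := by positivity
  have hLh : L * h ≤ e / 2 := by
    rw [hh, mul_div_assoc', div_le_div_iff₀ (by positivity) (by positivity)]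
    nlinarith
  -- The least amount by which `V` drops over such a window. Past a time where `V` is within `c` of
  -- its infimum no such drop is possible.
  set c : ℝ := h * (ε * (e / 2) ^ 2)
  have hc : 0 < c := by positivity
  have hbdd : BddBelow (V '' Set.Ici 0) := ⟨m, by rintro _ ⟨t, ht, rfl⟩; exact hm t ht⟩
  obtain ⟨_, ⟨t0, ht0, rfl⟩, hlt⟩ := exists_lt_of_csInf_lt (Set.Nonempty.image V ⟨0, le_rfl⟩)
    (lt_add_of_pos_right (sInf (V '' Set.Ici 0)) hc)
  refine ⟨t0, fun t ht => ?_⟩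
  have ht0' : (0 : ℝ) ≤ t0 := ht0
  have htn : 0 ≤ t := ht0'.trans ht
  rw [dist_zero_right]
  by_contra! hcon
  have h1 : V t ≤ V t0 := hanti ht0 htn ht
  have h2 : sInf (V '' Set.Ici 0) ≤ V (t + h) :=
    csInf_le hbdd ⟨t + h, by simp only [Set.mem_Ici]; linarith, rfl⟩
  obtain ⟨s, hs, hsV⟩ := exists_hasDerivAt_eq_slope V V' (lt_add_of_pos_right t hh0)
    (fun s hs => ((hV s (htn.trans hs.1)).continuousWithinAt).mono fun u hu => htn.trans hu.1)
    (fun s hs => (hV s (htn.trans hs.1.le)).hasDerivAt (Ici_mem_nhds (htn.trans_lt hs.1)))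
  have h3 : ‖y s - y t‖ ≤ L * (s - t) :=
    norm_sub_le_of_hasDerivWithinAt_Ici htn hs.1.le hy fun u hu => hL u (htn.trans hu.1)
  have h4 : e / 2 ≤ ‖y s‖ := by
    have : ‖y t‖ - ‖y s‖ ≤ ‖y s - y t‖ := by
      rw [← norm_neg (y s - y t), neg_sub]; exact norm_sub_norm_le _ _
    have : L * (s - t) ≤ L * h := mul_le_mul_of_nonneg_left (by linarith [hs.2]) hL0
    linarith
  have h5 : V' s ≤ -(ε * (e / 2) ^ 2) := by
    have := hV' s (htn.trans hs.1.le)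
    have : (e / 2) ^ 2 ≤ ‖y s‖ ^ 2 := by gcongr
    nlinarith
  rw [add_sub_cancel_left, eq_div_iff hh0.ne'] at hsV
  have h6 : V (t + h) - V t ≤ -c := by
    rw [← hsV]
    calc V' s * h ≤ -(ε * (e / 2) ^ 2) * h := by gcongr
      _ = -c := by ring
  linarith

/-- If `y` is asymptotically constant and equals, up to a vanishing term, the derivative of a
bounded function, then `y` tends to zero. -/
theorem tendsto_zero_of_slow {y y' W w : ℝ → E} {B : ℝ}
    (hy : ∀ t, 0 ≤ t → HasDerivWithinAt y (y' t) (Set.Ici 0) t)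
    (hy' : Tendsto y' atTop (𝓝 0))
    (hW : ∀ t, 0 ≤ t → HasDerivWithinAt W (w t) (Set.Ici 0) t)
    (hB : ∀ t, 0 ≤ t → ‖W t‖ ≤ B)
    (hw : Tendsto (fun t => w t + y t) atTop (𝓝 0)) : Tendsto y atTop (𝓝 0) := by
  have hB0 : 0 ≤ B := (norm_nonneg _).trans (hB 0 le_rfl)
  rw [Metric.tendsto_atTop] at hy' hw ⊢
  intro η hη
  -- The window is long enough that the increment of `W`, at most `2 * B`, is small relative to `h`.
  -- Only then is the tolerance `e` chosen, small enough that `y` hardly moves during the window.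
  set h : ℝ := 8 * (B + 1) / η with hh
  have hh0 : 0 < h := by positivity
  set e : ℝ := η / (4 * (1 + h)) with he
  have he0 : 0 < e := by positivity
  obtain ⟨t1, ht1⟩ := hy' e he0
  obtain ⟨t2, ht2⟩ := hw e he0
  refine ⟨max (max t1 t2) 0, fun t ht => ?_⟩
  have htn : 0 ≤ t := (le_max_right _ _).trans ht
  have htt1 : t1 ≤ t := ((le_max_left _ _).trans (le_max_left _ _)).trans ht
  have htt2 : t2 ≤ t := ((le_max_right _ _).trans (le_max_left _ _)).trans ht
  -- On the window `W'` is nearly `-y t`, so `W s + (s - t) • y t` is nearly constant. Boundedness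
  -- of `W` then bounds `h * ‖y t‖`.
  have key : ‖(W (t + h) + (t + h - t) • y t) - (W t + (t - t) • y t)‖
      ≤ (e + e * h) * (t + h - t) := by
    refine norm_sub_le_of_hasDerivWithinAt_Ici (f := fun s => W s + (s - t) • y t)
      (f' := fun s => w s + (1 : ℝ) • y t) htn (by linarith) (fun s hs => ?_) fun s hs => ?_
    · exact (hW s hs).add (((hasDerivWithinAt_id s _).sub_const t).smul_const (y t))
    · have e1 : ‖y s - y t‖ ≤ e * (s - t) :=
        norm_sub_le_of_hasDerivWithinAt_Ici htn hs.1 hy fun u hu => by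
          simpa using (ht1 u (htt1.trans hu.1)).le
      have e2 : ‖w s + y s‖ ≤ e := by simpa using (ht2 s (htt2.trans hs.1)).le
      have e3 : e * (s - t) ≤ e * h := mul_le_mul_of_nonneg_left (by linarith [hs.2]) he0.le
      calc ‖w s + (1 : ℝ) • y t‖ = ‖(w s + y s) - (y s - y t)‖ := by
            rw [one_smul]; congr 1; abel
        _ ≤ ‖w s + y s‖ + ‖y s - y t‖ := norm_sub_le _ _
        _ ≤ e + e * h := by linarith
  rw [dist_zero_right]
  have h1 : h * ‖y t‖ ≤ (e + e * h) * h + 2 * B := by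
    have e1 : h • y t = ((W (t + h) + (t + h - t) • y t) - (W t + (t - t) • y t))
        - (W (t + h) - W t) := by
      rw [add_sub_cancel_left, sub_self, zero_smul]; abel
    have e2 : ‖h • y t‖ = h * ‖y t‖ := by rw [norm_smul, Real.norm_of_nonneg hh0.le]
    rw [← e2, e1]
    refine (norm_sub_le _ _).trans (add_le_add (key.trans (by rw [add_sub_cancel_left])) ?_)
    refine (norm_sub_le _ _).trans ?_
    linarith [hB (t + h) (by linarith), hB t htn]
  have h2 : (e + e * h) = η / 4 := by
    rw [he]; field_simp
  have h3 : 2 * B ≤ h * (η / 4) := by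
    rw [hh]; field_simp; linarith
  rw [h2] at h1
  have : h * ‖y t‖ ≤ h * (η / 2) := by linarith
  have := le_of_mul_le_mul_left this hh0
  linarith

end HalfLine

/-! ### Global solutions of ordinary differential equations -/

section GlobalODE

variable {E : Type*} [NormedAddCommGroup E] [NormedSpace ℝ E] [FiniteDimensional ℝ E]

/-- Two solutions on `[0, T]` of an equation with `C¹` right-hand side and the same initial value
agree. -/
theorem eqOn_Icc_of_contDiff {g : E → E} (hg : ContDiff ℝ 1 g) (h : ℝ → E) {T : ℝ} {x y : ℝ → E}
    (hx : ∀ t ∈ Set.Icc 0 T, HasDerivWithinAt x (g (x t) + h t) (Set.Icc 0 T) t)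
    (hy : ∀ t ∈ Set.Icc 0 T, HasDerivWithinAt y (g (y t) + h t) (Set.Icc 0 T) t)
    (h0 : x 0 = y 0) : Set.EqOn x y (Set.Icc 0 T) := by
  have hxc : ContinuousOn x (Set.Icc 0 T) := fun t ht => (hx t ht).continuousWithinAt
  have hyc : ContinuousOn y (Set.Icc 0 T) := fun t ht => (hy t ht).continuousWithinAt
  obtain ⟨B, hB⟩ := ((isCompact_Icc.image_of_continuousOn hxc).union
    (isCompact_Icc.image_of_continuousOn hyc)).isBounded.subset_closedBall 0
  obtain ⟨K, hK⟩ := hg.contDiffOn.exists_lipschitzOnWith (s := Metric.closedBall (0 : E) B)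
    one_ne_zero (convex_closedBall _ _) (isCompact_closedBall _ _)
  have hIci : ∀ t ∈ Set.Ico 0 T, Set.Icc 0 T ∈ 𝓝[Set.Ici t] t := fun t ht =>
    mem_of_superset (Icc_mem_nhdsGE ht.2) (Set.Icc_subset_Icc_left ht.1)
  refine ODE_solution_unique_of_mem_Icc_right (v := fun t z => g z + h t) (K := K)
    (s := fun _ => Metric.closedBall 0 B) (fun t _ => ?_) hxc
    (fun t ht => (hx t (Set.Ico_subset_Icc_self ht)).mono_of_mem_nhdsWithin (hIci t ht))
    (fun t ht => hB (Or.inl ⟨t, Set.Ico_subset_Icc_self ht, rfl⟩)) hyc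
    (fun t ht => (hy t (Set.Ico_subset_Icc_self ht)).mono_of_mem_nhdsWithin (hIci t ht))
    (fun t ht => hB (Or.inr ⟨t, Set.Ico_subset_Icc_self ht, rfl⟩)) h0
  intro a ha b hb
  simpa using hK ha hb

/-- Solutions exist on `[0, T]` if the right-hand side is bounded and Lipschitz. -/
theorem exists_solution_Icc_of_bounded {f : E → E} {K : NNReal} (hf : LipschitzWith K f)
    {C : ℝ} (hC : ∀ z, ‖f z‖ ≤ C) {h : ℝ → E} (hh : Continuous h) {D : ℝ} (hD : ∀ t, ‖h t‖ ≤ D)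
    (x0 : E) {T : ℝ} (hT : 0 ≤ T) : ∃ x : ℝ → E, x 0 = x0 ∧
      ∀ t ∈ Set.Icc 0 T, HasDerivWithinAt x (f (x t) + h t) (Set.Icc 0 T) t := by
  have hC0 : 0 ≤ C := (norm_nonneg _).trans (hC 0)
  have hD0 : 0 ≤ D := (norm_nonneg _).trans (hD 0)
  -- A solution of speed at most `C + D` stays within `(C + D) * T` of `x0`, so with this radius the
  -- local theorem already covers the whole interval.
  have : IsPicardLindelof (fun t z => f z + h t) (tmin := 0) (tmax := T) ⟨0, le_rfl, hT⟩ x0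
      ((C + D).toNNReal * T.toNNReal) 0 (C + D).toNNReal K := by
    refine ⟨fun t _ => ?_, fun z _ => (continuous_const.add hh).continuousOn, fun t _ z _ => ?_, ?_⟩
    · intro a _ b _
      simpa using hf a b
    · rw [Real.coe_toNNReal _ (by positivity)]
      exact (norm_add_le _ _).trans (add_le_add (hC z) (hD t))
    · simp [hT]
  obtain ⟨x, hx0, hx⟩ := this.exists_eq_forall_mem_Icc_hasDerivWithinAt₀
  exact ⟨x, hx0, hx⟩

/-- Solutions exist on `[0, T]` if they are bounded a priori. -/
theorem exists_solution_Icc_of_apriori {g : E → E} (hg : ContDiff ℝ 1 g) {h : ℝ → E}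
    (hh : Continuous h) {D : ℝ} (hD : ∀ t, ‖h t‖ ≤ D) (x0 : E) {B T : ℝ} (hT : 0 ≤ T)
    (hB : ∀ S, 0 ≤ S → ∀ x : ℝ → E, x 0 = x0 →
      (∀ t ∈ Set.Icc 0 S, HasDerivWithinAt x (g (x t) + h t) (Set.Icc 0 S) t) →
      ∀ t ∈ Set.Icc 0 S, ‖x t‖ ≤ B) : ∃ x : ℝ → E, x 0 = x0 ∧
      ∀ t ∈ Set.Icc 0 T, HasDerivWithinAt x (g (x t) + h t) (Set.Icc 0 T) t := by
  have hB0 : ‖x0‖ ≤ B := by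
    -- On the degenerate interval `[0, 0]` the constant function counts as a solution, so the a
    -- priori bound applies to `x0` itself.
    have := hB 0 le_rfl (fun _ => x0) rfl (fun t ht => by
      obtain rfl : t = 0 := le_antisymm ht.2 ht.1
      rw [Set.Icc_self, hasDerivWithinAt_iff_tendsto_slope]; simp) 0 (by simp)
    simpa using this
  have hBn : 0 ≤ B := (norm_nonneg _).trans hB0
  -- Cutting the field off outside a ball slightly larger than the a priori bound makes it globally
  -- Lipschitz and bounded without changing it where solutions can go.
  let χ : ContDiffBump (0 : E) := ⟨B + 1, B + 2, by linarith, by linarith⟩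
  have hf : ContDiff ℝ 1 fun z => χ z • g z := (χ.contDiff).smul hg
  have hfc : HasCompactSupport fun z => χ z • g z := χ.hasCompactSupport.smul_right
  obtain ⟨K, hK⟩ := hf.lipschitzWith_of_hasCompactSupport hfc one_ne_zero
  obtain ⟨C, hC⟩ := hfc.exists_bound_of_continuous hf.continuous
  obtain ⟨x, hx0, hx⟩ := exists_solution_Icc_of_bounded hK hC hh hD x0 hT
  have hxc : ContinuousOn x (Set.Icc 0 T) := fun t ht => (hx t ht).continuousWithinAt
  have hχ : ∀ z, ‖z‖ ≤ B + 1 → χ z • g z = g z := fun z hz => by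
    rw [χ.one_of_mem_closedBall (by simpa using hz), one_smul]
  have hlt : ∀ t ∈ Set.Icc 0 T, ‖x t‖ < B + 1 := by
    by_contra! hcon
    have hcl : IsCompact (Set.Icc 0 T ∩ (fun t => ‖x t‖) ⁻¹' Set.Ici (B + 1)) :=
      (isCompact_Icc).of_isClosed_subset
        (hxc.norm.preimage_isClosed_of_isClosed isClosed_Icc isClosed_Ici) Set.inter_subset_left
    -- The first time at which the norm reaches `B + 1`. Up to then the cutoff is inactive, so the a
    -- priori bound `B` applies and is contradicted.
    obtain ⟨t1, ⟨ht1, ht1B⟩, hmin⟩ := hcl.exists_isLeast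
      (by obtain ⟨t, ht, htB⟩ := hcon; exact ⟨t, ht, htB⟩)
    have hle : ∀ t ∈ Set.Icc 0 t1, ‖x t‖ ≤ B + 1 := by
      have hsub : Set.Ico 0 t1 ⊆ {t | ‖x t‖ ≤ B + 1} := fun t ht => by
        by_contra! hc
        simp only [Set.mem_ofPred_eq, not_le] at hc
        exact absurd (hmin ⟨⟨ht.1, ht.2.le.trans ht1.2⟩, hc.le⟩) (not_le.2 ht.2)
      intro t ht
      rcases ht.2.lt_or_eq with h1 | rfl
      · exact hsub ⟨ht.1, h1⟩
      rcases ht.1.eq_or_lt with h0 | h0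
      · rw [← h0, hx0]; linarith
      have hcw : ContinuousWithinAt (fun t => ‖x t‖) (Set.Ico 0 t) t :=
        (hxc.norm t ht1).mono fun s hs => ⟨hs.1, hs.2.le.trans ht1.2⟩
      have hne : (𝓝[Set.Ico 0 t] t).NeBot := by
        rw [nhdsWithin_Ico_eq_nhdsLT h0]; infer_instance
      exact le_of_tendsto hcw (eventually_nhdsWithin_of_forall hsub)
    have := hB t1 ht1.1 x hx0 (fun t ht => by
      have h1 := (hx t ⟨ht.1, ht.2.trans ht1.2⟩).mono (Set.Icc_subset_Icc_right ht1.2)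
      rwa [hχ _ (hle t ht)] at h1) t1 ⟨ht1.1, le_rfl⟩
    simp only [Set.mem_preimage, Set.mem_Ici] at ht1B
    linarith
  refine ⟨x, hx0, fun t ht => ?_⟩
  have h1 := hx t ht
  rwa [hχ _ (hlt t ht).le] at h1

/-- A differential equation with `C¹` right-hand side and bounded continuous forcing has a solution
on `[0, ∞)` if its solutions are bounded a priori. -/
theorem exists_solution_Ici_of_apriori {g : E → E} (hg : ContDiff ℝ 1 g) {h : ℝ → E}
    (hh : Continuous h) {D : ℝ} (hD : ∀ t, ‖h t‖ ≤ D) (x0 : E) {B : ℝ}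
    (hB : ∀ S, 0 ≤ S → ∀ x : ℝ → E, x 0 = x0 →
      (∀ t ∈ Set.Icc 0 S, HasDerivWithinAt x (g (x t) + h t) (Set.Icc 0 S) t) →
      ∀ t ∈ Set.Icc 0 S, ‖x t‖ ≤ B) : ∃ x : ℝ → E, x 0 = x0 ∧
      ∀ t, 0 ≤ t → HasDerivWithinAt x (g (x t) + h t) (Set.Ici 0) t := by
  choose X hX0 hX using fun n : ℕ =>
    exists_solution_Icc_of_apriori hg hh hD x0 (Nat.cast_nonneg n) hB
  have hagree : ∀ m n : ℕ, m ≤ n → Set.EqOn (X m) (X n) (Set.Icc 0 m) := fun m n hmn =>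
    eqOn_Icc_of_contDiff hg h (hX m) (fun t ht =>
      (hX n t ⟨ht.1, ht.2.trans (Nat.cast_le.2 hmn)⟩).mono
        (Set.Icc_subset_Icc_right (Nat.cast_le.2 hmn))) ((hX0 m).trans (hX0 n).symm)
  -- Gluing along the integers: by uniqueness the value does not depend on which sufficiently long
  -- solution is used.
  let x : ℝ → E := fun t => X ⌈t⌉₊ t
  have hxX : ∀ n : ℕ, Set.EqOn x (X n) (Set.Icc 0 n) := fun n t ht =>
    hagree _ _ (Nat.ceil_le.2 ht.2) ⟨ht.1, Nat.le_ceil t⟩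
  refine ⟨x, by simp [x, hX0], fun t ht => ?_⟩
  obtain ⟨n, hn⟩ := exists_nat_gt t
  have htn : t ∈ Set.Icc (0 : ℝ) n := ⟨ht, hn.le⟩
  have h1 := (hX n t htn).congr (hxX n) (hxX n htn)
  rw [← hxX n htn] at h1
  refine h1.mono_of_mem_nhdsWithin ?_
  rw [← Set.Ici_inter_Iic]
  exact inter_mem self_mem_nhdsWithin (mem_nhdsWithin_of_mem_nhds (Iic_mem_nhds hn))

end GlobalODE

end

section

/-! ### Quadratic estimates -/

section Quadratic

theorem isSymm_of_posDef {ι : Type*} {A : Matrix ι ι ℝ} (hA : A.PosDef) : A.IsSymm := by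
  simpa [Matrix.IsHermitian, Matrix.IsSymm] using hA.isHermitian

variable {ι κ : Type*} [Fintype ι] [Fintype κ]

theorem dotProduct_self_nonneg' (x : ι → ℝ) : 0 ≤ x ⬝ᵥ x :=
  Finset.sum_nonneg fun i _ => mul_self_nonneg (x i)

/-- The norm on `ι → ℝ` is the supremum norm, while all energies are Euclidean and are written `x ⬝ᵥ
x`. This comparison and the next ones pass between the two. -/
theorem norm_sq_le_dotProduct_self (x : ι → ℝ) : ‖x‖ ^ 2 ≤ x ⬝ᵥ x := by
  have h : ‖x‖ ≤ √(x ⬝ᵥ x) := (pi_norm_le_iff_of_nonneg (Real.sqrt_nonneg _)).2 fun i => by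
    rw [Real.norm_eq_abs]
    refine Real.abs_le_sqrt ?_
    rw [sq]
    exact Finset.single_le_sum (f := fun i => x i * x i) (fun i _ => mul_self_nonneg (x i))
      (Finset.mem_univ i)
  calc ‖x‖ ^ 2 ≤ √(x ⬝ᵥ x) ^ 2 := by gcongr
    _ = x ⬝ᵥ x := Real.sq_sqrt (dotProduct_self_nonneg' x)

theorem dotProduct_self_le_norm_sq (x : ι → ℝ) : x ⬝ᵥ x ≤ Fintype.card ι * ‖x‖ ^ 2 := by
  have : ∀ i ∈ Finset.univ, x i * x i ≤ ‖x‖ ^ 2 := fun i _ => by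
    rw [← sq, ← sq_abs]
    exact pow_le_pow_left₀ (abs_nonneg _) (norm_le_pi_norm x i) 2
  simpa [dotProduct] using Finset.sum_le_card_nsmul _ _ _ this

theorem norm_le_of_dotProduct_self_le {x : ι → ℝ} {b : ℝ} (h : x ⬝ᵥ x ≤ b) : ‖x‖ ≤ b + 1 := by
  nlinarith [norm_sq_le_dotProduct_self x, sq_nonneg (‖x‖ - 1)]

theorem two_mul_dotProduct_le (x y : ι → ℝ) {a : ℝ} (ha : 0 < a) :
    2 * (x ⬝ᵥ y) ≤ a * (x ⬝ᵥ x) + a⁻¹ * (y ⬝ᵥ y) := by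
  have h := dotProduct_self_nonneg' (a • x - y)
  simp only [sub_dotProduct, dotProduct_sub, smul_dotProduct, dotProduct_smul, smul_eq_mul,
    dotProduct_comm y x] at h
  have h2 : a⁻¹ * (a * (2 * (x ⬝ᵥ y))) ≤ a⁻¹ * (a * (a * (x ⬝ᵥ x)) + y ⬝ᵥ y) := by
    refine mul_le_mul_of_nonneg_left ?_ (by positivity)
    linarith
  rw [inv_mul_cancel_left₀ ha.ne', mul_add, inv_mul_cancel_left₀ ha.ne'] at h2
  exact h2

/-- Cauchy–Schwarz row by row. The constant depends on the size of the entries only; this uniformity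
makes the gain threshold independent of the individual frequency vector. -/
theorem exists_mulVec_le_of_entries_le (β : ℝ) : ∃ c : ℝ, 0 < c ∧ ∀ A : Matrix ι κ ℝ,
    (∀ i j, |A i j| ≤ β) → ∀ x, (A *ᵥ x) ⬝ᵥ (A *ᵥ x) ≤ c * (x ⬝ᵥ x) := by
  refine ⟨Fintype.card ι * (Fintype.card κ * β ^ 2) + 1, by positivity, fun A hA x => ?_⟩
  have h : ∀ i ∈ Finset.univ, (A *ᵥ x) i * (A *ᵥ x) i ≤ (Fintype.card κ * β ^ 2) * (x ⬝ᵥ x) := by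
    intro i _
    rw [← sq]
    have h1 : ∀ j ∈ Finset.univ, A i j ^ 2 ≤ β ^ 2 := fun j _ => by
      rw [← sq_abs]; exact pow_le_pow_left₀ (abs_nonneg _) (hA i j) 2
    calc (A *ᵥ x) i ^ 2 ≤ (∑ j, A i j ^ 2) * ∑ j, x j ^ 2 :=
          Finset.sum_mul_sq_le_sq_mul_sq _ _ _
      _ ≤ (Fintype.card κ * β ^ 2) * (x ⬝ᵥ x) := by
          have e : ∑ j, x j ^ 2 = x ⬝ᵥ x := by simp [dotProduct, sq]
          rw [e]
          refine mul_le_mul_of_nonneg_right ?_ (dotProduct_self_nonneg' x)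
          simpa using Finset.sum_le_card_nsmul _ _ _ h1
  have h2 := Finset.sum_le_card_nsmul _ _ _ h
  simp only [nsmul_eq_mul, Finset.card_univ] at h2
  have h3 := dotProduct_self_nonneg' x
  change ∑ i, (A *ᵥ x) i * (A *ᵥ x) i ≤ _
  linarith

theorem exists_mulVec_le (A : Matrix ι κ ℝ) :
    ∃ c : ℝ, 0 < c ∧ ∀ x, (A *ᵥ x) ⬝ᵥ (A *ᵥ x) ≤ c * (x ⬝ᵥ x) := by
  obtain ⟨β, hβ⟩ := (Set.finite_range fun p : ι × κ => |A p.1 p.2|).bddAbove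
  obtain ⟨c, hc, h⟩ := exists_mulVec_le_of_entries_le (ι := ι) (κ := κ) β
  exact ⟨c, hc, h A fun i j => hβ ⟨(i, j), rfl⟩⟩

/-- The continuous form attains a positive minimum on the compact unit sphere, and homogeneity
extends the bound to all vectors. -/
theorem exists_le_dotProduct_mulVec_of_pos {A : Matrix ι ι ℝ}
    (hA : ∀ x, x ≠ 0 → 0 < x ⬝ᵥ (A *ᵥ x)) :
    ∃ c : ℝ, 0 < c ∧ ∀ x, c * (x ⬝ᵥ x) ≤ x ⬝ᵥ (A *ᵥ x) := by
  rcases isEmpty_or_nonempty ι with h | h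
  · exact ⟨1, one_pos, fun x => by simp [dotProduct]⟩
  have hcont : Continuous fun x : ι → ℝ => x ⬝ᵥ (A *ᵥ x) := by
    simp only [dotProduct, mulVec]; fun_prop
  obtain ⟨x0, hx0, hmin⟩ := (isCompact_sphere (0 : ι → ℝ) 1).exists_isMinOn
    (NormedSpace.sphere_nonempty.2 zero_le_one) hcont.continuousOn
  set m := x0 ⬝ᵥ (A *ᵥ x0) with hm
  have hm0 : 0 < m := hA x0 fun h0 => by simp [h0] at hx0
  have hcard : (0 : ℝ) < Fintype.card ι := by exact_mod_cast Fintype.card_pos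
  refine ⟨m / Fintype.card ι, by positivity, fun x => ?_⟩
  have h1 : m * ‖x‖ ^ 2 ≤ x ⬝ᵥ (A *ᵥ x) := by
    rcases eq_or_ne x 0 with rfl | hx
    · simp
    have hn : ‖x‖ ≠ 0 := norm_ne_zero_iff.2 hx
    have h2 : m ≤ (‖x‖⁻¹ • x) ⬝ᵥ (A *ᵥ (‖x‖⁻¹ • x)) :=
      hmin (by simp [norm_smul, hn])
    rw [mulVec_smul, dotProduct_smul, smul_dotProduct, smul_eq_mul, smul_eq_mul] at h2
    calc m * ‖x‖ ^ 2 ≤ (‖x‖⁻¹ * (‖x‖⁻¹ * (x ⬝ᵥ (A *ᵥ x)))) * ‖x‖ ^ 2 := by gcongr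
      _ = x ⬝ᵥ (A *ᵥ x) := by field_simp
  refine le_trans ?_ h1
  rw [div_mul_eq_mul_div, div_le_iff₀ hcard]
  have := mul_le_mul_of_nonneg_left (dotProduct_self_le_norm_sq x) hm0.le
  linarith

theorem exists_le_dotProduct_mulVec {A : Matrix ι ι ℝ} (hA : A.PosDef) :
    ∃ c : ℝ, 0 < c ∧ ∀ x, c * (x ⬝ᵥ x) ≤ x ⬝ᵥ (A *ᵥ x) :=
  exists_le_dotProduct_mulVec_of_pos fun x hx => by simpa using hA.dotProduct_mulVec_pos hx

theorem dotProduct_mulVec_comm {A : Matrix ι ι ℝ} (hA : A.IsSymm) (x y : ι → ℝ) :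
    x ⬝ᵥ (A *ᵥ y) = y ⬝ᵥ (A *ᵥ x) := by
  rw [dotProduct_mulVec, ← mulVec_transpose, hA.eq, dotProduct_comm]

theorem dotProduct_mulVec_transpose (A : Matrix ι κ ℝ) (x : ι → ℝ) (y : κ → ℝ) :
    x ⬝ᵥ (A *ᵥ y) = (Aᵀ *ᵥ x) ⬝ᵥ y := by
  rw [dotProduct_mulVec, mulVec_transpose]

end Quadratic

/-! ### Hurwitz matrices and Lyapunov's inequality -/

section Lyapunov

variable {ι : Type*} [Fintype ι] [DecidableEq ι]

attribute [local instance] Matrix.linftyOpNormedRing Matrix.linftyOpNormedAlgebra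

/-- Powers of a complex matrix with all eigenvalues in the open unit disc become small. -/
theorem exists_pow_norm_lt {A : Matrix ι ι ℂ} (hA : ∀ z ∈ spectrum ℂ A, ‖z‖ < 1) {e : ℝ}
    (he : 0 < e) : ∃ k : ℕ, ‖A ^ k‖ < e := by
  rcases isEmpty_or_nonempty ι with h | h
  · exact ⟨0, by rw [Subsingleton.elim (A ^ 0) 0, norm_zero]; exact he⟩
  have hr : spectralRadius ℂ A < ((1 : NNReal) : ENNReal) :=
    spectrum.spectralRadius_lt_of_forall_lt A fun z hz => by
      rw [← NNReal.coe_lt_coe]; simpa using hA z hz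
  obtain ⟨s, hs1, hs2⟩ := ENNReal.lt_iff_exists_nnreal_btwn.1 hr
  -- Gelfand's formula: eventually `‖A ^ k‖` is below `s ^ k` for some `s < 1`.
  have hev := (spectrum.pow_norm_pow_one_div_tendsto_nhds_spectralRadius A).eventually_lt_const hs1
  have hs2' : (s : ℝ) < 1 := by exact_mod_cast hs2
  have hpow := (tendsto_pow_atTop_nhds_zero_of_lt_one s.2 hs2').eventually_lt_const he
  obtain ⟨k, ⟨hk1, hk2⟩, hk3⟩ := ((hev.and hpow).and (eventually_gt_atTop 0)).exists
  refine ⟨k, lt_of_le_of_lt ?_ hk2⟩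
  rw [← ENNReal.ofReal_coe_nnreal, ENNReal.ofReal_lt_ofReal_iff_of_nonneg (by positivity)] at hk1
  have := pow_le_pow_left₀ (by positivity) hk1.le k
  rwa [← Real.rpow_natCast, ← Real.rpow_mul (norm_nonneg _), one_div,
    inv_mul_cancel₀ (by exact_mod_cast hk3.ne'), Real.rpow_one] at this

/-- The Cayley transform maps the open left half-plane into the open unit disc. -/
theorem norm_lt_one_of_mem_spectrum_cayley {A B : Matrix ι ι ℂ} (hB : B * (1 - A) = 1)
    (hA : ∀ z ∈ spectrum ℂ A, z.re < 0) : ∀ z ∈ spectrum ℂ ((1 + A) * B), ‖z‖ < 1 := by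
  intro z hz
  by_contra! hcon
  refine hz ?_
  have hB' : (1 - A) * B = 1 := mul_eq_one_comm.1 hB
  have hBu : IsUnit B := IsUnit.of_mul_eq_one _ hB
  -- Up to invertible factors, the resolvent of the transform at `z` is that of `A` at `(z - 1) / (z
  -- + 1)`. The real part of this point is `(|z|² - 1) / |z + 1|²`, nonnegative when `|z| ≥ 1`; only
  -- `z = -1` is treated separately.
  have e1 : algebraMap ℂ (Matrix ι ι ℂ) z - (1 + A) * B
      = ((z - 1) • (1 : Matrix ι ι ℂ) - (z + 1) • A) * B := by
    have : algebraMap ℂ (Matrix ι ι ℂ) z = z • ((1 - A) * B) := by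
      rw [hB', Algebra.algebraMap_eq_smul_one]
    rw [this, ← smul_mul_assoc, ← sub_mul]
    congr 1
    module
  change IsUnit _
  rw [e1]
  refine IsUnit.mul ?_ hBu
  by_cases hz1 : z + 1 = 0
  · rw [hz1, zero_smul, sub_zero]
    have : z - 1 ≠ 0 := fun h => by
      have h2 : (2 : ℂ) = (z + 1) - (z - 1) := by ring
      rw [hz1, h] at h2; norm_num at h2
    exact (isUnit_one.smul (Units.mk0 _ this))
  have hw : (z - 1) / (z + 1) ∉ spectrum ℂ A := fun hmem => by
    have h1 := hA _ hmem
    have h2 : ((z - 1) / (z + 1)).re = (Complex.normSq z - 1) / Complex.normSq (z + 1) := by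
      rw [Complex.div_re, ← add_div]
      congr 1
      simp [Complex.normSq_apply]; ring
    rw [h2] at h1
    have h3 : 1 ≤ Complex.normSq z := by
      rw [Complex.normSq_eq_norm_sq]; nlinarith
    exact absurd h1 (not_lt.2 (div_nonneg (by linarith) (Complex.normSq_nonneg _)))
  have hu : IsUnit (algebraMap ℂ (Matrix ι ι ℂ) ((z - 1) / (z + 1)) - A) := by
    simpa [spectrum.mem_iff] using hw
  have e2 : (z - 1) • (1 : Matrix ι ι ℂ) - (z + 1) • A
      = (Units.mk0 _ hz1) • (algebraMap ℂ (Matrix ι ι ℂ) ((z - 1) / (z + 1)) - A) := by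
    rw [Algebra.algebraMap_eq_smul_one, Units.smul_mk0, smul_sub, smul_smul, mul_div_cancel₀ _ hz1]
  rw [e2]
  exact hu.smul _

theorem norm_entry_le_linftyOpNorm (A : Matrix ι ι ℂ) (i j : ι) : ‖A i j‖ ≤ ‖A‖ := by
  have h1 : ‖A i j‖₊ ≤ ∑ j, ‖A i j‖₊ :=
    Finset.single_le_sum (f := fun j => ‖A i j‖₊) (fun _ _ => zero_le) (Finset.mem_univ j)
  have h2 : ∑ j, ‖A i j‖₊ ≤ ‖A‖₊ := by
    rw [Matrix.linfty_opNNNorm_def]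
    exact Finset.le_sup (f := fun i => ∑ j, ‖A i j‖₊) (Finset.mem_univ i)
  exact_mod_cast h1.trans h2

theorem exists_real_pow_le {A : Matrix ι ι ℝ}
    (hA : ∀ z ∈ spectrum ℂ (A.map (algebraMap ℝ ℂ)), ‖z‖ < 1) :
    ∃ k : ℕ, ∀ x, (A ^ k *ᵥ x) ⬝ᵥ (A ^ k *ᵥ x) ≤ (1 / 2) * (x ⬝ᵥ x) := by
  obtain ⟨c, hc, h⟩ := exists_mulVec_le_of_entries_le (ι := ι) (κ := ι) 1
  -- Entries of `A ^ k` below `e` make `e⁻¹ • A ^ k` admissible for the entrywise estimate, and `e *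
  -- e * c ≤ 1 / 2`.
  set e := min 1 (1 / (2 * c)) with he
  have he0 : 0 < e := by positivity
  obtain ⟨k, hk⟩ := exists_pow_norm_lt hA he0
  have hent : ∀ i j, |(A ^ k) i j| ≤ e := fun i j => by
    have h1 : A.map (algebraMap ℝ ℂ) ^ k = (A ^ k).map (algebraMap ℝ ℂ) :=
      (map_pow (algebraMap ℝ ℂ).mapMatrix A k).symm
    rw [h1] at hk
    have h2 := norm_entry_le_linftyOpNorm ((A ^ k).map (algebraMap ℝ ℂ)) i j
    have h6 : ‖((A ^ k).map (algebraMap ℝ ℂ)) i j‖ = |(A ^ k) i j| := by simp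
    rw [← h6]; exact h2.trans hk.le
  refine ⟨k, fun x => ?_⟩
  have h1 := h (e⁻¹ • A ^ k) (fun i j => by
    rw [Matrix.smul_apply, smul_eq_mul, abs_mul, abs_of_pos (inv_pos.2 he0), inv_mul_le_iff₀ he0, mul_one]
    exact hent i j) x
  rw [smul_mulVec, smul_dotProduct, dotProduct_smul, smul_eq_mul, smul_eq_mul,
    inv_mul_le_iff₀ he0, inv_mul_le_iff₀ he0] at h1
  refine h1.trans ?_
  have h2 : e * e * c ≤ 1 / 2 := by
    have e1 : e ≤ 1 := min_le_left _ _
    have e2 : e ≤ 1 / (2 * c) := min_le_right _ _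
    calc e * e * c ≤ 1 * (1 / (2 * c)) * c := by gcongr
      _ = 1 / 2 := by field_simp
  have := mul_le_mul_of_nonneg_right h2 (dotProduct_self_nonneg' x)
  linarith

/-- Lyapunov's theorem: a matrix all of whose eigenvalues have negative real part admits a
quadratic Lyapunov function. -/
theorem exists_lyapunov {M : Matrix ι ι ℝ}
    (hM : ∀ z ∈ spectrum ℂ (M.map (algebraMap ℝ ℂ)), z.re < 0) :
    ∃ P : Matrix ι ι ℝ, P.IsSymm ∧ (∃ c : ℝ, 0 < c ∧ ∀ x, c * (x ⬝ᵥ x) ≤ x ⬝ᵥ (P *ᵥ x)) ∧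
      ∀ x, x ⬝ᵥ (P *ᵥ (M *ᵥ x)) ≤ -(x ⬝ᵥ x) := by
  set φ := (algebraMap ℝ ℂ).mapMatrix (m := ι)
  have h1 : IsUnit (1 - M) := by
    have hu : IsUnit (algebraMap ℂ (Matrix ι ι ℂ) 1 - φ M) := by
      have : (1 : ℂ) ∉ spectrum ℂ (φ M) := fun h => by
        have := hM 1 h; norm_num at this
      simpa [spectrum.mem_iff] using this
    rw [map_one, ← map_one φ, ← map_sub, Matrix.isUnit_iff_isUnit_det, ← RingHom.map_det] at hu
    rw [Matrix.isUnit_iff_isUnit_det]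
    simpa [isUnit_iff_ne_zero] using hu
  obtain ⟨B, hB⟩ := h1.exists_left_inv
  have hBφ : φ B * (1 - φ M) = 1 := by rw [← map_one φ, ← map_sub, ← map_mul, hB]
  have hA := norm_lt_one_of_mem_spectrum_cayley hBφ hM
  rw [← map_one φ, ← map_add, ← map_mul] at hA
  set A := (1 + M) * B with hAdef
  obtain ⟨k, hk⟩ := exists_real_pow_le hA
  set Q : Matrix ι ι ℝ := 1 + ∑ j ∈ Finset.range k, (A ^ j)ᵀ * A ^ j with hQ
  -- A truncated Stein series for the Cayley transform `A`. It telescopes to `|y|² - |A ^ k y|²`,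
  -- which is at least half of `|y|²`, so no infinite sum or matrix exponential is needed.
  set Q' : Matrix ι ι ℝ := ∑ j ∈ Finset.range k, (A ^ j)ᵀ * A ^ j with hQ'
  have hQs : Q'.IsSymm := by
    simp [Matrix.IsSymm, hQ', Matrix.transpose_sum, Matrix.transpose_mul]
  have hquad : ∀ x, x ⬝ᵥ (Q' *ᵥ x) = ∑ j ∈ Finset.range k, (A ^ j *ᵥ x) ⬝ᵥ (A ^ j *ᵥ x) := by
    intro x
    rw [hQ', Matrix.sum_mulVec, dotProduct_sum]
    refine Finset.sum_congr rfl fun j _ => ?_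
    rw [← mulVec_mulVec, dotProduct_mulVec_transpose, transpose_transpose]
  have hstein : ∀ y, y ⬝ᵥ (Q' *ᵥ y) - (A *ᵥ y) ⬝ᵥ (Q' *ᵥ (A *ᵥ y))
      = y ⬝ᵥ y - (A ^ k *ᵥ y) ⬝ᵥ (A ^ k *ᵥ y) := by
    intro y
    have := Finset.sum_range_sub' (fun j => (A ^ j *ᵥ y) ⬝ᵥ (A ^ j *ᵥ y)) k
    rw [hquad, hquad, ← Finset.sum_sub_distrib]
    simp only [mulVec_mulVec, ← pow_succ]
    rw [this]; simp
  obtain ⟨b, hb, hBb⟩ := exists_mulVec_le B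
  have hlyap : ∀ x, x ⬝ᵥ (Q' *ᵥ (M *ᵥ x)) ≤ -((1 / (8 * b)) * (x ⬝ᵥ x)) := by
    intro x
    -- With this substitution `A y = (1 + M) x`, and the Stein difference becomes `-4 xᵀ Q' M x`.
    -- The bound `b` for `B = (1 - M)⁻¹` converts `|y|²` back to `|x|²`; the final scaling by `8 *
    -- b` normalizes the constant to one.
    set y := (1 - M) *ᵥ x with hy
    have hyx : y = x - M *ᵥ x := by rw [hy, sub_mulVec, one_mulVec]
    have hBy : B *ᵥ y = x := by rw [hy, mulVec_mulVec, hB, one_mulVec]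
    have hAy : A *ᵥ y = x + M *ᵥ x := by
      rw [hAdef, ← mulVec_mulVec, hBy, add_mulVec, one_mulVec]
    have h2 := hstein y
    rw [hAy, hyx, mulVec_add, mulVec_sub] at h2
    simp only [sub_dotProduct, add_dotProduct, dotProduct_sub, dotProduct_add] at h2
    rw [dotProduct_mulVec_comm hQs (M *ᵥ x) x] at h2
    have h3 := hk y
    have h4 := hBb y
    rw [hBy] at h4
    have h5 : -(4 * (x ⬝ᵥ (Q' *ᵥ (M *ᵥ x)))) = y ⬝ᵥ y - (A ^ k *ᵥ y) ⬝ᵥ (A ^ k *ᵥ y) := by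
      rw [hyx]
      simp only [sub_dotProduct, dotProduct_sub]
      linarith
    have h6 : (1 / (8 * b)) * (x ⬝ᵥ x) ≤ (1 / 8) * (y ⬝ᵥ y) := by
      rw [one_div, mul_inv, mul_assoc, one_div]
      refine mul_le_mul_of_nonneg_left ?_ (by norm_num)
      rwa [inv_mul_le_iff₀ hb]
    linarith
  have hk0 : ∀ x, x ≠ 0 → 0 < x ⬝ᵥ (Q' *ᵥ x) := by
    intro x hx
    rw [hquad]
    have hpos : 0 < x ⬝ᵥ x := lt_of_lt_of_le (by positivity) (norm_sq_le_dotProduct_self x)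
    have hk1 : k ≠ 0 := by
      rintro rfl
      have := hk x
      rw [pow_zero, one_mulVec] at this
      linarith
    refine lt_of_lt_of_le ?_ (Finset.single_le_sum
      (f := fun j => (A ^ j *ᵥ x) ⬝ᵥ (A ^ j *ᵥ x)) (fun j _ => dotProduct_self_nonneg' _)
      (Finset.mem_range.2 (Nat.pos_of_ne_zero hk1)))
    simpa using hpos
  obtain ⟨c, hc, hcQ⟩ := exists_le_dotProduct_mulVec_of_pos hk0
  refine ⟨(8 * b) • Q', hQs.smul _, ⟨8 * b * c, by positivity, fun x => ?_⟩, fun x => ?_⟩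
  · rw [smul_mulVec, dotProduct_smul, smul_eq_mul, mul_assoc]
    exact mul_le_mul_of_nonneg_left (hcQ x) (by positivity)
  · rw [smul_mulVec, dotProduct_smul, smul_eq_mul]
    have := mul_le_mul_of_nonneg_left (hlyap x) (show 0 ≤ 8 * b by positivity)
    refine this.trans (le_of_eq ?_)
    field_simp

theorem blockDiagonal'_mulVec_apply {o : Type*} [Fintype o] [DecidableEq o] {m : o → Type*}
    [∀ i, Fintype (m i)] (A : (i : o) → Matrix (m i) (m i) ℝ) (x : ((i : o) × m i) → ℝ)
    (i : o) (j : m i) :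
    (blockDiagonal' A *ᵥ x) ⟨i, j⟩ = (A i *ᵥ fun l => x ⟨i, l⟩) j := by
  simp only [mulVec, dotProduct, Fintype.sum_sigma]
  rw [Finset.sum_eq_single i]
  · simp [blockDiagonal'_apply_eq]
  · intro i' _ hi'
    exact Finset.sum_eq_zero fun l _ => by rw [blockDiagonal'_apply_ne _ _ _ hi'.symm, zero_mul]
  · simp

theorem exists_lyapunov_blockDiagonal' {r : Fin 3 → ℕ}
    {M : (i : Fin 3) → Matrix (Fin (r i)) (Fin (r i)) ℝ} (hM : ∀ i, IsHurwitz (M i)) :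
    ∃ P : Matrix (IMIdx r) (IMIdx r) ℝ, P.IsSymm ∧
      (∃ c : ℝ, 0 < c ∧ ∀ x, c * (x ⬝ᵥ x) ≤ x ⬝ᵥ (P *ᵥ x)) ∧
      ∀ x, x ⬝ᵥ (P *ᵥ (blockDiagonal' M *ᵥ x)) ≤ -(x ⬝ᵥ x) := by
  choose P hP hc hPM using fun i => exists_lyapunov (hM i)
  choose c hc using hc
  have hdot : ∀ x y : IMIdx r → ℝ, x ⬝ᵥ y = ∑ i, (fun j => x ⟨i, j⟩) ⬝ᵥ fun j => y ⟨i, j⟩ :=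
    fun x y => by simp only [dotProduct, Fintype.sum_sigma]
  have hmul : ∀ (A : (i : Fin 3) → Matrix (Fin (r i)) (Fin (r i)) ℝ) (x : IMIdx r → ℝ) (i),
      (fun j => (blockDiagonal' A *ᵥ x) ⟨i, j⟩) = A i *ᵥ fun j => x ⟨i, j⟩ :=
    fun A x i => funext fun j => blockDiagonal'_mulVec_apply A x i j
  refine ⟨blockDiagonal' P, ?_, ?_, fun x => ?_⟩
  · rw [Matrix.IsSymm, blockDiagonal'_transpose]
    exact congrArg _ (funext fun i => hP i)
  · refine exists_le_dotProduct_mulVec_of_pos fun x hx => ?_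
    obtain ⟨⟨i, j⟩, hij⟩ := Function.ne_iff.1 hx
    have hnn : ∀ i, 0 ≤ (fun j => x ⟨i, j⟩) ⬝ᵥ (P i *ᵥ fun j => x ⟨i, j⟩) := fun i =>
      (mul_nonneg (hc i).1.le (dotProduct_self_nonneg' _)).trans ((hc i).2 _)
    rw [hdot]
    simp only [hmul]
    refine Finset.sum_pos' (fun i _ => hnn i) ⟨i, Finset.mem_univ i, ?_⟩
    have hne : (fun j => x ⟨i, j⟩) ≠ 0 := fun h => hij (congrFun h j)
    have : 0 < ‖(fun j => x ⟨i, j⟩)‖ := norm_pos_iff.2 hne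
    exact lt_of_lt_of_le (mul_pos (hc i).1 (lt_of_lt_of_le (by positivity)
      (norm_sq_le_dotProduct_self _))) ((hc i).2 _)
  · rw [hdot, hdot x x, ← Finset.sum_neg_distrib]
    simp only [hmul]
    exact Finset.sum_le_sum fun i _ => hPM i _

end Lyapunov

end

section

/-! ### Characteristic polynomials of exosystems -/

section ExoPoly

open Polynomial

theorem degree_sum_lt {r : ℕ} (a : Fin r → ℝ) :
    (∑ j, C (a j) * X ^ (j : ℕ) : ℝ[X]).degree < r :=
  degree_sum_fin_lt a

theorem exoPoly_monic {r : ℕ} (a : Fin r → ℝ) : (exoPoly a).Monic :=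
  (monic_X_pow r).sub_of_left (by rw [degree_X_pow]; exact degree_sum_lt a)

theorem exoPoly_natDegree {r : ℕ} (a : Fin r → ℝ) : (exoPoly a).natDegree = r := by
  refine natDegree_eq_of_degree_eq_some ?_
  rw [exoPoly, degree_sub_eq_left_of_degree_lt (by rw [degree_X_pow]; exact degree_sum_lt a),
    degree_X_pow]

theorem aeval_exoPoly {A : Type*} [Ring A] [Algebra ℝ A] {r : ℕ} (a : Fin r → ℝ) (x : A) :
    aeval x (exoPoly a) = x ^ r - ∑ j, a j • x ^ (j : ℕ) := by
  simp [exoPoly, Algebra.smul_def]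

theorem eval_zero_exoPoly {r : ℕ} (hr : 0 < r) (a : Fin r → ℝ) :
    (exoPoly a).eval 0 = -a ⟨0, hr⟩ := by
  rw [← coe_aeval_eq_eval, aeval_exoPoly, Finset.sum_eq_single ⟨0, hr⟩]
  · simp [hr.ne']
  · intro j _ hj
    have : (j : ℕ) ≠ 0 := fun h => hj (Fin.ext h)
    simp [this]
  · simp

theorem exists_isRoot_of_odd_natDegree {p : ℝ[X]} (hp : p.Monic) (hodd : Odd p.natDegree) :
    ∃ x, p.IsRoot x := by
  have hnd : 0 < p.natDegree := hodd.pos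
  have h1 : Tendsto (fun x => p.eval x) atTop atTop :=
    p.tendsto_atTop_of_leadingCoeff_nonneg (natDegree_pos_iff_degree_pos.1 hnd)
      (by rw [hp.leadingCoeff]; exact zero_le_one)
  have hcd : (p.comp (-X)).natDegree = p.natDegree := by
    rw [natDegree_comp, natDegree_neg, natDegree_X, mul_one]
  have h2 : Tendsto (fun x => (p.comp (-X)).eval x) atTop atBot := by
    refine (p.comp (-X)).tendsto_atBot_of_leadingCoeff_nonpos
      (natDegree_pos_iff_degree_pos.1 (hcd ▸ hnd)) ?_
    rw [leadingCoeff_comp (by simp), hp.leadingCoeff, leadingCoeff_neg, leadingCoeff_X,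
      hodd.neg_one_pow]
    norm_num
  have h3 : Tendsto (fun x => p.eval x) atBot atBot := by
    have := h2.comp tendsto_neg_atBot_atTop
    refine this.congr fun x => ?_
    simp [eval_comp]
  exact p.continuous.surjective h1 h3 0

theorem IsExosystem.eq_zero_of_isRoot {r : ℕ} {a : Fin r → ℝ} (ha : IsExosystem a) {x : ℝ}
    (hx : (exoPoly a).IsRoot x) : x = 0 := by
  have : (x : ℂ) ∈ ((exoPoly a).map (algebraMap ℝ ℂ)).roots := by
    rw [mem_roots ((exoPoly_monic a).map _).ne_zero]
    exact hx.map
  simpa using ha.2 _ this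

/-- Zero is an eigenvalue of an exosystem exactly if its order is odd. -/
theorem IsExosystem.coeff_zero_iff {r : ℕ} (hr : 0 < r) {a : Fin r → ℝ} (ha : IsExosystem a) :
    a ⟨0, hr⟩ = 0 ↔ Odd r := by
  have hev := eval_zero_exoPoly hr a
  constructor
  · intro h0
    by_contra hodd
    rw [h0, neg_zero] at hev
    -- For even order, dividing out the root zero leaves a polynomial of odd degree. Its real root
    -- is also a root of the exosystem, hence zero again, which contradicts simplicity.
    obtain ⟨q, hq⟩ := dvd_iff_isRoot.2 (show (exoPoly a).IsRoot 0 from hev)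
    have hX : (X - C 0 : ℝ[X]).Monic := monic_X_sub_C 0
    have hqm : q.Monic := hX.of_mul_monic_left (hq ▸ exoPoly_monic a)
    have hqd : q.natDegree + 1 = r := by
      have := exoPoly_natDegree a
      rw [hq, hX.natDegree_mul hqm, natDegree_X_sub_C] at this
      omega
    have hqodd : Odd q.natDegree := by
      rw [← hqd] at hodd
      rcases Nat.even_or_odd q.natDegree with h | h
      · exact absurd h.add_one hodd
      · exact h
    obtain ⟨x, hx⟩ := exists_isRoot_of_odd_natDegree hqm hqodd
    have hx0 : x = 0 := ha.eq_zero_of_isRoot (by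
      rw [hq, IsRoot.def, eval_mul, hx.eq_zero, mul_zero])
    rw [hx0] at hx
    obtain ⟨s, hs⟩ := dvd_iff_isRoot.2 hx
    have hne := ((exoPoly_monic a).map (algebraMap ℝ ℂ)).ne_zero
    have h2 : 2 ≤ rootMultiplicity 0 ((exoPoly a).map (algebraMap ℝ ℂ)) := by
      rw [le_rootMultiplicity_iff hne, hq, hs]
      refine ⟨s.map (algebraMap ℝ ℂ), ?_⟩
      simp only [Polynomial.map_mul, map_X, map_zero, sub_zero]
      ring
    have h3 := Multiset.nodup_iff_count_le_one.1 ha.1 0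
    rw [count_roots] at h3
    omega
  · intro hodd
    obtain ⟨x, hx⟩ := exists_isRoot_of_odd_natDegree (exoPoly_monic a)
      (by rwa [exoPoly_natDegree])
    have hx0 := ha.eq_zero_of_isRoot hx
    rw [hx0, IsRoot.def, hev] at hx
    linarith

end ExoPoly

/-! ### The Sylvester equation -/

section Sylvester

variable {r : ℕ}

theorem outRow_eq_single (hr : 0 < r) : outRow r = Pi.single ⟨0, hr⟩ 1 := by
  ext k
  by_cases hk : k = ⟨0, hr⟩
  · subst hk; simp [outRow]
  · have : (k : ℕ) ≠ 0 := fun h => hk (Fin.ext h)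
    simp [outRow, this, Pi.single_eq_of_ne hk]

theorem single_vecMul_companion (a : Fin r → ℝ) {k : ℕ} (hk : k + 1 < r) :
    Pi.single ⟨k, by omega⟩ 1 ᵥ* companion a = Pi.single ⟨k + 1, hk⟩ (1 : ℝ) := by
  rw [single_one_vecMul]
  ext j
  by_cases hj : j = ⟨k + 1, hk⟩
  · subst hj; simp [companion, Matrix.row, hk.ne]
  · have : (j : ℕ) ≠ k + 1 := fun h => hj (Fin.ext h)
    simp [companion, Matrix.row, hk.ne, this, Pi.single_eq_of_ne hj]

/-- Each multiplication by the companion matrix shifts the unit row by one place. This is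
observability of `(Ψ, Φ)` in explicit form, used both for Cayley–Hamilton and for the kernel
argument in `isUnit_of_sylvester`. -/
theorem outRow_vecMul_companion_pow (a : Fin r → ℝ) {k : ℕ} (hk : k < r) :
    outRow r ᵥ* companion a ^ k = Pi.single ⟨k, hk⟩ 1 := by
  induction k with
  | zero => rw [pow_zero, vecMul_one, outRow_eq_single]
  | succ k ih =>
    rw [pow_succ, ← vecMul_vecMul, ih (by omega), single_vecMul_companion a hk]

theorem outRow_vecMul_companion_pow_self (hr : 0 < r) (a : Fin r → ℝ) :
    outRow r ᵥ* companion a ^ r = a := by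
  obtain ⟨k, rfl⟩ : ∃ k, r = k + 1 := ⟨r - 1, by omega⟩
  rw [pow_succ, ← vecMul_vecMul, outRow_vecMul_companion_pow a (Nat.lt_succ_self k),
    single_one_vecMul]
  ext j
  simp [companion, Matrix.row]

/-- The row `Ψ p(Φ)` vanishes because `Ψ Φ ^ r` is the coefficient row `a`. All other rows are `Ψ Φ
^ i p(Φ)`, and `p(Φ)` commutes with powers of `Φ`. -/
theorem aeval_companion_exoPoly (hr : 0 < r) (a : Fin r → ℝ) :
    Polynomial.aeval (companion a) (exoPoly a) = 0 := by
  have h0 : outRow r ᵥ* Polynomial.aeval (companion a) (exoPoly a) = 0 := by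
    rw [aeval_exoPoly, vecMul_sub, outRow_vecMul_companion_pow_self hr, vecMul_sum]
    simp only [vecMul_smul, outRow_vecMul_companion_pow a (Fin.isLt _), Fin.eta]
    rw [sub_eq_zero]
    exact pi_eq_sum_univ' a
  ext i j
  have h1 : Pi.single i 1 ᵥ* Polynomial.aeval (companion a) (exoPoly a) = 0 := by
    rw [← outRow_vecMul_companion_pow a i.2, vecMul_vecMul]
    have : companion a ^ (i : ℕ) * Polynomial.aeval (companion a) (exoPoly a)
        = Polynomial.aeval (companion a) (exoPoly a) * companion a ^ (i : ℕ) := by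
      rw [← Polynomial.aeval_X_pow (R := ℝ) (companion a), ← map_mul, ← map_mul, mul_comm]
    rw [this, ← vecMul_vecMul, h0, zero_vecMul]
  rw [single_one_vecMul] at h1
  exact congrFun h1 j

/-- By spectral mapping a zero eigenvalue of `p(M)` would be an eigenvalue of `M` that is a root of
`p`. The former lie in the open left half-plane, the latter on the imaginary axis. -/
theorem isUnit_aeval_exoPoly (hr : 0 < r) {a : Fin r → ℝ} (ha : IsExosystem a)
    {M : Matrix (Fin r) (Fin r) ℝ} (hM : IsHurwitz M) :
    IsUnit (Polynomial.aeval M (exoPoly a)) := by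
  set φ := (algebraMap ℝ ℂ).mapMatrix (m := Fin r)
  set p := (exoPoly a).map (algebraMap ℝ ℂ)
  have hpm : p.Monic := (exoPoly_monic a).map _
  have hmap : φ (Polynomial.aeval M (exoPoly a)) = Polynomial.aeval (φ M) p := by
    simp only [p]
    rw [aeval_exoPoly]
    simp only [exoPoly, Polynomial.map_sub, Polynomial.map_sum, Polynomial.map_mul,
      Polynomial.map_pow, Polynomial.map_X, Polynomial.map_C, map_sub, map_sum, map_mul, map_pow,
      Polynomial.aeval_X, Polynomial.aeval_C]
    congr 1
    refine Finset.sum_congr rfl fun j _ => ?_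
    rw [← Algebra.smul_def, ← map_pow]
    ext i l
    simp [φ]
  have hu : IsUnit (Polynomial.aeval (φ M) p) := by
    rw [← spectrum.zero_notMem_iff ℂ]
    rw [spectrum.map_polynomial_aeval_of_degree_pos]
    · rintro ⟨z, hz, hz0⟩
      have h1 := ha.2 z ((Polynomial.mem_roots hpm.ne_zero).2 hz0)
      have h2 := hM z hz
      linarith
    · rw [← Polynomial.natDegree_pos_iff_degree_pos,
        (exoPoly_monic a).natDegree_map, exoPoly_natDegree]
      exact hr
  rw [← hmap, Matrix.isUnit_iff_isUnit_det, ← RingHom.map_det] at hu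
  rw [Matrix.isUnit_iff_isUnit_det]
  simpa [isUnit_iff_ne_zero] using hu

/-- Intertwining passes to polynomials, so `X p(Φ) = p(M) X`; the left side is zero and `p(M)` is
invertible. -/
theorem eq_zero_of_mul_companion_eq (hr : 0 < r) {a : Fin r → ℝ} (ha : IsExosystem a)
    {M : Matrix (Fin r) (Fin r) ℝ} (hM : IsHurwitz M) {X : Matrix (Fin r) (Fin r) ℝ}
    (hX : X * companion a = M * X) : X = 0 := by
  have hpow : ∀ k : ℕ, X * companion a ^ k = M ^ k * X := fun k =>
    (show SemiconjBy X (companion a) M from hX).pow_right k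
  have h1 : X * Polynomial.aeval (companion a) (exoPoly a)
      = Polynomial.aeval M (exoPoly a) * X := by
    rw [aeval_exoPoly, aeval_exoPoly, mul_sub, sub_mul, Finset.mul_sum, Finset.sum_mul, hpow]
    simp only [mul_smul_comm, smul_mul_assoc, hpow]
  rw [aeval_companion_exoPoly hr, mul_zero] at h1
  exact ((isUnit_aeval_exoPoly hr ha hM).mul_right_eq_zero).1 h1.symm

/-- Solutions of the Sylvester equation of a controllable pair are nonsingular. -/
theorem isUnit_of_sylvester {a : Fin r → ℝ} {M : Matrix (Fin r) (Fin r) ℝ} {N : Fin r → ℝ}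
    (hMN : IsControllable M N) {T : Matrix (Fin r) (Fin r) ℝ}
    (hT : T * companion a - M * T = vecMulVec N (outRow r)) : IsUnit T := by
  have hTw : ∀ w, T *ᵥ (companion a *ᵥ w) = M *ᵥ (T *ᵥ w) + (outRow r ⬝ᵥ w) • N := by
    intro w
    have := congrArg (fun A => A *ᵥ w) hT
    simp only [sub_mulVec, vecMulVec_mulVec, op_smul_eq_smul] at this
    rw [mulVec_mulVec, mulVec_mulVec, ← this, add_sub_cancel]
  -- If `N` lies in the range of `T`, that range is `M`-invariant and contains all `M ^ k N`, so
  -- controllability makes `T` surjective. Otherwise the relation forces the kernel of `T` to be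
  -- `Φ`-invariant and annihilated by `Ψ`, so observability makes `T` injective.
  by_cases hN : ∃ w, T *ᵥ w = N
  · obtain ⟨w0, hw0⟩ := hN
    have hpow : ∀ k : ℕ, ∃ w, T *ᵥ w = M ^ k *ᵥ N := by
      intro k
      induction k with
      | zero => exact ⟨w0, by rw [pow_zero, one_mulVec, hw0]⟩
      | succ k ih =>
        obtain ⟨w, hw⟩ := ih
        refine ⟨companion a *ᵥ w - (outRow r ⬝ᵥ w) • w0, ?_⟩
        rw [mulVec_sub, mulVec_smul, hTw, hw0, hw, add_sub_cancel_right, mulVec_mulVec, pow_succ']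
    choose W hW using hpow
    have hfac : (Matrix.of fun j k : Fin r => ((M ^ (k : ℕ)) *ᵥ N) j)
        = T * Matrix.of fun j k : Fin r => W k j := by
      ext j k
      rw [of_apply, ← hW]
      rfl
    have hrank : T.rank = r := by
      refine le_antisymm (by simpa using T.rank_le_width) ?_
      calc r = (T * Matrix.of fun j k : Fin r => W k j).rank := by rw [← hfac]; exact hMN.symm
        _ ≤ T.rank := rank_mul_le_left _ _
    rw [← mulVec_surjective_iff_isUnit]
    have : LinearMap.range T.mulVecLin = ⊤ := by
      apply Submodule.eq_top_of_finrank_eq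
      rw [← Matrix.rank]
      simpa using hrank
    exact LinearMap.range_eq_top.1 this
  · rw [← mulVec_injective_iff_isUnit]
    have hker : ∀ w, T *ᵥ w = 0 → outRow r ⬝ᵥ w = 0 ∧ T *ᵥ (companion a *ᵥ w) = 0 := by
      intro w hw
      have h1 := hTw w
      rw [hw, mulVec_zero, zero_add] at h1
      have h2 : outRow r ⬝ᵥ w = 0 := by
        by_contra hne
        exact hN ⟨(outRow r ⬝ᵥ w)⁻¹ • (companion a *ᵥ w), by
          rw [mulVec_smul, h1, smul_smul, inv_mul_cancel₀ hne, one_smul]⟩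
      exact ⟨h2, by rw [h1, h2, zero_smul]⟩
    have hkerpow : ∀ w, T *ᵥ w = 0 → ∀ k : ℕ, T *ᵥ (companion a ^ k *ᵥ w) = 0 := by
      intro w hw k
      induction k with
      | zero => rwa [pow_zero, one_mulVec]
      | succ k ih => rw [pow_succ', ← mulVec_mulVec]; exact (hker _ ih).2
    refine (injective_iff_map_eq_zero T.mulVecLin).2 fun w hw => ?_
    ext k
    have h1 := (hker _ (hkerpow w hw k)).1
    rw [dotProduct_mulVec, outRow_vecMul_companion_pow a k.2] at h1
    simpa using h1

/-- The Sylvester operator is injective because the spectra of `Φ` and `M` are disjoint. In finite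
dimension it is then bijective, and controllability gives nonsingularity. -/
theorem existsUnique_isSylvesterSol (hr : 0 < r) {a : Fin r → ℝ} (ha : IsExosystem a)
    {M : Matrix (Fin r) (Fin r) ℝ} (hM : IsHurwitz M) {N : Fin r → ℝ}
    (hMN : IsControllable M N) : ∃! T, IsSylvesterSol a M N T := by
  let S : Matrix (Fin r) (Fin r) ℝ →ₗ[ℝ] Matrix (Fin r) (Fin r) ℝ :=
    LinearMap.mulRight ℝ (companion a) - LinearMap.mulLeft ℝ M
  have hS : ∀ X, S X = X * companion a - M * X := fun X => rfl
  have hinj : Function.Injective S := (injective_iff_map_eq_zero S).2 fun X hX =>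
    eq_zero_of_mul_companion_eq hr ha hM (sub_eq_zero.1 hX)
  obtain ⟨T, hT⟩ := LinearMap.injective_iff_surjective.1 hinj (vecMulVec N (outRow r))
  refine ⟨T, ⟨(Matrix.isUnit_iff_isUnit_det _).1 (isUnit_of_sylvester hMN hT), hT⟩, ?_⟩
  intro T' hT'
  exact hinj ((hS T').trans (hT'.2.trans hT.symm))

theorem isUnit_of_isHurwitz {M : Matrix (Fin r) (Fin r) ℝ} (hM : IsHurwitz M) : IsUnit M := by
  set φ := (algebraMap ℝ ℂ).mapMatrix (m := Fin r)
  have hu : IsUnit (φ M) := by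
    rw [← spectrum.zero_notMem_iff ℂ]
    intro h
    have := hM 0 h
    simp at this
  rw [Matrix.isUnit_iff_isUnit_det, ← RingHom.map_det] at hu
  rw [Matrix.isUnit_iff_isUnit_det]
  simpa [isUnit_iff_ne_zero] using hu

/-- If zero is an eigenvalue of the exosystem then the vector `τ` with `M τ = -N` is the image under
`T` of the constant solution of the exosystem with output one. -/
theorem IsSylvesterSol.output_eq_one (hr : 0 < r) {a : Fin r → ℝ}
    {M : Matrix (Fin r) (Fin r) ℝ} (hM : IsHurwitz M) {N : Fin r → ℝ}
    {T : Matrix (Fin r) (Fin r) ℝ} (hT : IsSylvesterSol a M N T) (ha : a ⟨0, hr⟩ = 0)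
    {τ : Fin r → ℝ} (hτ : M *ᵥ τ = -N) : (outRow r ᵥ* T⁻¹) ⬝ᵥ τ = 1 := by
  -- As `a 0 = 0`, the first unit vector is an equilibrium of the exosystem with output one. The
  -- Sylvester equation then yields `M T e₀ = -N`, so `T e₀ = τ`.
  have h0 : companion a *ᵥ outRow r = 0 := by
    rw [outRow_eq_single hr, mulVec_single_one]
    ext j
    by_cases hj : (j : ℕ) + 1 = r
    · simp [companion, Matrix.col, hj, ha]
    · simp [companion, Matrix.col, hj]
  have h1 : outRow r ⬝ᵥ outRow r = 1 := by
    rw [outRow_eq_single hr]; simp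
  have h2 := congrArg (fun A => A *ᵥ outRow r) hT.2
  simp only [sub_mulVec, vecMulVec_mulVec, op_smul_eq_smul, ← mulVec_mulVec, h0, mulVec_zero, h1,
    one_smul, zero_sub] at h2
  have h3 : T *ᵥ outRow r = τ := by
    refine (mulVec_injective_iff_isUnit.2 (isUnit_of_isHurwitz hM)) ?_
    rw [hτ, ← h2, neg_neg]
  rw [← h3, ← dotProduct_mulVec, mulVec_mulVec, nonsing_inv_mul _ hT.1, one_mulVec, h1]

end Sylvester

/-! ### Irredundant affine parametrizations -/

/-- Every function into a finite-dimensional space is an affine combination of finitely many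
scalar functions without redundant terms. -/
theorem exists_irredundant_parametrization {X V : Type*} [AddCommGroup V] [Module ℝ V]
    [FiniteDimensional ℝ V] (S : Set X) (G : X → V) :
    ∃ (ℓ : ℕ) (E0 : V) (E : Fin ℓ → V) (Ω : X → Fin ℓ → ℝ),
      (∀ σ ∈ S, G σ = E0 + ∑ j, Ω σ j • E j) ∧
      ∀ (c0 : ℝ) (c : Fin ℓ → ℝ), (∀ σ ∈ S, c0 + ∑ j, c j * Ω σ j = 0) → c = 0 := by
  rcases S.eq_empty_or_nonempty with rfl | ⟨σ0, hσ0⟩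
  · exact ⟨0, 0, Fin.elim0, fun _ => Fin.elim0, by simp, fun _ _ _ => Subsingleton.elim _ _⟩
  -- Irredundancy comes from subtracting a base value and taking coordinates in a basis of the span
  -- of the differences, not of the whole space.
  set W : Submodule ℝ V := Submodule.span ℝ ((fun σ => G σ - G σ0) '' S) with hW
  have hmem : ∀ σ ∈ S, G σ - G σ0 ∈ W := fun σ hσ => Submodule.subset_span ⟨σ, hσ, rfl⟩
  let b := Module.finBasis ℝ W
  classical
  let g : X → W := fun σ => if h : σ ∈ S then ⟨G σ - G σ0, hmem σ h⟩ else 0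
  have hg : ∀ σ ∈ S, (g σ : V) = G σ - G σ0 := fun σ h => by simp [g, h]
  refine ⟨_, G σ0, fun j => (b j : V), fun σ j => b.repr (g σ) j, fun σ hσ => ?_, ?_⟩
  · have h1 : ((∑ j, b.repr (g σ) j • b j : W) : V) = G σ - G σ0 := by
      rw [b.sum_repr, hg σ hσ]
    rw [Submodule.coe_sum] at h1
    simp only [Submodule.coe_smul] at h1
    rw [h1, add_sub_cancel]
  · intro c0 c hc
    -- A relation among the coordinates is a functional on `W`. The constant term is zero because
    -- all coordinates vanish at `σ0`; the functional then kills the generators of `W`.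
    let f : W →ₗ[ℝ] ℝ := ∑ j, c j • b.coord j
    have hf : ∀ w, f w = ∑ j, c j * b.repr w j := fun w => by simp [f]
    have hg0 : g σ0 = 0 := Subtype.ext (by rw [hg σ0 hσ0, sub_self]; rfl)
    have hc0 : c0 = 0 := by
      have : c0 + ∑ j, c j * b.repr (g σ0) j = 0 := hc σ0 hσ0
      rwa [hg0, map_zero, ← map_zero b.repr, ← hf, map_zero, add_zero] at this
    have hfg : ∀ σ ∈ S, f (g σ) = 0 := fun σ hσ => by
      have : c0 + ∑ j, c j * b.repr (g σ) j = 0 := hc σ hσ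
      rwa [hc0, zero_add, ← hf] at this
    have hle : W ≤ (LinearMap.ker f).map W.subtype := by
      refine Submodule.span_le.2 ?_
      rintro _ ⟨σ, hσ, rfl⟩
      exact ⟨g σ, hfg σ hσ, hg σ hσ⟩
    have hf0 : ∀ w, f w = 0 := fun w => by
      obtain ⟨w', hw', h⟩ := hle w.2
      rw [← Subtype.ext h]; exact hw'
    ext j
    have := hf0 (b j)
    rw [hf] at this
    simpa [Finsupp.single_apply] using this

theorem exists_isParametrization {nσ : ℕ} {r : Fin 3 → ℕ} (hr : ∀ i, 0 < r i)
    {S : Set (Fin nσ → ℝ)} {a : (i : Fin 3) → (Fin nσ → ℝ) → Fin (r i) → ℝ}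
    (ha : ∀ i, ∀ σ ∈ S, IsExosystem (a i σ))
    {M : (i : Fin 3) → Matrix (Fin (r i)) (Fin (r i)) ℝ} {N : (i : Fin 3) → Fin (r i) → ℝ}
    (hM : ∀ i, IsHurwitz (M i)) (hMN : ∀ i, IsControllable (M i) (N i)) :
    ∃ (ℓ : ℕ) (E0 : Matrix (Fin 3) (IMIdx r) ℝ) (E : Fin ℓ → Matrix (Fin 3) (IMIdx r) ℝ)
      (Ω : (Fin nσ → ℝ) → Fin ℓ → ℝ), IsParametrization S a M N E0 E Ω := by
  classical
  have hT : ∀ σ ∈ S, ∀ i, ∃! T, IsSylvesterSol (a i σ) (M i) (N i) T := fun σ hσ i =>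
    existsUnique_isSylvesterSol (hr i) (ha i σ hσ) (hM i) (hMN i)
  let T0 : (σ : Fin nσ → ℝ) → (i : Fin 3) → Matrix (Fin (r i)) (Fin (r i)) ℝ := fun σ i =>
    if h : σ ∈ S then (hT σ h i).exists.choose else 0
  have hT0 : ∀ σ ∈ S, ∀ i, IsSylvesterSol (a i σ) (M i) (N i) (T0 σ i) := fun σ hσ i => by
    simp only [T0, hσ, dif_pos]; exact (hT σ hσ i).exists.choose_spec
  obtain ⟨ℓ, E0, E, Ω, h1, h2⟩ := exists_irredundant_parametrization S fun σ => psiTinv (T0 σ)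
  refine ⟨ℓ, E0, E, Ω, fun σ hσ T hTs => ?_, h2⟩
  rw [← h1 σ hσ]
  congr 1
  exact funext fun i => (hT σ hσ i).unique (hTs i) (hT0 σ hσ i)

end

section

/-! ### Derivatives of matrix expressions -/

section Deriv

variable {ι κ : Type*} [Fintype ι] [Fintype κ] {s : Set ℝ} {t : ℝ}

theorem _root_.HasDerivWithinAt.mulVec (A : Matrix ι κ ℝ) {x : ℝ → κ → ℝ} {x' : κ → ℝ}
    (hx : HasDerivWithinAt x x' s t) : HasDerivWithinAt (fun u => A *ᵥ x u) (A *ᵥ x') s t :=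
  (LinearMap.toContinuousLinearMap A.mulVecLin).hasFDerivAt.comp_hasDerivWithinAt t hx

theorem _root_.HasDerivAt.mulVec (A : Matrix ι κ ℝ) {x : ℝ → κ → ℝ} {x' : κ → ℝ}
    (hx : HasDerivAt x x' t) : HasDerivAt (fun u => A *ᵥ x u) (A *ᵥ x') t :=
  (LinearMap.toContinuousLinearMap A.mulVecLin).hasFDerivAt.comp_hasDerivAt t hx

theorem _root_.HasDerivWithinAt.dotProduct {x y : ℝ → ι → ℝ} {x' y' : ι → ℝ}
    (hx : HasDerivWithinAt x x' s t) (hy : HasDerivWithinAt y y' s t) :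
    HasDerivWithinAt (fun u => x u ⬝ᵥ y u) (x' ⬝ᵥ y t + x t ⬝ᵥ y') s t := by
  have := HasDerivWithinAt.fun_sum (u := Finset.univ) fun i _ =>
    (hasDerivWithinAt_pi.1 hx i).fun_mul (hasDerivWithinAt_pi.1 hy i)
  simpa only [_root_.dotProduct, ← Finset.sum_add_distrib] using this

theorem exists_norm_mulVec_le (A : Matrix ι κ ℝ) :
    ∃ c : ℝ, 0 ≤ c ∧ ∀ x, ‖A *ᵥ x‖ ≤ c * ‖x‖ :=
  ⟨‖LinearMap.toContinuousLinearMap A.mulVecLin‖, norm_nonneg _,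
    (LinearMap.toContinuousLinearMap A.mulVecLin).le_opNorm⟩

end Deriv

/-! ### Multi-tone signals -/

section MultiTone

variable {m : ℕ} (C0 : ℝ) (C b l : Fin m → ℝ)

/-- The `k`-th derivative of a multi-tone signal. -/
def multiToneDeriv (k : ℕ) (t : ℝ) : ℝ :=
  (if k = 0 then C0 else 0) +
    ∑ j, ((Complex.I * b j) ^ k * (C j * Complex.exp (Complex.I * (b j * t + l j)))).im

theorem multiToneDeriv_zero : multiToneDeriv C0 C b l 0 = multiTone C0 C b l := by
  ext t
  simp only [multiToneDeriv, multiTone, if_true, pow_zero, one_mul]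
  congr 1
  refine Finset.sum_congr rfl fun j _ => ?_
  rw [Complex.im_ofReal_mul, mul_comm Complex.I]
  have := Complex.exp_ofReal_mul_I_im (b j * t + l j)
  push_cast at this
  rw [this]

theorem hasDerivAt_tone (k : ℕ) (C b l t : ℝ) :
    HasDerivAt (fun t : ℝ =>
        ((Complex.I * b) ^ k * (C * Complex.exp (Complex.I * (b * t + l)))).im)
      ((Complex.I * b) ^ (k + 1) * (C * Complex.exp (Complex.I * (b * t + l)))).im t := by
  have h1 : HasDerivAt (fun z : ℂ => Complex.I * ((b : ℂ) * z + l)) (Complex.I * b) (t : ℂ) := by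
    have := (((hasDerivAt_id (t : ℂ)).const_mul (b : ℂ)).add_const (l : ℂ)).const_mul Complex.I
    simpa using this
  have h2 := ((h1.cexp.const_mul (C : ℂ)).const_mul ((Complex.I * b) ^ k)).comp_ofReal
  have h3 : HasDerivAt (fun t : ℝ =>
      ((Complex.I * b) ^ k * (C * Complex.exp (Complex.I * (b * t + l)))).im) _ t :=
    Complex.imCLM.hasFDerivAt.comp_hasDerivAt t h2
  convert! h3 using 1
  rw [Complex.imCLM_apply]; congr 1; ring

theorem hasDerivAt_multiToneDeriv (k : ℕ) (t : ℝ) :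
    HasDerivAt (multiToneDeriv C0 C b l k) (multiToneDeriv C0 C b l (k + 1) t) t := by
  have := (HasDerivAt.fun_sum (u := Finset.univ) fun j _ =>
    hasDerivAt_tone k (C j) (b j) (l j) t).const_add (if k = 0 then C0 else 0)
  rw [multiToneDeriv, if_neg k.succ_ne_zero, zero_add]
  exact this

theorem iteratedDeriv_multiTone (k : ℕ) :
    iteratedDeriv k (multiTone C0 C b l) = multiToneDeriv C0 C b l k := by
  induction k with
  | zero => rw [iteratedDeriv_zero, multiToneDeriv_zero]
  | succ k ih =>
    rw [iteratedDeriv_succ, ih]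
    exact funext fun t => (hasDerivAt_multiToneDeriv C0 C b l k t).deriv

theorem exists_abs_multiToneDeriv_le (k : ℕ) : ∃ B, ∀ t, |multiToneDeriv C0 C b l k t| ≤ B := by
  refine ⟨|C0| + ∑ j, |b j| ^ k * |C j|, fun t => (abs_add_le _ _).trans (add_le_add ?_ ?_)⟩
  · split_ifs <;> simp
  · refine (Finset.abs_sum_le_sum_abs _ _).trans (Finset.sum_le_sum fun j _ => ?_)
    refine (Complex.abs_im_le_norm _).trans (le_of_eq ?_)
    have : ‖Complex.exp (Complex.I * (b j * t + l j))‖ = 1 := by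
      rw [mul_comm]
      have := Complex.norm_exp_ofReal_mul_I (b j * t + l j)
      push_cast at this
      exact this
    rw [norm_mul, norm_mul, this, norm_pow, norm_mul]
    simp

theorem IsMultiTone.hasDerivAt {d : ℝ → ℝ} (hd : IsMultiTone d) (k : ℕ) (t : ℝ) :
    HasDerivAt (iteratedDeriv k d) (iteratedDeriv (k + 1) d t) t := by
  obtain ⟨m, C0, C, b, l, rfl⟩ := hd
  simp only [iteratedDeriv_multiTone]
  exact hasDerivAt_multiToneDeriv C0 C b l k t

theorem IsMultiTone.exists_bound {d : ℝ → ℝ} (hd : IsMultiTone d) (k : ℕ) :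
    ∃ B, ∀ t, |iteratedDeriv k d t| ≤ B := by
  obtain ⟨m, C0, C, b, l, rfl⟩ := hd
  simp only [iteratedDeriv_multiTone]
  exact exists_abs_multiToneDeriv_le C0 C b l k

theorem IsMultiTone.continuous {d : ℝ → ℝ} (hd : IsMultiTone d) : Continuous d :=
  continuous_iff_continuousAt.2 fun t => by
    simpa using (hd.hasDerivAt 0 t).continuousAt

/-- A multi-tone signal is the sum of a constant and the derivative of a bounded function. -/
theorem IsMultiTone.exists_mean {d : ℝ → ℝ} (hd : IsMultiTone d) :
    ∃ (c : ℝ) (D : ℝ → ℝ) (B : ℝ), (∀ t, HasDerivAt D (d t - c) t) ∧ ∀ t, |D t| ≤ B := by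
  obtain ⟨m, C0, C, b, l, rfl⟩ := hd
  -- Tones of frequency zero are constants and belong to the mean; all others have bounded cosine
  -- primitives.
  refine ⟨C0 + ∑ j, if b j = 0 then C j * Real.sin (l j) else 0,
    fun t => ∑ j, if b j = 0 then 0 else -(C j / b j) * Real.cos (b j * t + l j),
    ∑ j, |C j / b j|, fun t => ?_, fun t => ?_⟩
  · rw [multiTone, add_sub_add_left_eq_sub, ← Finset.sum_sub_distrib]
    refine HasDerivAt.fun_sum fun j _ => ?_
    by_cases hb : b j = 0
    · simpa [hb] using hasDerivAt_const t (0 : ℝ)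
    · simp only [hb, if_false, sub_zero]
      have h1 : HasDerivAt (fun t => b j * t + l j) (b j) t := by
        simpa using ((hasDerivAt_id t).const_mul (b j)).add_const (l j)
      convert! h1.cos.const_mul (-(C j / b j)) using 1
      field_simp
  · refine (Finset.abs_sum_le_sum_abs _ _).trans (Finset.sum_le_sum fun j _ => ?_)
    split_ifs with hb
    · simp
    · rw [abs_mul, abs_neg]
      exact mul_le_of_le_one_right (abs_nonneg _) (Real.abs_cos_le_one _)

end MultiTone

/-! ### Exosystems of multi-tone signals -/

section ExistsExosystem

open Polynomial

/-- Conjugation permutes the factors, so it fixes the product and hence each coefficient. -/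
theorem exists_monic_real_of_conj_invariant (Z : Finset ℂ)
    (hZ : ∀ z ∈ Z, (starRingEnd ℂ) z ∈ Z) : ∃ p : ℝ[X], p.Monic ∧
      p.map (algebraMap ℝ ℂ) = ∏ z ∈ Z, (X - C z) := by
  set q : ℂ[X] := ∏ z ∈ Z, (X - C z) with hq
  have hconj : q.map (starRingEnd ℂ) = q := by
    rw [hq, Polynomial.map_prod]
    refine Finset.prod_nbij' (starRingEnd ℂ) (starRingEnd ℂ) hZ hZ (by simp) (by simp) ?_
    intro z _
    simp
  have hlift : q ∈ lifts (algebraMap ℝ ℂ) := by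
    rw [lifts_iff_coeff_lifts]
    intro n
    have h1 : (starRingEnd ℂ) (q.coeff n) = q.coeff n := by
      rw [← coeff_map, hconj]
    obtain ⟨x, hx⟩ := Complex.conj_eq_iff_real.1 h1
    exact ⟨x, hx.symm⟩
  obtain ⟨p, hp⟩ := (mem_lifts q).1 hlift
  refine ⟨p, monic_of_injective (algebraMap ℝ ℂ).injective ?_, hp⟩
  rw [hp]
  exact monic_prod_of_monic _ _ fun z _ => monic_X_sub_C z

theorem exoPoly_neg_coeff {p : ℝ[X]} (hp : p.Monic) :
    exoPoly (fun j : Fin p.natDegree => -p.coeff j) = p := by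
  conv_rhs => rw [hp.as_sum]
  simp only [exoPoly, map_neg, neg_mul, Finset.sum_neg_distrib, sub_neg_eq_add]
  rw [Fin.sum_univ_eq_sum_range (fun j => C (p.coeff j) * X ^ j)]

/-- Each tone is the imaginary part of a complex exponential, on which differentiation is
multiplication by `I * b j`; the equation reduces to vanishing of the characteristic polynomial
there. The step component needs the root zero. -/
theorem solvesExosystem_multiTone {r : ℕ} (hr : 0 < r) {a : Fin r → ℝ} (h0 : a ⟨0, hr⟩ = 0)
    {m : ℕ} {b : Fin m → ℝ} (hb : ∀ j, aeval (Complex.I * b j) (exoPoly a) = 0)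
    (C0 : ℝ) (C l : Fin m → ℝ) : SolvesExosystem a (multiTone C0 C b l) := by
  intro t
  simp only [iteratedDeriv_multiTone, multiToneDeriv, mul_add, Finset.sum_add_distrib]
  congr 1
  · rw [if_neg hr.ne', Finset.sum_eq_single ⟨0, hr⟩]
    · simp [h0]
    · intro j _ hj
      have : (j : ℕ) ≠ 0 := fun h => hj (Fin.ext h)
      simp [this]
    · simp
  · simp only [Finset.mul_sum]
    rw [Finset.sum_comm]
    refine Finset.sum_congr rfl fun j _ => ?_
    have h1 := hb j
    rw [aeval_exoPoly, sub_eq_zero] at h1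
    rw [h1, Finset.sum_mul, Complex.im_sum]
    refine Finset.sum_congr rfl fun k _ => ?_
    rw [smul_mul_assoc, Complex.smul_im, smul_eq_mul]

theorem exists_exosystem {m : ℕ} (b : Fin m → ℝ) : ∃ (r : ℕ) (a : Fin r → ℝ), 0 < r ∧
    IsExosystem a ∧ ∀ (C0 : ℝ) (C l : Fin m → ℝ), SolvesExosystem a (multiTone C0 C b l) := by
  classical
  -- Collecting `0` and `± I * b j` in a finite set removes repetitions, so the roots are simple
  -- even if frequencies coincide, vanish or are opposite.
  set Z : Finset ℂ := insert 0 (Finset.univ.image (fun j => Complex.I * (b j : ℂ)) ∪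
    Finset.univ.image (fun j => -(Complex.I * (b j : ℂ)))) with hZ
  have hmem : ∀ z, z ∈ Z ↔ z = 0 ∨ (∃ j, Complex.I * (b j : ℂ) = z) ∨
      ∃ j, -(Complex.I * (b j : ℂ)) = z := fun z => by simp [hZ]
  have hconj : ∀ z ∈ Z, (starRingEnd ℂ) z ∈ Z := by
    intro z hz
    rw [hmem] at hz ⊢
    rcases hz with rfl | ⟨j, rfl⟩ | ⟨j, rfl⟩
    · left; simp
    · right; right; exact ⟨j, by simp⟩
    · right; left; exact ⟨j, by simp⟩
  have hre : ∀ z ∈ Z, z.re = 0 := by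
    intro z hz
    rw [hmem] at hz
    rcases hz with rfl | ⟨j, rfl⟩ | ⟨j, rfl⟩ <;> simp
  obtain ⟨p, hp, hpZ⟩ := exists_monic_real_of_conj_invariant Z hconj
  have hroot : ∀ z ∈ Z, aeval z p = 0 := by
    intro z hz
    rw [← eval_map_algebraMap, hpZ, eval_prod]
    exact Finset.prod_eq_zero hz (by simp)
  have hdeg : 0 < p.natDegree := by
    rw [← hp.natDegree_map (algebraMap ℝ ℂ), hpZ, natDegree_prod_of_monic _ _
      fun z _ => monic_X_sub_C z]
    refine Finset.sum_pos (fun z _ => by simp) ⟨0, ?_⟩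
    rw [hmem]; exact Or.inl rfl
  refine ⟨p.natDegree, fun j => -p.coeff j, hdeg, ?_, fun C0 C l => ?_⟩
  · rw [IsExosystem, exoPoly_neg_coeff hp, hpZ, roots_prod_X_sub_C]
    exact ⟨Z.nodup, hre⟩
  · refine solvesExosystem_multiTone hdeg ?_ (fun j => ?_) C0 C l
    · have h1 := hroot 0 ((hmem 0).2 (Or.inl rfl))
      have h2 : aeval (0 : ℝ) p = 0 := by
        have : aeval (algebraMap ℝ ℂ 0) p = 0 := by simpa using h1
        rw [aeval_algebraMap_apply] at this
        simpa using this
      rw [coe_aeval_eq_eval, ← coeff_zero_eq_eval_zero] at h2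
      simp [h2]
    · rw [exoPoly_neg_coeff hp]
      exact hroot _ ((hmem _).2 (Or.inr (Or.inl ⟨j, rfl⟩)))

end ExistsExosystem

/-! ### The steady state of the internal model -/

section SteadyState

theorem eq_zero_of_hasDerivAt_const_of_bounded {F : ℝ → ℝ} {c B : ℝ}
    (hF : ∀ t, HasDerivAt F c t) (hB : ∀ t, |F t| ≤ B) : c = 0 := by
  have h := tendsto_zero_of_slow (y := fun _ => -c) (y' := fun _ => 0) (W := F) (w := fun _ => c)
    (fun t _ => hasDerivWithinAt_const t _ _) tendsto_const_nhds
    (fun t _ => (hF t).hasDerivWithinAt) (fun t _ => hB t) (by simp)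
  simpa using tendsto_nhds_unique tendsto_const_nhds h

/-- The mean of a multi-tone signal vanishes if zero is not an eigenvalue of its exosystem. -/
theorem mean_eq_zero_of_solvesExosystem {r : ℕ} (hr : 0 < r) {a : Fin r → ℝ} {d : ℝ → ℝ}
    (hd : IsMultiTone d) (hs : SolvesExosystem a d) (ha : a ⟨0, hr⟩ ≠ 0) {c B : ℝ} {D : ℝ → ℝ}
    (hD : ∀ t, HasDerivAt D (d t - c) t) (hB : ∀ t, |D t| ≤ B) : c = 0 := by
  obtain ⟨k, rfl⟩ : ∃ k, r = k + 1 := ⟨r - 1, by omega⟩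
  choose Bd hBd using hd.exists_bound
  -- The exosystem equation integrated once: a bounded function whose derivative is the constant `a
  -- 0 * c`, which must therefore be zero.
  have hF : ∀ t, HasDerivAt (fun t => iteratedDeriv k d t
      - ∑ j : Fin k, a j.succ * iteratedDeriv j d t - a 0 * D t) (a 0 * c) t := by
    intro t
    have h1 := ((hd.hasDerivAt k t).fun_sub (HasDerivAt.fun_sum (u := Finset.univ)
      fun (j : Fin k) _ => (hd.hasDerivAt j t).const_mul (a j.succ))).fun_sub
        ((hD t).const_mul (a 0))
    convert! h1 using 1
    rw [hs t, Fin.sum_univ_succ]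
    simp only [Fin.val_zero, iteratedDeriv_zero, Fin.val_succ]
    ring
  have h2 := eq_zero_of_hasDerivAt_const_of_bounded hF
    (B := Bd k + ∑ j : Fin k, |a j.succ| * Bd j + |a 0| * B) fun t => by
      refine (abs_sub _ _).trans (add_le_add ((abs_sub _ _).trans (add_le_add (hBd k t) ?_)) ?_)
      · refine (Finset.abs_sum_le_sum_abs _ _).trans (Finset.sum_le_sum fun j _ => ?_)
        rw [abs_mul]
        exact mul_le_mul_of_nonneg_left (hBd j t) (abs_nonneg _)
      · rw [abs_mul]
        exact mul_le_mul_of_nonneg_left (hB t) (abs_nonneg _)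
  exact (mul_eq_zero.1 h2).resolve_left ha

/-- The state of the exosystem in the coordinates of the internal model. -/
theorem exists_steadyState {r : ℕ} (hr : 0 < r) {a : Fin r → ℝ}
    {M : Matrix (Fin r) (Fin r) ℝ} (hM : IsHurwitz M) {N : Fin r → ℝ}
    {T : Matrix (Fin r) (Fin r) ℝ} (hT : IsSylvesterSol a M N T) {d : ℝ → ℝ}
    (hd : IsMultiTone d) (hs : SolvesExosystem a d) {τ : Fin r → ℝ} (hτ : M *ᵥ τ = -N) :
    ∃ (θ Y : ℝ → Fin r → ℝ) (c B : ℝ),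
      (∀ t, HasDerivAt θ (M *ᵥ θ t + d t • N) t) ∧ (∀ t, ‖θ t‖ ≤ B) ∧
      (∀ t, (outRow r ᵥ* T⁻¹) ⬝ᵥ θ t = d t) ∧
      (∀ t, HasDerivAt Y (θ t - c • τ) t) ∧ (∀ t, ‖Y t‖ ≤ B) ∧ (a ⟨0, hr⟩ ≠ 0 → c = 0) := by
  choose Bd hBd using hd.exists_bound
  obtain ⟨c, D, BD, hD, hBD⟩ := hd.exists_mean
  -- The jet of `d` is the companion-form state, and `θ = T x` is its image in internal-model
  -- coordinates.
  set x : ℝ → Fin r → ℝ := fun t k => iteratedDeriv k d t with hx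
  have hxd : ∀ t, outRow r ⬝ᵥ x t = d t := fun t => by
    rw [outRow_eq_single hr, single_one_dotProduct]; simp [hx]
  have hx' : ∀ t, HasDerivAt x (companion a *ᵥ x t) t := by
    intro t
    rw [hasDerivAt_pi]
    intro k
    convert! hd.hasDerivAt k t using 1
    by_cases hk : (k : ℕ) + 1 = r
    · rw [hk, hs t]
      simp [mulVec, dotProduct, companion, hk, hx]
    · have hk' : (k : ℕ) + 1 < r := by omega
      change (companion a).row k ⬝ᵥ x t = _
      have : (companion a).row k = Pi.single ⟨k + 1, hk'⟩ 1 := by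
        rw [← single_vecMul_companion a hk', single_one_vecMul]
      rw [this, single_one_dotProduct]
  have hTx : ∀ t, T *ᵥ (companion a *ᵥ x t) = M *ᵥ (T *ᵥ x t) + d t • N := by
    intro t
    have := congrArg (fun A => A *ᵥ x t) hT.2
    simp only [sub_mulVec, vecMulVec_mulVec, op_smul_eq_smul, hxd] at this
    rw [mulVec_mulVec, mulVec_mulVec, ← this, add_sub_cancel]
  have hθ : ∀ t, HasDerivAt (fun t => T *ᵥ x t) (M *ᵥ (T *ᵥ x t) + d t • N) t := fun t => by
    rw [← hTx]; exact (hx' t).mulVec T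
  have hMu : IsUnit M.det := (Matrix.isUnit_iff_isUnit_det _).1 (isUnit_of_isHurwitz hM)
  obtain ⟨cT, hcT, hT'⟩ := exists_norm_mulVec_le T
  obtain ⟨cM, hcM, hM'⟩ := exists_norm_mulVec_le M⁻¹
  have hBd0 : ∀ k, 0 ≤ Bd k := fun k => (abs_nonneg _).trans (hBd k 0)
  have hxB : ∀ t, ‖x t‖ ≤ ∑ k : Fin r, Bd k := fun t =>
    (pi_norm_le_iff_of_nonneg (Finset.sum_nonneg fun (k : Fin r) _ => hBd0 k)).2 fun k =>
      (hBd k t).trans (Finset.single_le_sum (f := fun k : Fin r => Bd k)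
        (fun k _ => hBd0 k) (Finset.mem_univ k))
  have hθB : ∀ t, ‖T *ᵥ x t‖ ≤ cT * ∑ k : Fin r, Bd k := fun t =>
    (hT' _).trans (mul_le_mul_of_nonneg_left (hxB t) hcT)
  -- Since `θ' = M θ + d N` and `D' = d - c`, the derivative of `θ - D N` is `M θ + c N = M (θ - c
  -- τ)`; applying `M⁻¹` gives a bounded primitive of `θ - c τ`.
  refine ⟨fun t => T *ᵥ x t, fun t => M⁻¹ *ᵥ (T *ᵥ x t - D t • N), c,
    max (cT * ∑ k : Fin r, Bd k) (cM * (cT * ∑ k : Fin r, Bd k + BD * ‖N‖)), hθ,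
    fun t => (hθB t).trans (le_max_left _ _), fun t => ?_, fun t => ?_, fun t => ?_,
    fun ha => mean_eq_zero_of_solvesExosystem hr hd hs ha hD hBD⟩
  · rw [← dotProduct_mulVec, mulVec_mulVec, nonsing_inv_mul _ hT.1, one_mulVec, hxd]
  · convert! ((hθ t).fun_sub ((hD t).smul_const N)).mulVec M⁻¹ using 1
    have h1 : N = -(M *ᵥ τ) := by rw [hτ, neg_neg]
    have h2 : M *ᵥ (T *ᵥ x t) + d t • N - (d t - c) • N = M *ᵥ (T *ᵥ x t - c • τ) := by
      rw [mulVec_sub, mulVec_smul, h1]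
      module
    rw [h2, mulVec_mulVec, nonsing_inv_mul _ hMu, one_mulVec]
  · refine le_trans ?_ (le_max_right _ _)
    refine (hM' _).trans (mul_le_mul_of_nonneg_left ?_ hcM)
    refine (norm_sub_le _ _).trans (add_le_add (hθB t) ?_)
    rw [norm_smul]
    exact mul_le_mul_of_nonneg_right (hBD t) (norm_nonneg _)

variable {nσ ℓ : ℕ} {r : Fin 3 → ℕ} {S : Set (Fin nσ → ℝ)}
  {a : (i : Fin 3) → (Fin nσ → ℝ) → Fin (r i) → ℝ}
  {M : (i : Fin 3) → Matrix (Fin (r i)) (Fin (r i)) ℝ} {N : (i : Fin 3) → Fin (r i) → ℝ}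
  {E0 : Matrix (Fin 3) (IMIdx r) ℝ} {E : Fin ℓ → Matrix (Fin 3) (IMIdx r) ℝ}
  {Ω : (Fin nσ → ℝ) → Fin ℓ → ℝ}

theorem psiTinv_mulVec_apply (T : (i : Fin 3) → Matrix (Fin (r i)) (Fin (r i)) ℝ)
    (x : IMIdx r → ℝ) (k : Fin 3) :
    (psiTinv T *ᵥ x) k = (outRow (r k) ᵥ* (T k)⁻¹) ⬝ᵥ fun l => x ⟨k, l⟩ := by
  simp only [mulVec, dotProduct, psiTinv, of_apply, Fintype.sum_sigma]
  rw [Finset.sum_eq_single k]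
  · simp
  · intro i _ hi
    simp [hi.symm]
  · simp

theorem blockCols_mulVec_apply (x : Fin 3 → ℝ) (i : Fin 3) (j : Fin (r i)) :
    (blockCols N *ᵥ x) ⟨i, j⟩ = N i j * x i := by
  simp [blockCols, mulVec, dotProduct]

/-- The matrices `Eʲ` of an irredundant parametrization annihilate the response of the internal
model to a constant input in every channel whose exosystem has eigenvalue zero. -/
theorem IsParametrization.mulVec_const_eq_zero (hr : ∀ i, 0 < r i)
    (ha : ∀ i, ∀ σ ∈ S, IsExosystem (a i σ)) (hM : ∀ i, IsHurwitz (M i))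
    (hMN : ∀ i, IsControllable (M i) (N i)) (hP : IsParametrization S a M N E0 E Ω)
    {σ : Fin nσ → ℝ} (hσ : σ ∈ S) {i : Fin 3} (h0 : a i σ ⟨0, hr i⟩ = 0) {τ : Fin (r i) → ℝ}
    (hτ : M i *ᵥ τ = -N i) (j : Fin ℓ) (k : Fin 3) : ∑ l, E j k ⟨i, l⟩ * τ l = 0 := by
  have h1 : ∀ σ' ∈ S, ((∑ l, E0 k ⟨i, l⟩ * τ l) - (if k = i then 1 else 0))
      + ∑ j, (∑ l, E j k ⟨i, l⟩ * τ l) * Ω σ' j = 0 := by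
    intro σ' hσ'
    choose T hT _ using fun i => existsUnique_isSylvesterSol (hr i) (ha i σ' hσ') (hM i) (hMN i)
    -- The eigenvalue zero is decided by the parity of `r i`, so it persists from `σ` to every `σ' ∈
    -- S`.
    have ha' : a i σ' ⟨0, hr i⟩ = 0 :=
      ((ha i σ' hσ').coeff_zero_iff (hr i)).2 (((ha i σ hσ).coeff_zero_iff (hr i)).1 h0)
    have h2 := hP.1 σ' hσ' T hT
    have h3 : ∑ l, psiTinv T k ⟨i, l⟩ * τ l = if k = i then 1 else 0 := by
      by_cases hki : k = i
      · subst hki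
        simpa [psiTinv, dotProduct] using (hT k).output_eq_one (hr k) (hM k) ha' hτ
      · simp [psiTinv, hki]
    rw [← h3, h2]
    simp only [Matrix.add_apply, Matrix.sum_apply, Matrix.smul_apply, smul_eq_mul, add_mul,
      Finset.sum_mul, Finset.sum_add_distrib]
    rw [Finset.sum_comm]
    have : ∀ j l, E j k ⟨i, l⟩ * τ l * Ω σ' j = Ω σ' j * E j k ⟨i, l⟩ * τ l := fun j l => by ring
    simp only [this]
    rw [Finset.sum_comm]
    ring
  exact congrFun (hP.2 _ _ h1) j

/-- The steady state `θ` of the internal model: it generates the disturbance, and the signals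
`Eʲ θ` have zero mean. -/
theorem IsParametrization.exists_steadyState (hr : ∀ i, 0 < r i)
    (ha : ∀ i, ∀ σ ∈ S, IsExosystem (a i σ)) (hM : ∀ i, IsHurwitz (M i))
    (hMN : ∀ i, IsControllable (M i) (N i)) (hP : IsParametrization S a M N E0 E Ω)
    {σ : Fin nσ → ℝ} (hσ : σ ∈ S) {d : Fin 3 → ℝ → ℝ} (hd : ∀ i, IsMultiTone (d i))
    (hs : ∀ i, SolvesExosystem (a i σ) (d i)) :
    ∃ (θ : ℝ → IMIdx r → ℝ) (X : Fin ℓ → ℝ → Fin 3 → ℝ) (B : ℝ),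
      (∀ t, HasDerivAt θ (blockDiagonal' M *ᵥ θ t + blockCols N *ᵥ fun i => d i t) t) ∧
      (∀ t, ‖θ t‖ ≤ B) ∧ (∀ t, (E0 + ∑ j, Ω σ j • E j) *ᵥ θ t = fun i => d i t) ∧
      (∀ j t, HasDerivAt (X j) (E j *ᵥ θ t) t) ∧ ∀ j t, ‖X j t‖ ≤ B := by
  choose T hT _ using fun i => existsUnique_isSylvesterSol (hr i) (ha i σ hσ) (hM i) (hMN i)
  have hτ : ∀ i, ∃ τ, M i *ᵥ τ = -N i := fun i =>
    mulVec_surjective_iff_isUnit.2 (isUnit_of_isHurwitz (hM i)) _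
  choose τ hτ using hτ
  choose θ Y c B hθ hθB hout hY hYB hc using fun i =>
    FlexSpacecraft.exists_steadyState (hr i) (hM i) (hT i) (hd i) (hs i) (hτ i)
  have hB0 : ∀ i, 0 ≤ B i := fun i => (norm_nonneg _).trans (hθB i 0)
  have hBs : ∀ i, B i ≤ ∑ i, B i := fun i =>
    Finset.single_le_sum (f := B) (fun i _ => hB0 i) (Finset.mem_univ i)
  have hBs0 : 0 ≤ ∑ i, B i := Finset.sum_nonneg fun i _ => hB0 i
  choose cE hcE hE using fun j => exists_norm_mulVec_le (E j)
  have hcE0 : 0 ≤ ∑ j, cE j := Finset.sum_nonneg fun j _ => hcE j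
  refine ⟨fun t p => θ p.1 t p.2, fun j t => E j *ᵥ fun p => Y p.1 t p.2,
    (1 + ∑ j, cE j) * ∑ i, B i, fun t => ?_, fun t => ?_, fun t => ?_, fun j t => ?_,
    fun j t => ?_⟩
  · rw [hasDerivAt_pi]
    rintro ⟨i, l⟩
    rw [Pi.add_apply, blockDiagonal'_mulVec_apply, blockCols_mulVec_apply]
    have := hasDerivAt_pi.1 (hθ i t) l
    simpa [mul_comm] using this
  · refine le_trans ((pi_norm_le_iff_of_nonneg hBs0).2 fun p => ?_)
      (le_mul_of_one_le_left hBs0 (by linarith))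
    exact (norm_le_pi_norm (θ p.1 t) p.2).trans ((hθB p.1 t).trans (hBs p.1))
  · rw [← hP.1 σ hσ T hT]
    ext k
    rw [psiTinv_mulVec_apply]
    exact hout k t
  · have h1 : HasDerivAt (fun t (p : IMIdx r) => Y p.1 t p.2)
        (fun p => θ p.1 t p.2 - c p.1 * τ p.1 p.2) t := by
      rw [hasDerivAt_pi]
      rintro ⟨i, l⟩
      simpa using hasDerivAt_pi.1 (hY i t) l
    convert! h1.mulVec (E j) using 1
    -- Channel by channel: either the exosystem has the eigenvalue zero and `E j` annihilates `τ i`,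
    -- or it does not and the mean `c i` is zero.
    have h2 : (E j *ᵥ fun p : IMIdx r => c p.1 * τ p.1 p.2) = 0 := by
      ext k
      simp only [mulVec, dotProduct, Fintype.sum_sigma, Pi.zero_apply]
      refine Finset.sum_eq_zero fun i _ => ?_
      by_cases h0 : a i σ ⟨0, hr i⟩ = 0
      · have := hP.mulVec_const_eq_zero hr ha hM hMN hσ h0 (hτ i) j k
        calc ∑ l, E j k ⟨i, l⟩ * (c i * τ i l) = c i * ∑ l, E j k ⟨i, l⟩ * τ i l := by
              rw [Finset.mul_sum]; exact Finset.sum_congr rfl fun l _ => by ring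
          _ = 0 := by rw [this, mul_zero]
      · simp [hc i h0]
    have h3 : (fun p : IMIdx r => θ p.1 t p.2 - c p.1 * τ p.1 p.2)
        = (fun p : IMIdx r => θ p.1 t p.2) - fun p : IMIdx r => c p.1 * τ p.1 p.2 := rfl
    rw [h3, mulVec_sub, h2, sub_zero]
  · refine (hE j _).trans ?_
    have h1 : ‖fun p : IMIdx r => Y p.1 t p.2‖ ≤ ∑ i, B i :=
      (pi_norm_le_iff_of_nonneg hBs0).2 fun p =>
        (norm_le_pi_norm (Y p.1 t) p.2).trans ((hYB p.1 t).trans (hBs p.1))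
    have h2 : cE j ≤ 1 + ∑ j, cE j := by
      have := Finset.single_le_sum (f := cE) (fun j _ => hcE j) (Finset.mem_univ j)
      linarith
    exact mul_le_mul h2 h1 (norm_nonneg _) (by linarith)

end SteadyState

end

section

/-! ### Smoothness of matrix expressions -/

section ContDiff

variable {X : Type*} [NormedAddCommGroup X] [NormedSpace ℝ X] {ι κ ν : Type*}

/-- All entries of a matrix-valued function are continuously differentiable. -/
def ContDiffEntries (A : X → Matrix ι κ ℝ) : Prop := ∀ i j, ContDiff ℝ 1 fun e => A e i j

theorem contDiffEntries_const (A : Matrix ι κ ℝ) : ContDiffEntries fun _ : X => A :=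
  fun _ _ => contDiff_const

theorem ContDiffEntries.mulVec [Fintype ι] [Fintype κ] {A : X → Matrix ι κ ℝ} (hA : ContDiffEntries A) {v : X → κ → ℝ}
    (hv : ContDiff ℝ 1 v) : ContDiff ℝ 1 fun e => A e *ᵥ v e :=
  contDiff_pi.2 fun i => ContDiff.sum fun j _ => (hA i j).mul (contDiff_pi.1 hv j)

theorem ContDiffEntries.mul [Fintype κ] {A : X → Matrix ι κ ℝ} (hA : ContDiffEntries A)
    {B : X → Matrix κ ν ℝ} (hB : ContDiffEntries B) : ContDiffEntries fun e => A e * B e :=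
  fun i j => by
    simp only [Matrix.mul_apply]
    exact ContDiff.sum fun k _ => (hA i k).mul (hB k j)

theorem ContDiffEntries.add {A B : X → Matrix ι κ ℝ} (hA : ContDiffEntries A)
    (hB : ContDiffEntries B) : ContDiffEntries fun e => A e + B e :=
  fun i j => (hA i j).add (hB i j)

theorem ContDiffEntries.sub {A B : X → Matrix ι κ ℝ} (hA : ContDiffEntries A)
    (hB : ContDiffEntries B) : ContDiffEntries fun e => A e - B e :=
  fun i j => (hA i j).sub (hB i j)

theorem ContDiffEntries.neg {A : X → Matrix ι κ ℝ} (hA : ContDiffEntries A) :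
    ContDiffEntries fun e => -A e :=
  fun i j => (hA i j).neg

theorem ContDiffEntries.transpose {A : X → Matrix ι κ ℝ} (hA : ContDiffEntries A) :
    ContDiffEntries fun e => (A e)ᵀ :=
  fun i j => hA j i

theorem ContDiffEntries.fromCols {A : X → Matrix ι κ ℝ} {B : X → Matrix ι ν ℝ}
    (hA : ContDiffEntries A) (hB : ContDiffEntries B) :
    ContDiffEntries fun e => Matrix.fromCols (A e) (B e) := by
  rintro i (j | j)
  · exact hA i j
  · exact hB i j

theorem contDiffEntries_regressor {w : X → Fin 3 → ℝ} (hw : ContDiff ℝ 1 w) :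
    ContDiffEntries fun e => regressor (w e) := by
  have h : ∀ i, ContDiff ℝ 1 fun e => w e i := contDiff_pi.1 hw
  intro i j
  fin_cases i <;> fin_cases j <;> first | exact h _ | exact contDiff_const

theorem contDiffEntries_skew {w : X → Fin 3 → ℝ} (hw : ContDiff ℝ 1 w) :
    ContDiffEntries fun e => skew (w e) := by
  have h : ∀ i, ContDiff ℝ 1 fun e => w e i := contDiff_pi.1 hw
  intro i j
  fin_cases i <;> fin_cases j <;> first | exact h _ | exact (h _).neg | exact contDiff_const

end ContDiff

/-! ### The closed loop as a differential equation -/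

section VectorField

variable {n nμ ℓ : ℕ} {r : Fin 3 → ℕ}

variable (n nμ ℓ r) in
/-- The closed-loop state space as a normed space. -/
abbrev StateVec : Type :=
  (Fin 3 → ℝ) × ℝ × (Fin 3 → ℝ) × (Fin n → ℝ) × (Fin n → ℝ) × (IMIdx r → ℝ) ×
    (ParIdx nμ ℓ → ℝ) × (IMIdx r → Fin nμ → ℝ)

def State.toVec (x : State n nμ ℓ r) : StateVec n nμ ℓ r :=
  (x.qv, x.q4, x.ω, x.η, x.ηdot, x.v, x.Rhat, x.ζ)

def State.ofVec (e : StateVec n nμ ℓ r) : State n nμ ℓ r :=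
  ⟨e.1, e.2.1, e.2.2.1, e.2.2.2.1, e.2.2.2.2.1, e.2.2.2.2.2.1, e.2.2.2.2.2.2.1, e.2.2.2.2.2.2.2⟩

theorem State.ofVec_toVec (x : State n nμ ℓ r) : State.ofVec x.toVec = x := rfl

/-- `x` solves the closed loop on the time interval `D`. -/
def IsClosedLoopSolutionOn (P : Flex n)
    (J : Matrix (Fin 3) (Fin 3) ℝ) (d : Fin 3 → ℝ → ℝ) (c : Controller nμ ℓ r) (D : Set ℝ)
    (x : ℝ → State n nμ ℓ r) : Prop :=
  ∀ t ∈ D,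
    HasDerivWithinAt (fun s => (x s).qv)
      ((1 / 2 : ℝ) • ((skew (x t).qv + (x t).q4 • (1 : Matrix (Fin 3) (Fin 3) ℝ)) *ᵥ (x t).ω))
      D t ∧
    HasDerivWithinAt (fun s => (x s).q4) (-(1 / 2 : ℝ) * ((x t).qv ⬝ᵥ (x t).ω)) D t ∧
    (∃ (α : Fin 3 → ℝ) (β : Fin n → ℝ),
      HasDerivWithinAt (fun s => (x s).ω) α D t ∧
      HasDerivWithinAt (fun s => (x s).η) (x t).ηdot D t ∧
      HasDerivWithinAt (fun s => (x s).ηdot) β D t ∧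
      J *ᵥ α + skew (x t).ω *ᵥ (J *ᵥ (x t).ω) + P.δ *ᵥ β = c.u P (x t) + (fun i => d i t) ∧
      β + P.C *ᵥ (x t).ηdot + P.K *ᵥ (x t).η = -(P.δᵀ *ᵥ α)) ∧
    HasDerivWithinAt (fun s => (x s).v)
      (c.Mb *ᵥ (x t).v + c.Nb *ᵥ c.u P (x t) + c.Nb *ᵥ c.F0 (x t).ω
        - c.Mb *ᵥ (c.Nb *ᵥ c.L0 (x t).ω))
      D t ∧
    HasDerivWithinAt (fun s => (x s).Rhat) (c.k • ((c.rho (x t))ᵀ *ᵥ (x t).ω)) D t ∧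
    ∀ p m, HasDerivWithinAt (fun s => (x s).ζ p m)
      ((c.Mb * (x t).ζ + (c.Mb * c.Nb * c.L1 (x t).ω - c.Nb * c.F1 (x t).ω)) p m) D t

variable (P : Flex n) (J : Matrix (Fin 3) (Fin 3) ℝ) (d : Fin 3 → ℝ → ℝ) (c : Controller nμ ℓ r)

/-- The angular acceleration of the undisturbed closed loop. -/
def angAcc (x : State n nμ ℓ r) : Fin 3 → ℝ :=
  (J - P.δ * P.δᵀ)⁻¹ *ᵥ (c.u P x - skew x.ω *ᵥ (J *ᵥ x.ω)
    + P.δ *ᵥ (P.C *ᵥ x.ηdot + P.K *ᵥ x.η))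

/-- The right-hand side of the undisturbed closed loop. -/
def field (x : State n nμ ℓ r) : StateVec n nμ ℓ r :=
  ((1 / 2 : ℝ) • ((skew x.qv + x.q4 • (1 : Matrix (Fin 3) (Fin 3) ℝ)) *ᵥ x.ω),
    -(1 / 2 : ℝ) * (x.qv ⬝ᵥ x.ω),
    angAcc P J c x,
    x.ηdot,
    -(P.δᵀ *ᵥ angAcc P J c x) - P.C *ᵥ x.ηdot - P.K *ᵥ x.η,
    c.Mb *ᵥ x.v + c.Nb *ᵥ c.u P x + c.Nb *ᵥ c.F0 x.ω - c.Mb *ᵥ (c.Nb *ᵥ c.L0 x.ω),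
    c.k • ((c.rho x)ᵀ *ᵥ x.ω),
    fun p m => (c.Mb * x.ζ + (c.Mb * c.Nb * c.L1 x.ω - c.Nb * c.F1 x.ω)) p m)

/-- The contribution of the disturbance to the right-hand side of the closed loop. -/
def forcing (t : ℝ) : StateVec n nμ ℓ r :=
  (0, 0, (J - P.δ * P.δᵀ)⁻¹ *ᵥ (fun i => d i t), 0,
    -(P.δᵀ *ᵥ ((J - P.δ * P.δᵀ)⁻¹ *ᵥ fun i => d i t)), 0, 0, 0)

theorem continuous_forcing (hd : ∀ i, Continuous (d i)) :
    Continuous (forcing P J d : ℝ → StateVec n nμ ℓ r) := by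
  unfold forcing
  have h : Continuous fun t => (fun i => d i t) := continuous_pi hd
  fun_prop

theorem exists_norm_forcing_le (hd : ∀ i, ∃ B, ∀ t, |d i t| ≤ B) :
    ∃ B, ∀ t, ‖(forcing P J d t : StateVec n nμ ℓ r)‖ ≤ B := by
  choose b hb using hd
  obtain ⟨c1, hc1, h1⟩ := exists_norm_mulVec_le (J - P.δ * P.δᵀ)⁻¹
  obtain ⟨c2, hc2, h2⟩ := exists_norm_mulVec_le P.δᵀ
  have hb0 : ∀ i, 0 ≤ b i := fun i => (abs_nonneg _).trans (hb i 0)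
  have hB0 : 0 ≤ ∑ i, b i := Finset.sum_nonneg fun i _ => hb0 i
  have hdB : ∀ t, ‖fun i => d i t‖ ≤ ∑ i, b i := fun t =>
    (pi_norm_le_iff_of_nonneg hB0).2 fun i => (hb i t).trans
      (Finset.single_le_sum (f := b) (fun i _ => hb0 i) (Finset.mem_univ i))
  have h3 : ∀ t, ‖(J - P.δ * P.δᵀ)⁻¹ *ᵥ fun i => d i t‖ ≤ c1 * ∑ i, b i := fun t =>
    (h1 _).trans (mul_le_mul_of_nonneg_left (hdB t) hc1)
  have h4 : ∀ t, ‖P.δᵀ *ᵥ ((J - P.δ * P.δᵀ)⁻¹ *ᵥ fun i => d i t)‖ ≤ c2 * (c1 * ∑ i, b i) :=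
    fun t => (h2 _).trans (mul_le_mul_of_nonneg_left (h3 t) hc2)
  refine ⟨c1 * ∑ i, b i + c2 * (c1 * ∑ i, b i), fun t => ?_⟩
  have h5 : 0 ≤ c1 * ∑ i, b i := by positivity
  have h6 : 0 ≤ c2 * (c1 * ∑ i, b i) := by positivity
  simp only [forcing, Prod.norm_def, norm_neg, norm_zero, max_le_iff]
  refine ⟨?_, ?_, ?_, ?_, ?_, ?_, ?_, ?_⟩ <;> linarith [h3 t, h4 t]

section Smooth

variable {X : Type*} [NormedAddCommGroup X] [NormedSpace ℝ X] {w : X → Fin 3 → ℝ}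

theorem contDiff_L0 (hw : ContDiff ℝ 1 w) : ContDiff ℝ 1 fun e => c.L0 (w e) :=
  (contDiffEntries_regressor hw).mulVec contDiff_const

theorem contDiffEntries_L1 (hw : ContDiff ℝ 1 w) : ContDiffEntries fun e => c.L1 (w e) :=
  (contDiffEntries_regressor hw).mul (contDiffEntries_const _)

theorem contDiff_F0 (hw : ContDiff ℝ 1 w) : ContDiff ℝ 1 fun e => c.F0 (w e) :=
  ((contDiffEntries_skew hw).mulVec (contDiff_L0 c hw)).neg

theorem contDiffEntries_F1 (hw : ContDiff ℝ 1 w) : ContDiffEntries fun e => c.F1 (w e) :=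
  ((contDiffEntries_skew hw).mul (contDiffEntries_L1 c hw)).neg

theorem contDiff_qev {x : X → State n nμ ℓ r} (hqv : ContDiff ℝ 1 fun e => (x e).qv)
    (hq4 : ContDiff ℝ 1 fun e => (x e).q4) : ContDiff ℝ 1 fun e => c.qev (x e) :=
  ((hqv.const_smul c.qd4).sub ((contDiffEntries_const (skew c.qdv)).mulVec hqv)).sub
    (contDiff_pi.2 fun _ => hq4.mul contDiff_const)

theorem contDiffEntries_rho {x : X → State n nμ ℓ r} (hω : ContDiff ℝ 1 fun e => (x e).ω)
    (hv : ContDiff ℝ 1 fun e => (x e).v) (hζ : ContDiffEntries fun e => (x e).ζ) :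
    ContDiffEntries fun e => c.rho (x e) := by
  have hN : ContDiffEntries fun e => c.Nb * c.L1 (x e).ω :=
    (contDiffEntries_const _).mul (contDiffEntries_L1 c hω)
  refine ContDiffEntries.fromCols (ContDiffEntries.fromCols ?_ fun i p => ?_) fun i j => ?_
  · exact (contDiffEntries_F1 c hω).add ((contDiffEntries_const c.E0).mul (hN.add hζ))
  · exact (contDiffEntries_const (c.E p.1)).mul (hζ.add hN) i p.2
  · exact contDiff_pi.1 ((contDiffEntries_const (c.E j)).mulVec
      (((contDiffEntries_const c.Nb).mulVec (contDiff_L0 c hω)).sub hv)) i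

theorem contDiff_field : ContDiff ℝ 1 fun e : StateVec n nμ ℓ r => field P J c (State.ofVec e) := by
  have hqv : ContDiff ℝ 1 fun e : StateVec n nμ ℓ r => (State.ofVec e).qv := contDiff_fst
  have hq4 : ContDiff ℝ 1 fun e : StateVec n nμ ℓ r => (State.ofVec e).q4 := by
    simp only [State.ofVec]; fun_prop
  have hω : ContDiff ℝ 1 fun e : StateVec n nμ ℓ r => (State.ofVec e).ω := by
    simp only [State.ofVec]; fun_prop
  have hη : ContDiff ℝ 1 fun e : StateVec n nμ ℓ r => (State.ofVec e).η := by
    simp only [State.ofVec]; fun_prop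
  have hηd : ContDiff ℝ 1 fun e : StateVec n nμ ℓ r => (State.ofVec e).ηdot := by
    simp only [State.ofVec]; fun_prop
  have hv : ContDiff ℝ 1 fun e : StateVec n nμ ℓ r => (State.ofVec e).v := by
    simp only [State.ofVec]; fun_prop
  have hR : ContDiff ℝ 1 fun e : StateVec n nμ ℓ r => (State.ofVec e).Rhat := by
    simp only [State.ofVec]; fun_prop
  have hζ : ContDiffEntries fun e : StateVec n nμ ℓ r => (State.ofVec e).ζ := by
    intro p m
    simp only [State.ofVec]; fun_prop
  have hmul : ∀ {ι κ : Type} [Fintype ι] [Fintype κ] (A : Matrix ι κ ℝ)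
      {f : StateVec n nμ ℓ r → κ → ℝ}, ContDiff ℝ 1 f → ContDiff ℝ 1 fun e => A *ᵥ f e :=
    fun A _ hf => (contDiffEntries_const A).mulVec hf
  have hu : ContDiff ℝ 1 fun e : StateVec n nμ ℓ r => c.u P (State.ofVec e) := by
    unfold Controller.u
    exact ((((((((contDiff_qev c hqv hq4).const_smul _).neg).sub (hω.const_smul _)).sub
      ((contDiffEntries_rho c hω hv hζ).mulVec hR)).sub
      (hmul _ (hmul _ (contDiff_L0 c hω)))).add (hmul _ hω)).add (hmul _ hv)).sub
      (contDiff_F0 c hω)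
  have hα : ContDiff ℝ 1 fun e : StateVec n nμ ℓ r => angAcc P J c (State.ofVec e) := by
    unfold angAcc
    exact hmul _ ((hu.sub ((contDiffEntries_skew hω).mulVec (hmul _ hω))).add
      (hmul _ ((hmul _ hηd).add (hmul _ hη))))
  have h1 : ContDiffEntries fun e : StateVec n nμ ℓ r => skew (State.ofVec e).qv
      + (State.ofVec e).q4 • (1 : Matrix (Fin 3) (Fin 3) ℝ) :=
    (contDiffEntries_skew hqv).add fun i j => hq4.mul contDiff_const
  refine ContDiff.prodMk ((h1.mulVec hω).const_smul _) (ContDiff.prodMk (contDiff_const.mul ?_)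
    (hα.prodMk (hηd.prodMk (ContDiff.prodMk ?_ (ContDiff.prodMk ?_ (ContDiff.prodMk ?_ ?_))))))
  · exact ContDiff.sum fun i _ => (contDiff_pi.1 hqv i).mul (contDiff_pi.1 hω i)
  · exact ((hmul _ hα).neg.sub (hmul _ hηd)).sub (hmul _ hη)
  · exact (((hmul _ hv).add (hmul _ hu)).add (hmul _ (contDiff_F0 c hω))).sub
      (hmul _ (hmul _ (contDiff_L0 c hω)))
  · exact ((contDiffEntries_rho c hω hv hζ).transpose.mulVec hω).const_smul _
  · refine contDiff_pi.2 fun p => contDiff_pi.2 fun m => ?_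
    exact ((contDiffEntries_const c.Mb).mul hζ).add
      (((contDiffEntries_const (c.Mb * c.Nb)).mul (contDiffEntries_L1 c hω)).sub
        ((contDiffEntries_const c.Nb).mul (contDiffEntries_F1 c hω))) p m

end Smooth

theorem _root_.HasDerivWithinAt.fst' {F G : Type*} [NormedAddCommGroup F] [NormedSpace ℝ F]
    [NormedAddCommGroup G] [NormedSpace ℝ G] {f : ℝ → F × G} {f' : F × G} {s : Set ℝ} {t : ℝ}
    (h : HasDerivWithinAt f f' s t) : HasDerivWithinAt (fun u => (f u).1) f'.1 s t :=
  (ContinuousLinearMap.fst ℝ F G).hasFDerivAt.comp_hasDerivWithinAt t h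

theorem _root_.HasDerivWithinAt.snd' {F G : Type*} [NormedAddCommGroup F] [NormedSpace ℝ F]
    [NormedAddCommGroup G] [NormedSpace ℝ G] {f : ℝ → F × G} {f' : F × G} {s : Set ℝ} {t : ℝ}
    (h : HasDerivWithinAt f f' s t) : HasDerivWithinAt (fun u => (f u).2) f'.2 s t :=
  (ContinuousLinearMap.snd ℝ F G).hasFDerivAt.comp_hasDerivWithinAt t h

variable {P J d c}

/-- The two balance equations determine the accelerations only implicitly. Eliminating `β` leaves
the matrix `J - δ δᵀ` in front of `α`, which is invertible. -/
theorem accelerations_iff (hJ : IsUnit (J - P.δ * P.δᵀ).det) (x : State n nμ ℓ r) (f α : Fin 3 → ℝ)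
    (β : Fin n → ℝ) :
    (J *ᵥ α + skew x.ω *ᵥ (J *ᵥ x.ω) + P.δ *ᵥ β = c.u P x + f ∧
      β + P.C *ᵥ x.ηdot + P.K *ᵥ x.η = -(P.δᵀ *ᵥ α)) ↔
    α = angAcc P J c x + (J - P.δ * P.δᵀ)⁻¹ *ᵥ f ∧
      β = -(P.δᵀ *ᵥ α) - P.C *ᵥ x.ηdot - P.K *ᵥ x.η := by
  have hβ : β + P.C *ᵥ x.ηdot + P.K *ᵥ x.η = -(P.δᵀ *ᵥ α) ↔
      β = -(P.δᵀ *ᵥ α) - P.C *ᵥ x.ηdot - P.K *ᵥ x.η := by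
    rw [sub_sub, eq_sub_iff_add_eq, add_assoc]
  rw [hβ]
  refine and_congr_left fun h => ?_
  have h1 : P.δ *ᵥ β = -(P.δ *ᵥ (P.δᵀ *ᵥ α)) - P.δ *ᵥ (P.C *ᵥ x.ηdot + P.K *ᵥ x.η) := by
    rw [h, sub_sub, mulVec_sub, mulVec_neg]
  have h2 : J *ᵥ α = (J - P.δ * P.δᵀ) *ᵥ α + P.δ *ᵥ (P.δᵀ *ᵥ α) := by
    rw [sub_mulVec, ← mulVec_mulVec, sub_add_cancel]
  have h3 : (α = angAcc P J c x + (J - P.δ * P.δᵀ)⁻¹ *ᵥ f) ↔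
      (J - P.δ * P.δᵀ) *ᵥ α = c.u P x - skew x.ω *ᵥ (J *ᵥ x.ω)
        + P.δ *ᵥ (P.C *ᵥ x.ηdot + P.K *ᵥ x.η) + f := by
    rw [angAcc, ← mulVec_add]
    constructor
    · rintro rfl
      rw [mulVec_mulVec, mul_nonsing_inv _ hJ, one_mulVec]
    · intro h
      rw [← h, mulVec_mulVec, nonsing_inv_mul _ hJ, one_mulVec]
  rw [h3, h1, h2, ← sub_eq_zero, ← sub_eq_zero (a := (J - P.δ * P.δᵀ) *ᵥ α)]
  refine Eq.congr ?_ rfl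
  abel

theorem field_add_forcing (x : State n nμ ℓ r) (t : ℝ) : field P J c x + forcing P J d t =
    (((1 / 2 : ℝ) • ((skew x.qv + x.q4 • (1 : Matrix (Fin 3) (Fin 3) ℝ)) *ᵥ x.ω),
      -(1 / 2 : ℝ) * (x.qv ⬝ᵥ x.ω),
      angAcc P J c x + (J - P.δ * P.δᵀ)⁻¹ *ᵥ (fun i => d i t),
      x.ηdot,
      -(P.δᵀ *ᵥ (angAcc P J c x + (J - P.δ * P.δᵀ)⁻¹ *ᵥ (fun i => d i t)))
        - P.C *ᵥ x.ηdot - P.K *ᵥ x.η,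
      c.Mb *ᵥ x.v + c.Nb *ᵥ c.u P x + c.Nb *ᵥ c.F0 x.ω - c.Mb *ᵥ (c.Nb *ᵥ c.L0 x.ω),
      c.k • ((c.rho x)ᵀ *ᵥ x.ω),
      fun p m => (c.Mb * x.ζ + (c.Mb * c.Nb * c.L1 x.ω - c.Nb * c.F1 x.ω)) p m) :
        StateVec n nμ ℓ r) := by
  have h : ∀ a b e f : Fin n → ℝ, -a - b - e + -f = -(a + f) - b - e := fun a b e f => by abel
  rw [mulVec_add, ← h]
  exact Prod.ext (add_zero _) (Prod.ext (add_zero _) (Prod.ext rfl (Prod.ext (add_zero _)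
    (Prod.ext rfl (Prod.ext (add_zero _) (Prod.ext (add_zero _) (add_zero _)))))))

/-- The closed loop is equivalent to an explicit ordinary differential equation. -/
theorem isClosedLoopSolutionOn_iff (hJ : IsUnit (J - P.δ * P.δᵀ).det) (D : Set ℝ)
    (x : ℝ → State n nμ ℓ r) : IsClosedLoopSolutionOn P J d c D x ↔
      ∀ t ∈ D, HasDerivWithinAt (fun s => (x s).toVec)
        (field P J c (x t) + forcing P J d t) D t := by
  refine forall₂_congr fun t _ => ⟨?_, fun h => ?_⟩
  · rintro ⟨hqv, hq4, ⟨α, β, hω, hη, hηd, h1⟩, hv, hR, hζ⟩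
    obtain ⟨rfl, rfl⟩ := (accelerations_iff hJ (x t) _ α β).1 h1
    rw [field_add_forcing]
    exact hqv.prodMk (hq4.prodMk (hω.prodMk (hη.prodMk (hηd.prodMk (hv.prodMk
      (hR.prodMk (hasDerivWithinAt_pi.2 fun p => hasDerivWithinAt_pi.2 fun m => hζ p m)))))))
  · rw [field_add_forcing] at h
    have h2 := h.snd'.snd'
    have h5 := h2.snd'.snd'.snd'
    refine ⟨h.fst', h.snd'.fst', ⟨_, _, h2.fst', h2.snd'.fst', h2.snd'.snd'.fst',
      (accelerations_iff hJ (x t) _ _ _).2 ⟨rfl, rfl⟩⟩, h5.fst', h5.snd'.fst', fun p m => ?_⟩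
    exact hasDerivWithinAt_pi.1 (hasDerivWithinAt_pi.1 h5.snd'.snd' p) m

end VectorField

end

section

/-! ### Error dynamics -/

section ErrorDynamics

variable {n nμ ℓ : ℕ} {r : Fin 3 → ℕ}

theorem inertia_mulVec (p : Fin 6 → ℝ) (w : Fin 3 → ℝ) : inertia p *ᵥ w = regressor w *ᵥ p := by
  ext i
  fin_cases i <;> simp [inertia, regressor, mulVec, dotProduct, Fin.sum_univ_succ] <;> ring

/-- The vector `R = (μ, Ω ⊗ μ, Ω)` of unknown parameters. -/
def parVec (Ωv : Fin ℓ → ℝ) (μ : Fin nμ → ℝ) : ParIdx nμ ℓ → ℝ :=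
  Sum.elim (Sum.elim μ fun p => Ωv p.1 * μ p.2) Ωv

/-- The deviation of the internal model from its steady state. -/
def imError (P : Flex n) (J : Matrix (Fin 3) (Fin 3) ℝ) (c : Controller nμ ℓ r) (μ : Fin nμ → ℝ)
    (θ : IMIdx r → ℝ) (x : State n nμ ℓ r) : IMIdx r → ℝ :=
  x.v + θ - c.Nb *ᵥ (J *ᵥ x.ω) - x.ζ *ᵥ μ - c.Nb *ᵥ (P.δ *ᵥ x.ηdot)

variable {P : Flex n} {J : Matrix (Fin 3) (Fin 3) ℝ} {d : Fin 3 → ℝ → ℝ} {c : Controller nμ ℓ r}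
  {μ : Fin nμ → ℝ}

theorem inertia_eq_L (hJ : J = inertia (c.Lbar1 *ᵥ μ + c.Lbar0)) (w : Fin 3 → ℝ) :
    J *ᵥ w = c.L1 w *ᵥ μ + c.L0 w := by
  rw [hJ, inertia_mulVec, mulVec_add, mulVec_mulVec, Controller.L1, Controller.L0]

theorem gyroscopic_eq_F (hJ : J = inertia (c.Lbar1 *ᵥ μ + c.Lbar0)) (w : Fin 3 → ℝ) :
    c.F1 w *ᵥ μ + c.F0 w = -(skew w *ᵥ (J *ᵥ w)) := by
  rw [inertia_eq_L hJ, Controller.F1, Controller.F0, neg_mulVec, ← mulVec_mulVec, mulVec_add,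
    neg_add]

theorem hasDerivWithinAt_mulVec_const {ι κ : Type*} [Fintype ι] [Fintype κ]
    {A : ℝ → Matrix ι κ ℝ} {A' : Matrix ι κ ℝ} {D : Set ℝ} {t : ℝ}
    (hA : ∀ i j, HasDerivWithinAt (fun s => A s i j) (A' i j) D t) (w : κ → ℝ) :
    HasDerivWithinAt (fun s => A s *ᵥ w) (A' *ᵥ w) D t :=
  hasDerivWithinAt_pi.2 fun i => HasDerivWithinAt.fun_sum fun j _ => (hA i j).mul_const (w j)

/-- The inputs `N u` and `N d` carried by `v` and `θ` are removed by `N (J α + δ β)`; the filter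
column combination `ζ μ` removes the terms with the unknown inertia. The flexible coupling alone
remains as a forcing. -/
theorem hasDerivWithinAt_imError (hJ : J = inertia (c.Lbar1 *ᵥ μ + c.Lbar0)) {D : Set ℝ}
    {x : ℝ → State n nμ ℓ r} (hx : IsClosedLoopSolutionOn P J d c D x) {θ : ℝ → IMIdx r → ℝ}
    (hθ : ∀ t, HasDerivAt θ (c.Mb *ᵥ θ t + c.Nb *ᵥ fun i => d i t) t) {t : ℝ} (ht : t ∈ D) :
    HasDerivWithinAt (fun s => imError P J c μ (θ s) (x s))
      (c.Mb *ᵥ imError P J c μ (θ t) (x t) + c.Mb *ᵥ (c.Nb *ᵥ (P.δ *ᵥ (x t).ηdot))) D t := by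
  obtain ⟨-, -, ⟨α, β, hω, -, hηd, h1, -⟩, hv, -, hζ⟩ := hx t ht
  have h2 := (((hv.add (hθ t).hasDerivWithinAt).sub ((hω.mulVec J).mulVec c.Nb)).sub
    (hasDerivWithinAt_mulVec_const hζ μ)).sub ((hηd.mulVec P.δ).mulVec c.Nb)
  convert! h2 using 1
  have h3 : J *ᵥ α = c.u P (x t) + (fun i => d i t) + (c.F1 (x t).ω *ᵥ μ + c.F0 (x t).ω)
      - P.δ *ᵥ β := by
    rw [gyroscopic_eq_F hJ, ← h1]; abel
  rw [h3]
  simp only [imError, inertia_eq_L hJ, mulVec_add, mulVec_sub, add_mulVec, sub_mulVec,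
    ← mulVec_mulVec]
  abel

/-- With the true parameters, the adaptive term reproduces the gyroscopic torque and the disturbance
estimate based on the true `Ψ T⁻¹`. The products `Ω ⊗ μ` are kept as separate unknowns so that this
is linear in them. -/
theorem rho_mulVec_parVec (x : State n nμ ℓ r) (Ωv : Fin ℓ → ℝ) :
    c.rho x *ᵥ parVec Ωv μ = c.F1 x.ω *ᵥ μ + c.E0 *ᵥ x.v - c.E0 *ᵥ (c.Nb *ᵥ c.L0 x.ω)
      + (c.E0 + ∑ j, Ωv j • c.E j) *ᵥ
        (c.Nb *ᵥ c.L0 x.ω + c.Nb *ᵥ (c.L1 x.ω *ᵥ μ) + x.ζ *ᵥ μ - x.v) := by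
  rw [Controller.rho, parVec, fromCols_mulVec_sumElim, fromCols_mulVec_sumElim]
  have h2 : c.rho2 x *ᵥ (fun p => Ωv p.1 * μ p.2)
      = ∑ j, Ωv j • (c.E j *ᵥ ((x.ζ + c.Nb * c.L1 x.ω) *ᵥ μ)) := by
    ext i
    simp only [Finset.sum_apply, Pi.smul_apply, smul_eq_mul]
    simp only [mulVec_mulVec]
    simp only [mulVec, dotProduct, Controller.rho2, of_apply, Fintype.sum_prod_type,
      Finset.mul_sum]
    refine Finset.sum_congr rfl fun j _ => Finset.sum_congr rfl fun m _ => ?_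
    ring
  have h3 : c.rho3 x *ᵥ Ωv = ∑ j, Ωv j • (c.E j *ᵥ (c.Nb *ᵥ c.L0 x.ω - x.v)) := by
    ext i
    simp only [Finset.sum_apply, Pi.smul_apply, smul_eq_mul]
    simp only [Controller.rho3]
    rw [mulVec, dotProduct]
    refine Finset.sum_congr rfl fun j _ => ?_
    rw [of_apply, mul_comm]
  rw [h2, h3, Controller.rho1]
  simp only [add_mulVec, Matrix.sum_mulVec, smul_mulVec, mulVec_add, mulVec_sub, smul_add,
    smul_sub, Finset.sum_add_distrib, Finset.sum_sub_distrib, ← mulVec_mulVec]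
  abel

/-- The momentum equation of the closed loop in error coordinates. -/
theorem momentum_eq (hJ : J = inertia (c.Lbar1 *ᵥ μ + c.Lbar0)) (x : State n nμ ℓ r)
    {f α : Fin 3 → ℝ} {β : Fin n → ℝ}
    (h : J *ᵥ α + skew x.ω *ᵥ (J *ᵥ x.ω) + P.δ *ᵥ β = c.u P x + f) {Ωv : Fin ℓ → ℝ}
    {θ : IMIdx r → ℝ} (hf : (c.E0 + ∑ j, Ωv j • c.E j) *ᵥ θ = f) :
    J *ᵥ α + P.δ *ᵥ β = -(c.k1 • c.qev x) - c.k2 • x.ω + (P.δ * P.C * P.δᵀ) *ᵥ x.ω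
      - c.rho x *ᵥ (x.Rhat - parVec Ωv μ)
      + (c.E0 + ∑ j, Ωv j • c.E j) *ᵥ
        (imError P J c μ θ x + c.Nb *ᵥ (P.δ *ᵥ x.ηdot)) := by
  have h1 : J *ᵥ α + P.δ *ᵥ β = c.u P x + f + (c.F1 x.ω *ᵥ μ + c.F0 x.ω) := by
    rw [gyroscopic_eq_F hJ, ← h]; abel
  have h2 : imError P J c μ θ x + c.Nb *ᵥ (P.δ *ᵥ x.ηdot)
      = θ - (c.Nb *ᵥ c.L0 x.ω + c.Nb *ᵥ (c.L1 x.ω *ᵥ μ) + x.ζ *ᵥ μ - x.v) := by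
    simp only [imError, inertia_eq_L hJ, mulVec_add]; abel
  rw [h1, h2, mulVec_sub (c.rho x), mulVec_sub _ θ, rho_mulVec_parVec, hf, Controller.u]
  abel

/-! ### Attitude error -/

/-- Scalar part of the quaternion error. -/
def qe4 (c : Controller nμ ℓ r) (x : State n nμ ℓ r) : ℝ := c.qd4 * x.q4 + c.qdv ⬝ᵥ x.qv

theorem qev_apply (x : State n nμ ℓ r) :
    c.qev x 0 = c.qd4 * x.qv 0 - (c.qdv 1 * x.qv 2 - c.qdv 2 * x.qv 1) - x.q4 * c.qdv 0 ∧
    c.qev x 1 = c.qd4 * x.qv 1 - (c.qdv 2 * x.qv 0 - c.qdv 0 * x.qv 2) - x.q4 * c.qdv 1 ∧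
    c.qev x 2 = c.qd4 * x.qv 2 - (c.qdv 0 * x.qv 1 - c.qdv 1 * x.qv 0) - x.q4 * c.qdv 2 := by
  refine ⟨?_, ?_, ?_⟩ <;>
  · simp only [Controller.qev, Pi.sub_apply, Pi.smul_apply, smul_eq_mul, mulVec, dotProduct,
      Fin.sum_univ_three, skew]
    simp
    ring

/-- Multiplicativity of the quaternion norm, since the attitude error is a quaternion product. -/
theorem qev_sq_add_qe4_sq (x : State n nμ ℓ r) : c.qev x ⬝ᵥ c.qev x + qe4 c x ^ 2
    = (c.qdv ⬝ᵥ c.qdv + c.qd4 ^ 2) * (x.qv ⬝ᵥ x.qv + x.q4 ^ 2) := by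
  obtain ⟨h0, h1, h2⟩ := qev_apply (c := c) x
  simp only [qe4, dotProduct, Fin.sum_univ_three, h0, h1, h2]
  ring

theorem qdv_dotProduct_derivative (x : State n nμ ℓ r) :
    c.qd4 * (-(1 / 2 : ℝ) * (x.qv ⬝ᵥ x.ω)) + c.qdv ⬝ᵥ ((1 / 2 : ℝ) •
      ((skew x.qv + x.q4 • (1 : Matrix (Fin 3) (Fin 3) ℝ)) *ᵥ x.ω))
    = -(1 / 2) * (c.qev x ⬝ᵥ x.ω) := by
  obtain ⟨h0, h1, h2⟩ := qev_apply (c := c) x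
  simp only [dotProduct, Fin.sum_univ_three, h0, h1, h2]
  simp [skew, mulVec, dotProduct, Fin.sum_univ_succ, Matrix.one_apply]
  ring

theorem qv_dotProduct_derivative (x : State n nμ ℓ r) :
    x.qv ⬝ᵥ ((1 / 2 : ℝ) • ((skew x.qv + x.q4 • (1 : Matrix (Fin 3) (Fin 3) ℝ)) *ᵥ x.ω))
      = 1 / 2 * x.q4 * (x.qv ⬝ᵥ x.ω) := by
  simp [skew, mulVec, dotProduct, Fin.sum_univ_succ, Matrix.one_apply]
  ring

theorem hasDerivWithinAt_qe4 {D : Set ℝ} {x : ℝ → State n nμ ℓ r}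
    (hx : IsClosedLoopSolutionOn P J d c D x) {t : ℝ} (ht : t ∈ D) :
    HasDerivWithinAt (fun s => qe4 c (x s)) (-(1 / 2) * (c.qev (x t) ⬝ᵥ (x t).ω)) D t := by
  obtain ⟨hqv, hq4, -⟩ := hx t ht
  rw [← qdv_dotProduct_derivative]
  have := (hq4.const_mul c.qd4).add ((hasDerivWithinAt_const t D c.qdv).dotProduct hqv)
  simpa [qe4] using! this

/-- The kinematic equations conserve the quaternion norm: the two contributions to its derivative
cancel. -/
theorem unit_quaternion {D : Set ℝ} (hD : Convex ℝ D) (h0 : 0 ∈ D) {x : ℝ → State n nμ ℓ r}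
    (hx : IsClosedLoopSolutionOn P J d c D x)
    (hx0 : (x 0).qv ⬝ᵥ (x 0).qv + (x 0).q4 ^ 2 = 1) {t : ℝ} (ht : t ∈ D) :
    (x t).qv ⬝ᵥ (x t).qv + (x t).q4 ^ 2 = 1 := by
  have h : ∀ s ∈ D, HasDerivWithinAt (fun s => (x s).qv ⬝ᵥ (x s).qv + (x s).q4 ^ 2) 0 D s := by
    intro s hs
    obtain ⟨hqv, hq4, -⟩ := hx s hs
    have h1 := (hqv.dotProduct hqv).add (hq4.pow 2)
    convert! h1 using 1
    rw [dotProduct_comm _ (x s).qv, qv_dotProduct_derivative]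
    ring
  have h2 := hD.norm_image_sub_le_of_norm_hasDerivWithin_le (C := 0) h
    (fun _ _ => norm_zero.le) h0 ht
  rw [zero_mul, norm_le_zero_iff, sub_eq_zero] at h2
  rw [← hx0]; exact h2

end ErrorDynamics

end

section

/-! ### Choice of the gains -/

section Gains

theorem add_dotProduct_add_le {ι : Type*} [Fintype ι] (x y : ι → ℝ) :
    (x + y) ⬝ᵥ (x + y) ≤ 2 * (x ⬝ᵥ x) + 2 * (y ⬝ᵥ y) := by
  have h := dotProduct_self_nonneg' (x - y)
  simp only [sub_dotProduct, dotProduct_sub, add_dotProduct, dotProduct_add,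
    dotProduct_comm y x] at h ⊢
  linarith

/-- Dissipation inequality for sufficiently high gain of the rate feedback. -/
theorem exists_gain {n : ℕ} {ι : Type*} [Fintype ι] {C : Matrix (Fin n) (Fin n) ℝ} (hC : C.PosDef)
    (δ : Matrix (Fin 3) (Fin n) ℝ) {A Q : Matrix ι ι ℝ} (hQ : ∀ z, z ⬝ᵥ (Q *ᵥ (A *ᵥ z)) ≤ -(z ⬝ᵥ z))
    (N : Matrix ι (Fin 3) ℝ) (β : ℝ) : ∃ κ γ ε : ℝ, 0 < κ ∧ 0 < γ ∧ 0 < ε ∧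
      ∀ G : Matrix (Fin 3) ι ℝ, (∀ i j, |G i j| ≤ β) → ∀ k2, κ ≤ k2 →
      ∀ (w : Fin 3 → ℝ) (y : Fin n → ℝ) (z : ι → ℝ),
        w ⬝ᵥ (-(k2 • w) + (δ * C * δᵀ) *ᵥ w + G *ᵥ (z + N *ᵥ (δ *ᵥ y))) - y ⬝ᵥ (C *ᵥ y)
          + 2 * γ * (z ⬝ᵥ (Q *ᵥ (A *ᵥ z + A *ᵥ (N *ᵥ (δ *ᵥ y)))))
        ≤ -ε * (w ⬝ᵥ w + y ⬝ᵥ y + z ⬝ᵥ z) := by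
  obtain ⟨cC, hcC, hC'⟩ := exists_le_dotProduct_mulVec hC
  obtain ⟨a1, ha1, h1⟩ := exists_mulVec_le (Q * A * N * δ)
  obtain ⟨g, hg, hG⟩ := exists_mulVec_le_of_entries_le (ι := ι) (κ := Fin 3) β
  obtain ⟨b, hb, h2⟩ := exists_mulVec_le (N * δ)
  obtain ⟨g3, hg3, h3⟩ := exists_mulVec_le (δ * C * δᵀ)
  -- With this weight the cross term between `z` and `y` costs only a quarter of the structural
  -- damping.
  set γ := cC / (4 * a1) with hγ
  have hγ0 : 0 < γ := by positivity
  -- Budget by Young's inequality: the summands of `κ` pay for the `w` part of the terms `e1`, `e2`,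
  -- `e3` and leave one unit. Half of the damping `cC` of `y` and a quarter of the decay `2 * γ` of
  -- `z` survive, which gives `ε`.
  refine ⟨(1 + g3) / 2 + g / (2 * γ) + b * g / cC + 1, γ, min 1 (min (cC / 2) (γ / 2)),
    by positivity, hγ0, by positivity, fun G hGβ k2 hk2 w y z => ?_⟩
  have hGw := hG Gᵀ (fun i j => hGβ j i) w
  have e1 : w ⬝ᵥ ((δ * C * δᵀ) *ᵥ w) ≤ (1 + g3) / 2 * (w ⬝ᵥ w) := by
    have := two_mul_dotProduct_le w ((δ * C * δᵀ) *ᵥ w) one_pos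
    rw [inv_one] at this
    linarith [h3 w]
  have e2 : w ⬝ᵥ (G *ᵥ z) ≤ g / (2 * γ) * (w ⬝ᵥ w) + γ / 2 * (z ⬝ᵥ z) := by
    rw [dotProduct_mulVec_transpose]
    have := two_mul_dotProduct_le (Gᵀ *ᵥ w) z (inv_pos.2 hγ0)
    rw [inv_inv] at this
    have h4 := mul_le_mul_of_nonneg_left hGw (inv_pos.2 hγ0).le
    have h5 : g / (2 * γ) * (w ⬝ᵥ w) = (γ⁻¹ * (g * (w ⬝ᵥ w))) / 2 := by field_simp
    rw [h5]; linarith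
  have e3 : w ⬝ᵥ (G *ᵥ (N *ᵥ (δ *ᵥ y))) ≤ b * g / cC * (w ⬝ᵥ w) + cC / 4 * (y ⬝ᵥ y) := by
    rw [dotProduct_mulVec_transpose, mulVec_mulVec]
    have := two_mul_dotProduct_le (Gᵀ *ᵥ w) ((N * δ) *ᵥ y) (show 0 < 2 * b / cC by positivity)
    have h4 := mul_le_mul_of_nonneg_left hGw (show 0 ≤ 2 * b / cC by positivity)
    have h5 := mul_le_mul_of_nonneg_left (h2 y) (show 0 ≤ (2 * b / cC)⁻¹ by positivity)
    have h6 : (2 * b / cC)⁻¹ * (b * (y ⬝ᵥ y)) = cC / 2 * (y ⬝ᵥ y) := by field_simp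
    have h7 : 2 * b / cC * (g * (w ⬝ᵥ w)) = 2 * (b * g / cC * (w ⬝ᵥ w)) := by ring
    linarith
  have e4 : 2 * γ * (z ⬝ᵥ (Q *ᵥ (A *ᵥ z))) ≤ -(2 * γ * (z ⬝ᵥ z)) := by
    have := mul_le_mul_of_nonneg_left (hQ z) (show 0 ≤ 2 * γ by positivity)
    linarith
  have e5 : 2 * γ * (z ⬝ᵥ (Q *ᵥ (A *ᵥ (N *ᵥ (δ *ᵥ y))))) ≤ γ * (z ⬝ᵥ z) + cC / 4 * (y ⬝ᵥ y) := by
    simp only [mulVec_mulVec, ← Matrix.mul_assoc]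
    have h4 := two_mul_dotProduct_le z ((Q * A * N * δ) *ᵥ y) one_pos
    rw [inv_one] at h4
    have h5 : 2 * (z ⬝ᵥ ((Q * A * N * δ) *ᵥ y)) ≤ z ⬝ᵥ z + a1 * (y ⬝ᵥ y) := by linarith [h1 y]
    have h6 := mul_le_mul_of_nonneg_left h5 hγ0.le
    have h7 : γ * (a1 * (y ⬝ᵥ y)) = cC / 4 * (y ⬝ᵥ y) := by rw [hγ]; field_simp
    rw [mul_add, h7] at h6
    linarith
  have e6 := hC' y
  have hw := dotProduct_self_nonneg' w
  have hy := dotProduct_self_nonneg' y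
  have hz := dotProduct_self_nonneg' z
  set ε := min 1 (min (cC / 2) (γ / 2))
  have hε1 : ε ≤ 1 := min_le_left _ _
  have hε2 : ε ≤ cC / 2 := (min_le_right _ _).trans (min_le_left _ _)
  have hε3 : ε ≤ γ / 2 := (min_le_right _ _).trans (min_le_right _ _)
  have f1 := mul_le_mul_of_nonneg_right hk2 hw
  have f2 := mul_le_mul_of_nonneg_right hε1 hw
  have f3 := mul_le_mul_of_nonneg_right hε2 hy
  have f4 := mul_le_mul_of_nonneg_right hε3 hz
  simp only [mulVec_add, dotProduct_add, dotProduct_neg, dotProduct_smul, smul_eq_mul]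
  linarith

end Gains

/-! ### The Lyapunov function and a priori bounds. -/

section Energy

variable {n nμ ℓ : ℕ} {r : Fin 3 → ℕ}

/-- The filter `ζ` is dissipative as long as the angular velocity is bounded. -/
theorem exists_filter_dissipation (c : Controller nμ ℓ r) {Q : Matrix (IMIdx r) (IMIdx r) ℝ}
    (hQ : ∀ z, z ⬝ᵥ (Q *ᵥ (c.Mb *ᵥ z)) ≤ -(z ⬝ᵥ z)) (b : ℝ) :
    ∃ a : ℝ, 0 < a ∧ ∀ w : Fin 3 → ℝ, w ⬝ᵥ w ≤ b → ∀ (e : Fin nμ) (Z : Matrix (IMIdx r) (Fin nμ) ℝ),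
      2 * ((Z *ᵥ Pi.single e 1) ⬝ᵥ (Q *ᵥ ((c.Mb * Z + (c.Mb * c.Nb * c.L1 w - c.Nb * c.F1 w)) *ᵥ
        Pi.single e 1))) ≤
      -((Z *ᵥ Pi.single e 1) ⬝ᵥ (Z *ᵥ Pi.single e 1)) + a * (w ⬝ᵥ w) := by
  choose ci hci hi using fun e : Fin nμ =>
    exists_mulVec_le (inertia (c.Lbar1 *ᵥ Pi.single e 1))
  obtain ⟨cs, hcs, hs⟩ := exists_mulVec_le_of_entries_le (ι := Fin 3) (κ := Fin 3) (b + 1)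
  obtain ⟨c1, hc1, h1⟩ := exists_mulVec_le (Q * (c.Mb * c.Nb))
  obtain ⟨c2, hc2, h2⟩ := exists_mulVec_le (Q * c.Nb)
  have hsum : 0 ≤ ∑ e, ci e := Finset.sum_nonneg fun e _ => (hci e).le
  refine ⟨2 * (c1 + c2 * cs) * (1 + ∑ e, ci e), by positivity, fun w hw e Z => ?_⟩
  set ζ := Z *ᵥ Pi.single e (1 : ℝ)
  set y := c.L1 w *ᵥ Pi.single e (1 : ℝ) with hy
  have hyi : y = inertia (c.Lbar1 *ᵥ Pi.single e 1) *ᵥ w := by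
    rw [inertia_mulVec, mulVec_mulVec]; rfl
  have hyw : y ⬝ᵥ y ≤ (1 + ∑ e, ci e) * (w ⬝ᵥ w) := by
    rw [hyi]
    refine (hi e w).trans (mul_le_mul_of_nonneg_right ?_ (dotProduct_self_nonneg' w))
    have := Finset.single_le_sum (f := ci) (fun e _ => (hci e).le) (Finset.mem_univ e)
    linarith
  have hwn : ‖w‖ ≤ b + 1 := norm_le_of_dotProduct_self_le hw
  have hb1 : 0 ≤ b + 1 := (norm_nonneg _).trans hwn
  have hwi : ∀ i, |w i| ≤ b + 1 := fun i => (norm_le_pi_norm w i).trans hwn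
  have hskew : (skew w *ᵥ y) ⬝ᵥ (skew w *ᵥ y) ≤ cs * (y ⬝ᵥ y) := by
    refine hs _ (fun i j => ?_) y
    fin_cases i <;> fin_cases j <;> simp [skew, hb1, hwi]
  -- Each column of the filter is driven by `y`, which is linear in `w`, and by `skew w *ᵥ y`, which
  -- is quadratic. The bound on `w` reduces the latter to linear size, so the forcing is controlled
  -- by `w ⬝ᵥ w`.
  have hin : Q *ᵥ ((c.Mb * Z + (c.Mb * c.Nb * c.L1 w - c.Nb * c.F1 w)) *ᵥ Pi.single e 1)
      = Q *ᵥ (c.Mb *ᵥ ζ) + ((Q * (c.Mb * c.Nb)) *ᵥ y + (Q * c.Nb) *ᵥ (skew w *ᵥ y)) := by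
    simp only [add_mulVec, sub_mulVec, ← mulVec_mulVec, mulVec_add, mulVec_sub, Controller.F1,
      neg_mulVec, mulVec_neg, hy, ζ]
    abel
  rw [hin, dotProduct_add, mul_add]
  set s := (Q * (c.Mb * c.Nb)) *ᵥ y + (Q * c.Nb) *ᵥ (skew w *ᵥ y)
  have h3 : s ⬝ᵥ s ≤ 2 * (c1 + c2 * cs) * (1 + ∑ e, ci e) * (w ⬝ᵥ w) := by
    have h4 := add_dotProduct_add_le ((Q * (c.Mb * c.Nb)) *ᵥ y) ((Q * c.Nb) *ᵥ (skew w *ᵥ y))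
    have h5 := h1 y
    have h6 := (h2 (skew w *ᵥ y)).trans (mul_le_mul_of_nonneg_left hskew hc2.le)
    have h7 := mul_le_mul_of_nonneg_left hyw (show 0 ≤ 2 * (c1 + c2 * cs) by positivity)
    linarith
  have h4 := two_mul_dotProduct_le ζ s one_pos
  rw [inv_one] at h4
  linarith [hQ ζ]

variable (P : Flex n) (J : Matrix (Fin 3) (Fin 3) ℝ) (c : Controller nμ ℓ r) (μ : Fin nμ → ℝ)
  (Ωv : Fin ℓ → ℝ) (Q : Matrix (IMIdx r) (IMIdx r) ℝ) (γ : ℝ)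

/-- The Lyapunov function of the closed loop, without the filter state. -/
def energy (θ : IMIdx r → ℝ) (x : State n nμ ℓ r) : ℝ :=
  2 * c.k1 * (1 - qe4 c x) + 1 / 2 * (x.ω ⬝ᵥ (J *ᵥ x.ω)) + x.ω ⬝ᵥ (P.δ *ᵥ x.ηdot)
    + 1 / 2 * (x.ηdot ⬝ᵥ x.ηdot) + 1 / 2 * (x.η ⬝ᵥ (P.K *ᵥ x.η))
    + 1 / (2 * c.k) * ((x.Rhat - parVec Ωv μ) ⬝ᵥ (x.Rhat - parVec Ωv μ))
    + γ * (imError P J c μ θ x ⬝ᵥ (Q *ᵥ imError P J c μ θ x))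

variable {P J c μ Ωv Q γ} {d : Fin 3 → ℝ → ℝ}

/-- The attitude potential cancels the proportional torque, the adaptation law cancels `ρ (Rhat -
R)`, and the inertial and elastic exchanges between body and structure cancel by symmetry. What is
left is the form estimated by `hgain`. -/
theorem exists_hasDerivWithinAt_energy (hJ : J = inertia (c.Lbar1 *ᵥ μ + c.Lbar0))
    (hJs : J.IsSymm) (hKs : P.K.IsSymm) (hQs : Q.IsSymm) (hk : 0 < c.k) {ε : ℝ}
    (hgain : ∀ (w : Fin 3 → ℝ) (y : Fin n → ℝ) (z : IMIdx r → ℝ),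
        w ⬝ᵥ (-(c.k2 • w) + (P.δ * P.C * P.δᵀ) *ᵥ w
          + (c.E0 + ∑ j, Ωv j • c.E j) *ᵥ (z + c.Nb *ᵥ (P.δ *ᵥ y))) - y ⬝ᵥ (P.C *ᵥ y)
          + 2 * γ * (z ⬝ᵥ (Q *ᵥ (c.Mb *ᵥ z + c.Mb *ᵥ (c.Nb *ᵥ (P.δ *ᵥ y)))))
        ≤ -ε * (w ⬝ᵥ w + y ⬝ᵥ y + z ⬝ᵥ z))
    {θ : ℝ → IMIdx r → ℝ}
    (hθ : ∀ t, HasDerivAt θ (c.Mb *ᵥ θ t + c.Nb *ᵥ fun i => d i t) t)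
    (hout : ∀ t, (c.E0 + ∑ j, Ωv j • c.E j) *ᵥ θ t = fun i => d i t)
    {D : Set ℝ} {x : ℝ → State n nμ ℓ r} (hx : IsClosedLoopSolutionOn P J d c D x) {t : ℝ}
    (ht : t ∈ D) :
    ∃ V' : ℝ, HasDerivWithinAt (fun s => energy P J c μ Ωv Q γ (θ s) (x s)) V' D t ∧
      V' ≤ -ε * ((x t).ω ⬝ᵥ (x t).ω + (x t).ηdot ⬝ᵥ (x t).ηdot
        + imError P J c μ (θ t) (x t) ⬝ᵥ imError P J c μ (θ t) (x t)) := by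
  have hz := hasDerivWithinAt_imError hJ hx hθ ht
  have hq := hasDerivWithinAt_qe4 hx ht
  obtain ⟨-, -, ⟨α, β, hω, hη, hηd, h1, h2⟩, -, hR, -⟩ := hx t ht
  have hm := momentum_eq hJ (x t) h1 (hout t)
  have hR' := hR.sub_const (parVec Ωv μ)
  have hV := ((((((((hq.const_sub 1).const_mul (2 * c.k1)).add
    ((hω.dotProduct (hω.mulVec J)).const_mul (1 / 2))).add (hω.dotProduct (hηd.mulVec P.δ))).add
    ((hηd.dotProduct hηd).const_mul (1 / 2))).add ((hη.dotProduct (hη.mulVec P.K)).const_mul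
    (1 / 2))).add ((hR'.dotProduct hR').const_mul (1 / (2 * c.k)))).add
    ((hz.dotProduct (hz.mulVec Q)).const_mul γ))
  refine ⟨_, hV, ?_⟩
  refine le_trans (le_of_eq ?_) (hgain (x t).ω (x t).ηdot (imError P J c μ (θ t) (x t)))
  set z := imError P J c μ (θ t) (x t)
  set z' := c.Mb *ᵥ z + c.Mb *ᵥ (c.Nb *ᵥ (P.δ *ᵥ (x t).ηdot))
  set R := (x t).Rhat - parVec Ωv μ
  set w := (x t).ω
  set y := (x t).ηdot
  have s1 : α ⬝ᵥ (J *ᵥ w) = w ⬝ᵥ (J *ᵥ α) := dotProduct_mulVec_comm hJs _ _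
  have s2 : (x t).η ⬝ᵥ (P.K *ᵥ y) = y ⬝ᵥ (P.K *ᵥ (x t).η) := dotProduct_mulVec_comm hKs _ _
  have s3 : z' ⬝ᵥ (Q *ᵥ z) = z ⬝ᵥ (Q *ᵥ z') := dotProduct_mulVec_comm hQs _ _
  have s4 : α ⬝ᵥ (P.δ *ᵥ y) = y ⬝ᵥ (P.δᵀ *ᵥ α) := by
    rw [dotProduct_mulVec_transpose, dotProduct_comm]
  have s5 : ((c.rho (x t))ᵀ *ᵥ w) ⬝ᵥ R = w ⬝ᵥ (c.rho (x t) *ᵥ R) :=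
    (dotProduct_mulVec_transpose _ _ _).symm
  have s6 : R ⬝ᵥ ((c.rho (x t))ᵀ *ᵥ w) = w ⬝ᵥ (c.rho (x t) *ᵥ R) := by
    rw [dotProduct_comm, s5]
  have s7 : β ⬝ᵥ y = y ⬝ᵥ β := dotProduct_comm _ _
  have s8 : c.qev (x t) ⬝ᵥ w = w ⬝ᵥ c.qev (x t) := dotProduct_comm _ _
  have m1 := congrArg (fun f => w ⬝ᵥ f) hm
  have m2 := congrArg (fun f => y ⬝ᵥ f) h2
  simp only [dotProduct_add, dotProduct_sub, dotProduct_neg, dotProduct_smul, smul_eq_mul]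
    at m1 m2
  simp only [dotProduct_add, dotProduct_neg, dotProduct_smul, smul_dotProduct, smul_eq_mul,
    s1, s2, s3, s4, s5, s6, s7, s8]
  have hkk : 1 / (2 * c.k) * (c.k * (w ⬝ᵥ (c.rho (x t) *ᵥ R)) + c.k * (w ⬝ᵥ (c.rho (x t) *ᵥ R)))
      = w ⬝ᵥ (c.rho (x t) *ᵥ R) := by field_simp; ring
  rw [hkk]
  linarith

/-- The coupling `ωᵀ δ η'` has no sign. Completing the square with `ψ = η' + δᵀ ω` turns the kinetic
energy into `ωᵀ (J - δ δᵀ) ω + |ψ|²` over two, so every term of the energy is nonnegative. -/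
theorem exists_bound_of_energy_le (hJmb : (J - P.δ * P.δᵀ).PosDef) (hK : P.K.PosDef)
    {cQ : ℝ} (hcQ : 0 < cQ) (hQ : ∀ z, cQ * (z ⬝ᵥ z) ≤ z ⬝ᵥ (Q *ᵥ z)) (hγ : 0 < γ)
    (hk1 : 0 < c.k1) (hk : 0 < c.k) (hqd : c.qdv ⬝ᵥ c.qdv + c.qd4 ^ 2 = 1) (v0 : ℝ) :
    ∃ b : ℝ, ∀ (θ : IMIdx r → ℝ) (x : State n nμ ℓ r), x.qv ⬝ᵥ x.qv + x.q4 ^ 2 = 1 →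
      0 ≤ energy P J c μ Ωv Q γ θ x ∧ (energy P J c μ Ωv Q γ θ x ≤ v0 →
        x.ω ⬝ᵥ x.ω ≤ b ∧ x.ηdot ⬝ᵥ x.ηdot ≤ b ∧ x.η ⬝ᵥ x.η ≤ b ∧
        (x.Rhat - parVec Ωv μ) ⬝ᵥ (x.Rhat - parVec Ωv μ) ≤ b ∧
        imError P J c μ θ x ⬝ᵥ imError P J c μ θ x ≤ b) := by
  obtain ⟨cJ, hcJ, hJ'⟩ := exists_le_dotProduct_mulVec hJmb
  obtain ⟨cK, hcK, hK'⟩ := exists_le_dotProduct_mulVec hK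
  obtain ⟨cδ, hcδ, hδ⟩ := exists_mulVec_le P.δᵀ
  set b1 := 2 * v0 / cJ with hb1
  set b2 := 4 * v0 + 2 * (cδ * b1) with hb2
  set b3 := 2 * v0 / cK with hb3
  set b4 := 2 * c.k * v0 with hb4
  set b5 := v0 / (γ * cQ) with hb5
  refine ⟨max b1 (max b2 (max b3 (max b4 b5))), fun θ x hx => ?_⟩
  set z := imError P J c μ θ x
  set R := x.Rhat - parVec Ωv μ
  set ψ := x.ηdot + P.δᵀ *ᵥ x.ω with hψ
  have t1 : 0 ≤ 2 * c.k1 * (1 - qe4 c x) := by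
    have h1 := qev_sq_add_qe4_sq (c := c) x
    rw [hqd, hx] at h1
    have h2 := dotProduct_self_nonneg' (c.qev x)
    have h3 : qe4 c x ≤ 1 := by nlinarith
    have : 0 ≤ 1 - qe4 c x := by linarith
    positivity
  have t2 : 1 / 2 * (x.ω ⬝ᵥ (J *ᵥ x.ω)) + x.ω ⬝ᵥ (P.δ *ᵥ x.ηdot) + 1 / 2 * (x.ηdot ⬝ᵥ x.ηdot)
      = 1 / 2 * (x.ω ⬝ᵥ ((J - P.δ * P.δᵀ) *ᵥ x.ω)) + 1 / 2 * (ψ ⬝ᵥ ψ) := by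
    have h1 : x.ω ⬝ᵥ (P.δ *ᵥ x.ηdot) = (P.δᵀ *ᵥ x.ω) ⬝ᵥ x.ηdot := dotProduct_mulVec_transpose _ _ _
    have h2 : x.ω ⬝ᵥ ((P.δ * P.δᵀ) *ᵥ x.ω) = (P.δᵀ *ᵥ x.ω) ⬝ᵥ (P.δᵀ *ᵥ x.ω) := by
      rw [← mulVec_mulVec, dotProduct_mulVec_transpose]
    rw [sub_mulVec, dotProduct_sub, h2, h1, hψ]
    simp only [add_dotProduct, dotProduct_add, dotProduct_comm x.ηdot]
    ring
  have t3 := hJ' x.ω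
  have t4 := hK' x.η
  have t5 := hQ z
  have nω := dotProduct_self_nonneg' x.ω
  have nη := dotProduct_self_nonneg' x.η
  have nψ := dotProduct_self_nonneg' ψ
  have nR := dotProduct_self_nonneg' R
  have nz := dotProduct_self_nonneg' z
  have pω : 0 ≤ cJ * (x.ω ⬝ᵥ x.ω) := by positivity
  have pη : 0 ≤ cK * (x.η ⬝ᵥ x.η) := by positivity
  have pR : 0 ≤ 1 / (2 * c.k) * (R ⬝ᵥ R) := by positivity
  have pz : 0 ≤ γ * (cQ * (z ⬝ᵥ z)) := by positivity
  have t6 : γ * (cQ * (z ⬝ᵥ z)) ≤ γ * (z ⬝ᵥ (Q *ᵥ z)) := mul_le_mul_of_nonneg_left t5 hγ.le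
  have hE : energy P J c μ Ωv Q γ θ x = 2 * c.k1 * (1 - qe4 c x)
      + (1 / 2 * (x.ω ⬝ᵥ ((J - P.δ * P.δᵀ) *ᵥ x.ω)) + 1 / 2 * (ψ ⬝ᵥ ψ))
      + 1 / 2 * (x.η ⬝ᵥ (P.K *ᵥ x.η)) + 1 / (2 * c.k) * (R ⬝ᵥ R) + γ * (z ⬝ᵥ (Q *ᵥ z)) := by
    rw [← t2, energy]; ring
  rw [hE]
  refine ⟨by linarith, fun hv => ?_⟩
  have r1 : x.ω ⬝ᵥ x.ω ≤ b1 := by rw [hb1, le_div_iff₀ hcJ]; linarith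
  have r3 : x.η ⬝ᵥ x.η ≤ b3 := by rw [hb3, le_div_iff₀ hcK]; linarith
  have r4 : R ⬝ᵥ R ≤ b4 := by
    have : 1 / (2 * c.k) * (R ⬝ᵥ R) ≤ v0 := by linarith
    rw [one_div, inv_mul_le_iff₀ (by positivity)] at this
    exact this
  have r5 : z ⬝ᵥ z ≤ b5 := by rw [hb5, le_div_iff₀ (by positivity)]; linarith
  have r2 : x.ηdot ⬝ᵥ x.ηdot ≤ b2 := by
    have h1 : x.ηdot = ψ + -(P.δᵀ *ᵥ x.ω) := by rw [hψ]; abel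
    have h2 := add_dotProduct_add_le ψ (-(P.δᵀ *ᵥ x.ω))
    rw [← h1, neg_dotProduct, dotProduct_neg, neg_neg] at h2
    have h3 := (hδ x.ω).trans (mul_le_mul_of_nonneg_left r1 hcδ.le)
    linarith
  exact ⟨r1.trans (by simp), r2.trans (by simp), r3.trans (by simp), r4.trans (by simp),
    r5.trans (by simp)⟩

/-- The only state not bounded directly is `v`, which is recovered by solving the definition of
`imError` for it. -/
theorem exists_norm_toVec_le (b bθ : ℝ) : ∃ B : ℝ, ∀ (θ : IMIdx r → ℝ) (x : State n nμ ℓ r),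
    x.qv ⬝ᵥ x.qv + x.q4 ^ 2 = 1 → ‖θ‖ ≤ bθ →
    x.ω ⬝ᵥ x.ω ≤ b → x.ηdot ⬝ᵥ x.ηdot ≤ b → x.η ⬝ᵥ x.η ≤ b →
    (x.Rhat - parVec Ωv μ) ⬝ᵥ (x.Rhat - parVec Ωv μ) ≤ b →
    imError P J c μ θ x ⬝ᵥ imError P J c μ θ x ≤ b →
    (∀ e, (x.ζ *ᵥ Pi.single e 1) ⬝ᵥ (x.ζ *ᵥ Pi.single e 1) ≤ b) → ‖x.toVec‖ ≤ B := by
  obtain ⟨a1, ha1, h1⟩ := exists_norm_mulVec_le (c.Nb * J)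
  obtain ⟨a2, ha2, h2⟩ := exists_norm_mulVec_le (c.Nb * P.δ)
  refine ⟨1 + (|b| + 1) + (|b| + 1 + ‖parVec Ωv μ‖) + (|b| + 1 + |bθ| + a1 * (|b| + 1)
    + (∑ e, |μ e|) * (|b| + 1) + a2 * (|b| + 1)), fun θ x hx hθ hω hηd hη hR hz hζ => ?_⟩
  have key : ∀ {ι : Type} [Fintype ι] {y : ι → ℝ}, y ⬝ᵥ y ≤ b → ‖y‖ ≤ |b| + 1 := fun h =>
    (norm_le_of_dotProduct_self_le h).trans (by linarith [le_abs_self b])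
  have hμ0 : 0 ≤ ∑ e, |μ e| := Finset.sum_nonneg fun _ _ => abs_nonneg _
  have hqv : ‖x.qv‖ ≤ 1 := by
    have := norm_sq_le_dotProduct_self x.qv
    nlinarith [sq_nonneg x.q4, norm_nonneg x.qv]
  have hq4 : |x.q4| ≤ 1 := by
    rw [← sq_le_one_iff_abs_le_one]
    linarith [dotProduct_self_nonneg' x.qv]
  have hζe : ∀ p e, |x.ζ p e| ≤ |b| + 1 := fun p e => by
    have h3 := (norm_le_pi_norm (x.ζ *ᵥ Pi.single e 1) p).trans (key (hζ e))
    rwa [mulVec_single_one, Real.norm_eq_abs] at h3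
  have hζμ : ‖x.ζ *ᵥ μ‖ ≤ (∑ e, |μ e|) * (|b| + 1) := by
    refine (pi_norm_le_iff_of_nonneg (by positivity)).2 fun p => ?_
    change |∑ e, x.ζ p e * μ e| ≤ _
    refine (Finset.abs_sum_le_sum_abs _ _).trans ?_
    rw [Finset.sum_mul]
    refine Finset.sum_le_sum fun e _ => ?_
    rw [abs_mul, mul_comm]
    exact mul_le_mul_of_nonneg_left (hζe p e) (abs_nonneg _)
  have hv : x.v = imError P J c μ θ x - θ + (c.Nb * J) *ᵥ x.ω + x.ζ *ᵥ μ
      + (c.Nb * P.δ) *ᵥ x.ηdot := by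
    simp only [imError, ← mulVec_mulVec]; abel
  have hvn : ‖x.v‖ ≤ |b| + 1 + |bθ| + a1 * (|b| + 1) + (∑ e, |μ e|) * (|b| + 1)
      + a2 * (|b| + 1) := by
    rw [hv]
    refine (norm_add_le _ _).trans (add_le_add ((norm_add_le _ _).trans (add_le_add
      ((norm_add_le _ _).trans (add_le_add ((norm_sub_le _ _).trans (add_le_add (key hz)
        (hθ.trans (le_abs_self _)))) ?_)) hζμ)) ?_)
    · exact (h1 _).trans (mul_le_mul_of_nonneg_left (key hω) ha1)
    · exact (h2 _).trans (mul_le_mul_of_nonneg_left (key hηd) ha2)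
  have hRn : ‖x.Rhat‖ ≤ |b| + 1 + ‖parVec Ωv μ‖ := by
    have : x.Rhat = (x.Rhat - parVec Ωv μ) + parVec Ωv μ := by abel
    rw [this]
    exact (norm_add_le _ _).trans (add_le_add (key hR) le_rfl)
  have hζn : ‖x.toVec.2.2.2.2.2.2.2‖ ≤ |b| + 1 :=
    (pi_norm_le_iff_of_nonneg (by positivity)).2 fun p =>
      (pi_norm_le_iff_of_nonneg (by positivity)).2 fun e => hζe p e
  have p1 : 0 ≤ |b| + 1 + ‖parVec Ωv μ‖ := by positivity
  have p2 : 0 ≤ |b| + 1 + |bθ| + a1 * (|b| + 1) + (∑ e, |μ e|) * (|b| + 1)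
      + a2 * (|b| + 1) := by positivity
  have p3 := abs_nonneg b
  have hωn := key hω
  have hηdn := key hηd
  have hηn := key hη
  refine norm_prod_le_iff.2 ⟨?_, norm_prod_le_iff.2 ⟨?_, norm_prod_le_iff.2 ⟨?_,
    norm_prod_le_iff.2 ⟨?_, norm_prod_le_iff.2 ⟨?_, norm_prod_le_iff.2 ⟨?_,
    norm_prod_le_iff.2 ⟨?_, ?_⟩⟩⟩⟩⟩⟩⟩
  · exact hqv.trans (by linarith)
  · exact hq4.trans (by linarith)
  · exact hωn.trans (by linarith)
  · exact hηn.trans (by linarith)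
  · exact hηdn.trans (by linarith)
  · exact hvn.trans (by linarith)
  · exact hRn.trans (by linarith)
  · exact hζn.trans (by linarith)

/-- A Lyapunov function for the whole closed loop and the resulting a priori bound. -/
theorem exists_lyapunov_certificate (hJ : J = inertia (c.Lbar1 *ᵥ μ + c.Lbar0))
    (hJp : J.PosDef) (hJmb : (J - P.δ * P.δᵀ).PosDef) (hK : P.K.PosDef) (hQs : Q.IsSymm)
    {cQ : ℝ} (hcQ : 0 < cQ) (hQ : ∀ z, cQ * (z ⬝ᵥ z) ≤ z ⬝ᵥ (Q *ᵥ z))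
    (hQM : ∀ z, z ⬝ᵥ (Q *ᵥ (c.Mb *ᵥ z)) ≤ -(z ⬝ᵥ z)) (hγ : 0 < γ)
    (hk1 : 0 < c.k1) (hk : 0 < c.k) (hqd : c.qdv ⬝ᵥ c.qdv + c.qd4 ^ 2 = 1) {ε : ℝ} (hε : 0 < ε)
    (hgain : ∀ (w : Fin 3 → ℝ) (y : Fin n → ℝ) (z : IMIdx r → ℝ),
        w ⬝ᵥ (-(c.k2 • w) + (P.δ * P.C * P.δᵀ) *ᵥ w
          + (c.E0 + ∑ j, Ωv j • c.E j) *ᵥ (z + c.Nb *ᵥ (P.δ *ᵥ y))) - y ⬝ᵥ (P.C *ᵥ y)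
          + 2 * γ * (z ⬝ᵥ (Q *ᵥ (c.Mb *ᵥ z + c.Mb *ᵥ (c.Nb *ᵥ (P.δ *ᵥ y)))))
        ≤ -ε * (w ⬝ᵥ w + y ⬝ᵥ y + z ⬝ᵥ z))
    {θ : ℝ → IMIdx r → ℝ} {bθ : ℝ} (hθb : ∀ t, ‖θ t‖ ≤ bθ)
    (hθ : ∀ t, HasDerivAt θ (c.Mb *ᵥ θ t + c.Nb *ᵥ fun i => d i t) t)
    (hout : ∀ t, (c.E0 + ∑ j, Ωv j • c.E j) *ᵥ θ t = fun i => d i t)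
    (x0 : State n nμ ℓ r) (hx0 : x0.qv ⬝ᵥ x0.qv + x0.q4 ^ 2 = 1) :
    ∃ B ε' : ℝ, 0 < ε' ∧ ∀ D : Set ℝ, Convex ℝ D → 0 ∈ D → D ⊆ Set.Ici 0 →
      ∀ x : ℝ → State n nμ ℓ r, x 0 = x0 → IsClosedLoopSolutionOn P J d c D x →
      ∃ W W' : ℝ → ℝ, ∀ t ∈ D, HasDerivWithinAt W (W' t) D t ∧
        W' t ≤ -ε' * ((x t).ω ⬝ᵥ (x t).ω + (x t).ηdot ⬝ᵥ (x t).ηdot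
          + imError P J c μ (θ t) (x t) ⬝ᵥ imError P J c μ (θ t) (x t)
          + ∑ e, ((x t).ζ *ᵥ Pi.single e 1) ⬝ᵥ ((x t).ζ *ᵥ Pi.single e 1)) ∧
        0 ≤ W t ∧ ‖(x t).toVec‖ ≤ B := by
  -- The order matters: the energy without `ζ` decreases on its own and bounds `ω` by `b`, and only
  -- this bound makes the filter estimate with constant `a` available.
  obtain ⟨b, hb⟩ := exists_bound_of_energy_le (μ := μ) (Ωv := Ωv) hJmb hK hcQ hQ hγ hk1 hk hqd
    (energy P J c μ Ωv Q γ (θ 0) x0)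
  obtain ⟨a, ha, hfil⟩ := exists_filter_dissipation c hQM b
  -- Weight of the filter energy: its `nμ` columns together produce at most `l * nμ * a ≤ ε / 2`
  -- times `ω ⬝ᵥ ω`, half of the available dissipation. The summand one covers `nμ = 0`.
  set l := ε / (2 * (a * (nμ + 1))) with hl
  have hl0 : 0 < l := by positivity
  let F : State n nμ ℓ r → ℝ := fun x =>
    ∑ e, (x.ζ *ᵥ Pi.single e 1) ⬝ᵥ (Q *ᵥ (x.ζ *ᵥ Pi.single e 1))
  have hF0 : ∀ x e, cQ * ((x.ζ *ᵥ Pi.single e 1) ⬝ᵥ (x.ζ *ᵥ Pi.single e 1)) ≤ F x := fun x e =>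
    (hQ _).trans (Finset.single_le_sum
      (f := fun e => (x.ζ *ᵥ Pi.single e 1) ⬝ᵥ (Q *ᵥ (x.ζ *ᵥ Pi.single e 1)))
      (fun e _ => (mul_nonneg hcQ.le (dotProduct_self_nonneg' _)).trans (hQ _))
      (Finset.mem_univ e))
  have hFn : ∀ x, 0 ≤ F x := fun x => Finset.sum_nonneg fun e _ =>
    (mul_nonneg hcQ.le (dotProduct_self_nonneg' _)).trans (hQ _)
  set w0 := energy P J c μ Ωv Q γ (θ 0) x0 + l * F x0
  obtain ⟨B, hB⟩ := exists_norm_toVec_le (P := P) (J := J) (c := c) (μ := μ) (Ωv := Ωv)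
    (max b (w0 / (l * cQ))) bθ
  refine ⟨B, min (ε / 2) l, by positivity, fun D hD h0 hD0 x hxx0 hx => ?_⟩
  have hunit : ∀ t ∈ D, (x t).qv ⬝ᵥ (x t).qv + (x t).q4 ^ 2 = 1 := fun t ht =>
    unit_quaternion hD h0 hx (by rw [hxx0]; exact hx0) ht
  set V := fun t => energy P J c μ Ωv Q γ (θ t) (x t) with hV
  have hVd := fun t (ht : t ∈ D) => exists_hasDerivWithinAt_energy hJ (isSymm_of_posDef hJp)
    (isSymm_of_posDef hK) hQs hk hgain hθ hout hx ht
  choose! V' hV1 hV2 using hVd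
  have hVle : ∀ t ∈ D, V t ≤ energy P J c μ Ωv Q γ (θ 0) x0 := by
    intro t ht
    have h1 := antitoneOn_of_hasDerivWithinAt_le_zero hD hV1 (fun s hs => (hV2 s hs).trans ?_)
      h0 ht (hD0 ht)
    · simpa only [hxx0] using h1
    · have := dotProduct_self_nonneg' (x s).ω
      have := dotProduct_self_nonneg' (x s).ηdot
      have := dotProduct_self_nonneg' (imError P J c μ (θ s) (x s))
      rw [neg_mul, neg_nonpos]
      positivity
  have hbd := fun t (ht : t ∈ D) => (hb (θ t) (x t) (hunit t ht)).2 (hVle t ht)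
  have hFd : ∀ t ∈ D, ∃ F' : ℝ, HasDerivWithinAt (fun s => F (x s)) F' D t ∧
      F' ≤ -(∑ e, ((x t).ζ *ᵥ Pi.single e 1) ⬝ᵥ ((x t).ζ *ᵥ Pi.single e 1))
        + nμ * (a * ((x t).ω ⬝ᵥ (x t).ω)) := by
    intro t ht
    obtain ⟨-, -, -, -, -, hζ⟩ := hx t ht
    have h1 := fun e : Fin nμ => hasDerivWithinAt_mulVec_const hζ (Pi.single e 1)
    refine ⟨_, HasDerivWithinAt.fun_sum fun e _ => (h1 e).dotProduct ((h1 e).mulVec Q), ?_⟩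
    have h2 : ∀ e ∈ Finset.univ, _ ≤ _ := fun e (_ : e ∈ (Finset.univ : Finset (Fin nμ))) =>
      hfil (x t).ω (hbd t ht).1 e (x t).ζ
    have h3 := Finset.sum_le_sum h2
    rw [Finset.sum_add_distrib, Finset.sum_neg_distrib, Finset.sum_const, Finset.card_univ,
      Fintype.card_fin, nsmul_eq_mul] at h3
    refine le_trans (le_of_eq (Finset.sum_congr rfl fun e _ => ?_)) h3
    rw [dotProduct_mulVec_comm hQs]
    ring
  choose! F' hF1 hF2 using hFd
  have hWd : ∀ t ∈ D, HasDerivWithinAt (fun s => V s + l * F (x s)) (V' t + l * F' t) D t :=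
    fun t ht => (hV1 t ht).add ((hF1 t ht).const_mul l)
  have hWle : ∀ t ∈ D, V' t + l * F' t ≤ -(min (ε / 2) l) * ((x t).ω ⬝ᵥ (x t).ω
      + (x t).ηdot ⬝ᵥ (x t).ηdot
      + imError P J c μ (θ t) (x t) ⬝ᵥ imError P J c μ (θ t) (x t)
      + ∑ e, ((x t).ζ *ᵥ Pi.single e 1) ⬝ᵥ ((x t).ζ *ᵥ Pi.single e 1)) := by
    intro t ht
    have nω := dotProduct_self_nonneg' (x t).ω
    have nη := dotProduct_self_nonneg' (x t).ηdot
    have nz := dotProduct_self_nonneg' (imError P J c μ (θ t) (x t))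
    have nζ : 0 ≤ ∑ e, ((x t).ζ *ᵥ Pi.single e 1) ⬝ᵥ ((x t).ζ *ᵥ Pi.single e 1) :=
      Finset.sum_nonneg fun e _ => dotProduct_self_nonneg' _
    have h1 := hV2 t ht
    have h2 := mul_le_mul_of_nonneg_left (hF2 t ht) hl0.le
    have h3 : l * (nμ * (a * ((x t).ω ⬝ᵥ (x t).ω))) ≤ ε / 2 * ((x t).ω ⬝ᵥ (x t).ω) := by
      have h4 : l * (nμ * a) ≤ ε / 2 := by
        rw [hl, div_mul_eq_mul_div, div_le_div_iff₀ (by positivity) (by positivity)]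
        nlinarith [mul_pos hε ha]
      nlinarith
    have m1 : min (ε / 2) l ≤ ε / 2 := min_le_left _ _
    have m2 : min (ε / 2) l ≤ l := min_le_right _ _
    have f1 := mul_le_mul_of_nonneg_right m1 nω
    have f2 := mul_le_mul_of_nonneg_right m1 nη
    have f3 := mul_le_mul_of_nonneg_right m1 nz
    have f4 := mul_le_mul_of_nonneg_right m2 nζ
    have f5 := mul_nonneg hε.le nη
    have f6 := mul_nonneg hε.le nz
    linarith
  refine ⟨_, _, fun t ht => ⟨hWd t ht, hWle t ht, ?_, ?_⟩⟩
  · exact add_nonneg (hb (θ t) (x t) (hunit t ht)).1 (mul_nonneg hl0.le (hFn _))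
  · obtain ⟨b1, b2, b3, b4, b5⟩ := hbd t ht
    refine hB (θ t) (x t) (hunit t ht) (hθb t) (b1.trans (le_max_left _ _))
      (b2.trans (le_max_left _ _)) (b3.trans (le_max_left _ _)) (b4.trans (le_max_left _ _))
      (b5.trans (le_max_left _ _)) fun e => le_trans ?_ (le_max_right _ _)
    have h1 := antitoneOn_of_hasDerivWithinAt_le_zero hD hWd (fun s hs => (hWle s hs).trans ?_)
      h0 ht (hD0 ht)
    · simp only [V, hxx0] at h1
      rw [le_div_iff₀ (by positivity)]
      have h2 := mul_le_mul_of_nonneg_left (hF0 (x t) e) hl0.le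
      have h3 := (hb (θ t) (x t) (hunit t ht)).1
      calc _ = l * (cQ * (((x t).ζ *ᵥ Pi.single e 1) ⬝ᵥ ((x t).ζ *ᵥ Pi.single e 1))) := by ring
        _ ≤ w0 := by linarith
    · have := dotProduct_self_nonneg' (x s).ω
      have := dotProduct_self_nonneg' (x s).ηdot
      have := dotProduct_self_nonneg' (imError P J c μ (θ s) (x s))
      have : 0 ≤ ∑ e, ((x s).ζ *ᵥ Pi.single e 1) ⬝ᵥ ((x s).ζ *ᵥ Pi.single e 1) :=
        Finset.sum_nonneg fun e _ => dotProduct_self_nonneg' _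
      rw [neg_mul, neg_nonpos]
      positivity

end Energy

end

section

/-! ### Convergence of the trajectories -/

theorem tendsto_mulVec_zero {α ι κ : Type*} [Fintype κ] {l : Filter α} (A : Matrix ι κ ℝ)
    {v : α → κ → ℝ} (hv : Tendsto v l (𝓝 0)) : Tendsto (fun t => A *ᵥ v t) l (𝓝 0) := by
  have h : Continuous fun w : κ → ℝ => A *ᵥ w := Continuous.matrix_mulVec continuous_const continuous_id
  simpa using! (h.tendsto 0).comp hv

theorem tendsto_mulVec_zero_of_bounded {ι κ : Type*} [Fintype κ]
    {A : ℝ → Matrix ι κ ℝ} {v : ℝ → κ → ℝ} {B : ℝ} (hA : ∀ t, 0 ≤ t → ∀ i j, |A t i j| ≤ B)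
    (hv : Tendsto v atTop (𝓝 0)) : Tendsto (fun t => A t *ᵥ v t) atTop (𝓝 0) := by
  refine tendsto_pi_nhds.2 fun i => ?_
  have h : ∀ j ∈ Finset.univ, Tendsto (fun t => A t i j * v t j) atTop (𝓝 0) := fun j _ =>
    Filter.isBoundedUnder_le_mul_tendsto_zero
      (isBoundedUnder_of_eventually_le ((eventually_ge_atTop 0).mono fun t ht => hA t ht i j))
      (tendsto_pi_nhds.1 hv j)
  simpa using! tendsto_finsetSum _ h

theorem tendsto_mulVec_of_tendsto_zero {ι κ : Type*} [Fintype κ]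
    {A : ℝ → Matrix ι κ ℝ} {v : ℝ → κ → ℝ} {B : ℝ} (hv : ∀ t, 0 ≤ t → ‖v t‖ ≤ B)
    (hA : ∀ i j, Tendsto (fun t => A t i j) atTop (𝓝 0)) :
    Tendsto (fun t => A t *ᵥ v t) atTop (𝓝 0) := by
  refine tendsto_pi_nhds.2 fun i => ?_
  have h : ∀ j ∈ Finset.univ, Tendsto (fun t => A t i j * v t j) atTop (𝓝 0) := fun j _ =>
    (hA i j).zero_mul_isBoundedUnder_le
      (isBoundedUnder_of_eventually_le ((eventually_ge_atTop 0).mono fun t ht =>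
        (norm_le_pi_norm (v t) j).trans (hv t ht)))
  simpa using! tendsto_finsetSum _ h

variable {n nμ ℓ : ℕ} {r : Fin 3 → ℕ} {P : Flex n} {J : Matrix (Fin 3) (Fin 3) ℝ}
  {d : Fin 3 → ℝ → ℝ} {c : Controller nμ ℓ r} {μ : Fin nμ → ℝ} {x : ℝ → State n nμ ℓ r}

theorem exists_norm_comp_le {F : Type*} [NormedAddCommGroup F] {φ : StateVec n nμ ℓ r → F}
    (hφ : Continuous φ) (B : ℝ) : ∃ B' : ℝ, ∀ e, ‖e‖ ≤ B → ‖φ e‖ ≤ B' := by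
  obtain ⟨B', h⟩ := (isCompact_closedBall (0 : StateVec n nμ ℓ r) B).exists_bound_of_continuousOn
    hφ.continuousOn
  exact ⟨B', fun e he => h e (by simpa using he)⟩

theorem continuous_rho (c : Controller nμ ℓ r) (i : Fin 3) (j : ParIdx nμ ℓ) :
    Continuous fun e : StateVec n nμ ℓ r => c.rho (State.ofVec e) i j := by
  refine (contDiffEntries_rho c ?_ ?_ ?_ i j).continuous
  · simp only [State.ofVec]; fun_prop
  · simp only [State.ofVec]; fun_prop
  · intro p m
    simp only [State.ofVec]; fun_prop

theorem rho_ofVec_zero (c : Controller nμ ℓ r) :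
    c.rho (State.ofVec (0 : StateVec n nμ ℓ r)) = 0 := by
  have h : regressor 0 = 0 := by
    ext i j
    fin_cases i <;> fin_cases j <;> rfl
  have h0 : c.L0 0 = 0 := by rw [Controller.L0, h, zero_mulVec]
  have h1 : c.L1 0 = 0 := by rw [Controller.L1, h, Matrix.zero_mul]
  have hF : c.F1 0 = 0 := by rw [Controller.F1, h1, Matrix.mul_zero, neg_zero]
  have hω : (State.ofVec (0 : StateVec n nμ ℓ r)).ω = 0 := rfl
  have hζ : (State.ofVec (0 : StateVec n nμ ℓ r)).ζ = 0 := rfl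
  have hv : (State.ofVec (0 : StateVec n nμ ℓ r)).v = 0 := rfl
  ext i j
  rcases j with (j | j) | j <;>
  simp [Controller.rho, Controller.rho1, Controller.rho2, Controller.rho3, hω, hζ, hv, h0, h1, hF]

/-- A continuous field is bounded on the bounded set where the trajectory stays. This supplies the
derivative bound in the Barbalat argument. -/
theorem exists_bounded_velocity (hdet : IsUnit (J - P.δ * P.δᵀ).det)
    (hd : ∀ i, ∃ B, ∀ t, |d i t| ≤ B) (hx : IsClosedLoopSolutionOn P J d c (Set.Ici 0) x) {B : ℝ}
    (hB : ∀ t, 0 ≤ t → ‖(x t).toVec‖ ≤ B) : ∃ (F : ℝ → StateVec n nμ ℓ r) (L : ℝ),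
      (∀ t, 0 ≤ t → HasDerivWithinAt (fun s => (x s).toVec) (F t) (Set.Ici 0) t) ∧
      ∀ t, 0 ≤ t → ‖F t‖ ≤ L := by
  obtain ⟨b1, hb1⟩ := exists_norm_comp_le (contDiff_field P J c).continuous B
  obtain ⟨b2, hb2⟩ := exists_norm_forcing_le (nμ := nμ) (ℓ := ℓ) (r := r) P J d hd
  refine ⟨fun t => field P J c (x t) + forcing P J d t, b1 + b2,
    (isClosedLoopSolutionOn_iff hdet _ x).1 hx, fun t ht => ?_⟩
  have h := hb1 (x t).toVec (hB t ht)
  rw [State.ofVec_toVec] at h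
  exact (norm_add_le _ _).trans (add_le_add h (hb2 t))

theorem continuous_imError (P : Flex n) (J : Matrix (Fin 3) (Fin 3) ℝ) (c : Controller nμ ℓ r)
    (μ : Fin nμ → ℝ) (θ : IMIdx r → ℝ) :
    Continuous fun e : StateVec n nμ ℓ r => imError P J c μ θ (State.ofVec e) := by
  have hζ : Continuous fun e : StateVec n nμ ℓ r => (State.ofVec e).ζ *ᵥ μ :=
    (ContDiffEntries.mulVec (A := fun e : StateVec n nμ ℓ r => (State.ofVec e).ζ)
      (v := fun _ => μ)
      (fun p m => by simp only [State.ofVec]; fun_prop) contDiff_const).continuous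
  have hω : Continuous fun e : StateVec n nμ ℓ r => (State.ofVec e).ω := by
    simp only [State.ofVec]; fun_prop
  have hηd : Continuous fun e : StateVec n nμ ℓ r => (State.ofVec e).ηdot := by
    simp only [State.ofVec]; fun_prop
  have hv : Continuous fun e : StateVec n nμ ℓ r => (State.ofVec e).v := by
    simp only [State.ofVec]; fun_prop
  exact (((hv.add continuous_const).sub (continuous_const.matrix_mulVec
    (continuous_const.matrix_mulVec hω))).sub hζ).sub
    (continuous_const.matrix_mulVec (continuous_const.matrix_mulVec hηd))

theorem tendsto_dissipated_errors (hJ : J = inertia (c.Lbar1 *ᵥ μ + c.Lbar0))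
    (hdet : IsUnit (J - P.δ * P.δᵀ).det) (hd : ∀ i, ∃ B, ∀ t, |d i t| ≤ B)
    {θ : ℝ → IMIdx r → ℝ} {bθ : ℝ} (hθb : ∀ t, ‖θ t‖ ≤ bθ)
    (hθ : ∀ t, HasDerivAt θ (c.Mb *ᵥ θ t + c.Nb *ᵥ fun i => d i t) t)
    (hx : IsClosedLoopSolutionOn P J d c (Set.Ici 0) x) {B : ℝ} (hB : ∀ t, 0 ≤ t → ‖(x t).toVec‖ ≤ B)
    {W W' : ℝ → ℝ} {ε : ℝ} (hε : 0 < ε)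
    (hW : ∀ t, 0 ≤ t → HasDerivWithinAt W (W' t) (Set.Ici 0) t)
    (hW' : ∀ t, 0 ≤ t → W' t ≤ -ε * ((x t).ω ⬝ᵥ (x t).ω + (x t).ηdot ⬝ᵥ (x t).ηdot
          + imError P J c μ (θ t) (x t) ⬝ᵥ imError P J c μ (θ t) (x t)
          + ∑ e, ((x t).ζ *ᵥ Pi.single e 1) ⬝ᵥ ((x t).ζ *ᵥ Pi.single e 1)))
    (hW0 : ∀ t, 0 ≤ t → 0 ≤ W t) :
    Tendsto (fun t => (x t).ω) atTop (𝓝 0) ∧ Tendsto (fun t => (x t).ηdot) atTop (𝓝 0) ∧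
    Tendsto (fun t => imError P J c μ (θ t) (x t)) atTop (𝓝 0) ∧
    ∀ p m, Tendsto (fun t => (x t).ζ p m) atTop (𝓝 0) := by
  obtain ⟨F, L, hF, hFb⟩ := exists_bounded_velocity hdet hd hx hB
  have key : ∀ {ι : Type} [Fintype ι] (y y' : ℝ → ι → ℝ) (L : ℝ),
      (∀ t, 0 ≤ t → y t ⬝ᵥ y t ≤ (x t).ω ⬝ᵥ (x t).ω + (x t).ηdot ⬝ᵥ (x t).ηdot
          + imError P J c μ (θ t) (x t) ⬝ᵥ imError P J c μ (θ t) (x t)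
          + ∑ e, ((x t).ζ *ᵥ Pi.single e 1) ⬝ᵥ ((x t).ζ *ᵥ Pi.single e 1)) →
      (∀ t, 0 ≤ t → HasDerivWithinAt y (y' t) (Set.Ici 0) t) → (∀ t, 0 ≤ t → ‖y' t‖ ≤ L) →
      Tendsto y atTop (𝓝 0) := fun y y' L hS hy hL =>
    tendsto_zero_of_dissipation hε hW (fun t ht => (hW' t ht).trans (by
      rw [neg_mul, neg_mul, neg_le_neg_iff]
      exact mul_le_mul_of_nonneg_left ((norm_sq_le_dotProduct_self _).trans (hS t ht)) hε.le))
      hW0 hy hL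
  have n1 := fun t => dotProduct_self_nonneg' (x t).ω
  have n2 := fun t => dotProduct_self_nonneg' (x t).ηdot
  have n3 := fun t => dotProduct_self_nonneg' (imError P J c μ (θ t) (x t))
  have n4 := fun t e => dotProduct_self_nonneg' ((x t).ζ *ᵥ Pi.single e 1)
  have n4' := fun t => Finset.sum_nonneg fun e (_ : e ∈ Finset.univ) => n4 t e
  refine ⟨?_, ?_, ?_, fun p m => ?_⟩
  · refine key _ (fun t => (F t).2.2.1) L
      (fun t _ => by linarith [n2 t, n3 t, n4' t]) (fun t ht => (hF t ht).snd'.snd'.fst')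
      fun t ht => ?_
    exact (norm_fst_le _).trans ((norm_snd_le _).trans ((norm_snd_le _).trans (hFb t ht)))
  · refine key _ (fun t => (F t).2.2.2.2.1) L
      (fun t _ => by linarith [n1 t, n3 t, n4' t])
      (fun t ht => (hF t ht).snd'.snd'.snd'.snd'.fst') fun t ht => ?_
    exact (norm_fst_le _).trans ((norm_snd_le _).trans ((norm_snd_le _).trans
      ((norm_snd_le _).trans ((norm_snd_le _).trans (hFb t ht)))))
  · obtain ⟨a1, ha1, h1⟩ := exists_norm_mulVec_le c.Mb
    obtain ⟨a2, ha2, h2⟩ := exists_norm_mulVec_le (c.Mb * c.Nb * P.δ)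
    obtain ⟨b3, hb3⟩ := exists_norm_comp_le (continuous_imError P J c μ 0) B
    have hz : ∀ t, 0 ≤ t → ‖imError P J c μ (θ t) (x t)‖ ≤ b3 + bθ := fun t ht => by
      have : imError P J c μ (θ t) (x t) = imError P J c μ 0 (x t) + θ t := by
        simp only [imError]; abel
      have h := hb3 (x t).toVec (hB t ht)
      rw [State.ofVec_toVec] at h
      rw [this]
      exact (norm_add_le _ _).trans (add_le_add h (hθb t))
    refine key _ _ (a1 * (b3 + bθ) + a2 * B) (fun t _ => by linarith [n1 t, n2 t, n4' t])
      (fun t ht => hasDerivWithinAt_imError hJ hx hθ ht) fun t ht => ?_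
    refine (norm_add_le _ _).trans (add_le_add ((h1 _).trans
      (mul_le_mul_of_nonneg_left (hz t ht) ha1)) ?_)
    rw [mulVec_mulVec, mulVec_mulVec]
    refine (h2 _).trans (mul_le_mul_of_nonneg_left (le_trans ?_ (hB t ht)) ha2)
    exact (norm_fst_le _).trans ((norm_snd_le _).trans ((norm_snd_le _).trans
      ((norm_snd_le _).trans (norm_snd_le (x t).toVec))))
  · have h8 : ∀ e : StateVec n nμ ℓ r, ‖e.2.2.2.2.2.2.2‖ ≤ ‖e‖ := fun e =>
      (norm_snd_le _).trans ((norm_snd_le _).trans ((norm_snd_le _).trans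
        ((norm_snd_le _).trans ((norm_snd_le _).trans ((norm_snd_le _).trans (norm_snd_le e))))))
    refine tendsto_pi_nhds.1 (key (fun t p => (x t).ζ p m)
      (fun t p => (F t).2.2.2.2.2.2.2 p m) L
      (fun t _ => ?_) (fun t ht => hasDerivWithinAt_pi.2 fun p => ?_) fun t ht => ?_) p
    · have h := Finset.single_le_sum (fun e _ => n4 t e) (Finset.mem_univ m)
      have h2 : ((x t).ζ *ᵥ Pi.single m 1) = fun p => (x t).ζ p m := by
        ext p; simp
      rw [← h2]
      linarith [n1 t, n2 t, n3 t]
    · exact hasDerivWithinAt_pi.1 (hasDerivWithinAt_pi.1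
        (hF t ht).snd'.snd'.snd'.snd'.snd'.snd'.snd' p) m
    · have h0 : 0 ≤ L := (norm_nonneg _).trans (hFb t ht)
      refine (pi_norm_le_iff_of_nonneg h0).2 fun p => ?_
      exact (norm_le_pi_norm ((F t).2.2.2.2.2.2.2 p) m).trans
        ((norm_le_pi_norm _ p).trans ((h8 _).trans (hFb t ht)))

/-- By the modal equation `K η` is, up to the vanishing `C η'`, minus the derivative of the bounded
function `η' + δᵀ ω`; it varies slowly because `η' → 0`. Invertibility of `K` finishes the argument.
-/
theorem tendsto_modal (hK : P.K.PosDef) (hx : IsClosedLoopSolutionOn P J d c (Set.Ici 0) x) {B : ℝ}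
    (hB : ∀ t, 0 ≤ t → ‖(x t).toVec‖ ≤ B)
    (hηd : Tendsto (fun t => (x t).ηdot) atTop (𝓝 0)) :
    Tendsto (fun t => (x t).η) atTop (𝓝 0) := by
  have h : ∀ t, 0 ≤ t → ∃ (α : Fin 3 → ℝ) (β : Fin n → ℝ),
      HasDerivWithinAt (fun s => (x s).ω) α (Set.Ici 0) t ∧
      HasDerivWithinAt (fun s => (x s).η) (x t).ηdot (Set.Ici 0) t ∧
      HasDerivWithinAt (fun s => (x s).ηdot) β (Set.Ici 0) t ∧
      β + P.C *ᵥ (x t).ηdot + P.K *ᵥ (x t).η = -(P.δᵀ *ᵥ α) := fun t ht => by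
    obtain ⟨-, -, ⟨α, β, h1, h2, h3, -, h4⟩, -⟩ := hx t ht
    exact ⟨α, β, h1, h2, h3, h4⟩
  choose! α β h1 h2 h3 h4 using h
  obtain ⟨a, ha, hδ⟩ := exists_norm_mulVec_le P.δᵀ
  have hy : Tendsto (fun t => P.K *ᵥ (x t).η) atTop (𝓝 0) := by
    refine tendsto_zero_of_slow (y' := fun t => P.K *ᵥ (x t).ηdot)
      (W := fun t => (x t).ηdot + P.δᵀ *ᵥ (x t).ω) (w := fun t => β t + P.δᵀ *ᵥ α t)
      (B := B + a * B) (fun t ht => (h2 t ht).mulVec _) (tendsto_mulVec_zero _ hηd)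
      (fun t ht => (h3 t ht).add ((h1 t ht).mulVec _)) (fun t ht => ?_) ?_
    · refine (norm_add_le _ _).trans (add_le_add ?_ ((hδ _).trans
        (mul_le_mul_of_nonneg_left ?_ ha)))
      · exact le_trans ((norm_fst_le _).trans ((norm_snd_le _).trans ((norm_snd_le _).trans
          ((norm_snd_le _).trans (norm_snd_le (x t).toVec))))) (hB t ht)
      · exact le_trans ((norm_fst_le _).trans ((norm_snd_le _).trans (norm_snd_le (x t).toVec)))
          (hB t ht)
    · have h5 := (tendsto_mulVec_zero P.C hηd).neg
      rw [neg_zero] at h5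
      refine h5.congr' ((eventually_ge_atTop 0).mono fun t ht => ?_)
      have h6 := h4 t ht
      rw [eq_neg_iff_add_eq_zero] at h6
      rw [neg_eq_iff_add_eq_zero, ← h6]
      abel_nf
  have h6 := tendsto_mulVec_zero P.K⁻¹ hy
  refine h6.congr fun t => ?_
  rw [mulVec_mulVec, nonsing_inv_mul _ hK.det_pos.ne'.isUnit, one_mulVec]

/-- In the momentum equation `k₁ q_ev` is balanced by derivatives of bounded functions and vanishing
terms. The persistent part of `ρ (Rhat - R)` is of this kind because its slowly varying coefficients
multiply the signals `Eʲ θ`, which have the bounded primitives `X j`. -/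
theorem tendsto_qev (hk1 : 0 < c.k1) (hJ : J = inertia (c.Lbar1 *ᵥ μ + c.Lbar0)) {Ωv : Fin ℓ → ℝ}
    {θ : ℝ → IMIdx r → ℝ}
    (hout : ∀ t, (c.E0 + ∑ j, Ωv j • c.E j) *ᵥ θ t = fun i => d i t)
    {X : Fin ℓ → ℝ → Fin 3 → ℝ} (hX : ∀ j t, HasDerivAt (X j) (c.E j *ᵥ θ t) t) {bX : ℝ}
    (hXb : ∀ j t, ‖X j t‖ ≤ bX)
    (hx : IsClosedLoopSolutionOn P J d c (Set.Ici 0) x) {B : ℝ}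
    (hB : ∀ t, 0 ≤ t → ‖(x t).toVec‖ ≤ B)
    (hω : Tendsto (fun t => (x t).ω) atTop (𝓝 0))
    (hηd : Tendsto (fun t => (x t).ηdot) atTop (𝓝 0))
    (hz : Tendsto (fun t => imError P J c μ (θ t) (x t)) atTop (𝓝 0))
    (hζ : ∀ p m, Tendsto (fun t => (x t).ζ p m) atTop (𝓝 0)) :
    Tendsto (fun t => c.qev (x t)) atTop (𝓝 0) := by
  have hqvb : ∀ t, 0 ≤ t → ‖(x t).qv‖ ≤ B := fun t ht => (norm_fst_le (x t).toVec).trans (hB t ht)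
  have hq4b : ∀ t, 0 ≤ t → |(x t).q4| ≤ B := fun t ht =>
    le_trans ((norm_fst_le _).trans (norm_snd_le (x t).toVec)) (hB t ht)
  have hωb : ∀ t, 0 ≤ t → ‖(x t).ω‖ ≤ B := fun t ht =>
    le_trans ((norm_fst_le _).trans ((norm_snd_le _).trans (norm_snd_le (x t).toVec))) (hB t ht)
  have hηdb : ∀ t, 0 ≤ t → ‖(x t).ηdot‖ ≤ B := fun t ht =>
    le_trans ((norm_fst_le _).trans ((norm_snd_le _).trans ((norm_snd_le _).trans
      ((norm_snd_le _).trans (norm_snd_le (x t).toVec))))) (hB t ht)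
  have hRb : ∀ t, 0 ≤ t → ‖(x t).Rhat‖ ≤ B := fun t ht =>
    le_trans ((norm_fst_le _).trans ((norm_snd_le _).trans ((norm_snd_le _).trans
      ((norm_snd_le _).trans ((norm_snd_le _).trans ((norm_snd_le _).trans
        (norm_snd_le (x t).toVec))))))) (hB t ht)
  have h : ∀ t, 0 ≤ t → ∃ (α : Fin 3 → ℝ) (β : Fin n → ℝ),
      HasDerivWithinAt (fun s => (x s).ω) α (Set.Ici 0) t ∧
      HasDerivWithinAt (fun s => (x s).ηdot) β (Set.Ici 0) t ∧
      J *ᵥ α + skew (x t).ω *ᵥ (J *ᵥ (x t).ω) + P.δ *ᵥ β = c.u P (x t) + (fun i => d i t) :=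
    fun t ht => by
      obtain ⟨-, -, ⟨α, β, h1, -, h3, h4, -⟩, -⟩ := hx t ht
      exact ⟨α, β, h1, h3, h4⟩
  choose! α β h1 h3 h4 using h
  set R : ℝ → ParIdx nμ ℓ → ℝ := fun t => (x t).Rhat - parVec Ωv μ with hR
  have hRb' : ∀ t, 0 ≤ t → ‖R t‖ ≤ B + ‖parVec Ωv μ‖ := fun t ht =>
    (norm_sub_le _ _).trans (add_le_add (hRb t ht) le_rfl)
  -- the adaptation and kinematic rates vanish asymptotically
  choose bρ hbρ using fun i j => exists_norm_comp_le (continuous_rho (n := n) c i j) B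
  have hρb : ∀ t, 0 ≤ t → ∀ i j, |c.rho (x t) i j| ≤ ∑ i, ∑ j, |bρ i j| := fun t ht i j =>
    ((hbρ i j _ (hB t ht)).trans (le_abs_self _)).trans
      ((Finset.single_le_sum (f := fun j => |bρ i j|) (fun _ _ => abs_nonneg _)
        (Finset.mem_univ j)).trans
      (Finset.single_le_sum (f := fun i => ∑ j, |bρ i j|)
        (fun _ _ => Finset.sum_nonneg fun _ _ => abs_nonneg _) (Finset.mem_univ i)))
  have hR' : Tendsto (fun t => c.k • ((c.rho (x t))ᵀ *ᵥ (x t).ω)) atTop (𝓝 0) := by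
    simpa using (tendsto_mulVec_zero_of_bounded (A := fun t => (c.rho (x t))ᵀ)
      (fun t ht i j => hρb t ht j i) hω).const_smul c.k
  have hqv' : Tendsto (fun t => (1 / 2 : ℝ) • ((skew (x t).qv
      + (x t).q4 • (1 : Matrix (Fin 3) (Fin 3) ℝ)) *ᵥ (x t).ω)) atTop (𝓝 0) := by
    have h5 : ∀ t, 0 ≤ t → ∀ i j,
        |(skew (x t).qv + (x t).q4 • (1 : Matrix (Fin 3) (Fin 3) ℝ)) i j| ≤ B + B := by
      intro t ht i j
      have hB0 : 0 ≤ B := (norm_nonneg _).trans (hB t ht)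
      have hi : ∀ i, |(x t).qv i| ≤ B := fun i => (norm_le_pi_norm _ i).trans (hqvb t ht)
      refine (abs_add_le _ _).trans (add_le_add ?_ ?_)
      · fin_cases i <;> fin_cases j <;> simp [skew, hi, hB0]
      · rw [Matrix.smul_apply, smul_eq_mul, abs_mul, Matrix.one_apply]
        split_ifs <;> simp [hq4b t ht, hB0]
    simpa using (tendsto_mulVec_zero_of_bounded h5 hω).const_smul (1 / 2 : ℝ)
  have hq4' : Tendsto (fun t => -(1 / 2 : ℝ) * ((x t).qv ⬝ᵥ (x t).ω)) atTop (𝓝 0) := by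
    have h5 := tendsto_pi_nhds.1 (tendsto_mulVec_zero_of_bounded
      (A := fun t => Matrix.of fun _ : Fin 1 => (x t).qv)
      (fun t ht i j => (norm_le_pi_norm _ j).trans (hqvb t ht)) hω) 0
    simpa using! h5.const_mul (-(1 / 2 : ℝ))
  -- the regressor without the steady state of the internal model vanishes asymptotically
  let x' : ℝ → State n nμ ℓ r := fun t => ⟨0, 0, (x t).ω, 0, 0, (x t).v + θ t, 0, (x t).ζ⟩
  have hvθ : Tendsto (fun t => (x t).v + θ t) atTop (𝓝 0) := by
    have h5 : Tendsto (fun t => (x t).ζ *ᵥ μ) atTop (𝓝 0) :=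
      tendsto_mulVec_of_tendsto_zero (B := ‖μ‖) (fun _ _ => le_rfl) hζ
    have h6 := ((hz.add (tendsto_mulVec_zero c.Nb (tendsto_mulVec_zero J hω))).add h5).add
      (tendsto_mulVec_zero c.Nb (tendsto_mulVec_zero P.δ hηd))
    simp only [add_zero] at h6
    refine h6.congr fun t => ?_
    simp only [imError]; abel
  have hx' : Tendsto (fun t => (x' t).toVec) atTop (𝓝 0) := by
    refine tendsto_const_nhds.prodMk_nhds (tendsto_const_nhds.prodMk_nhds (hω.prodMk_nhds
      (tendsto_const_nhds.prodMk_nhds (tendsto_const_nhds.prodMk_nhds (hvθ.prodMk_nhds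
        (tendsto_const_nhds.prodMk_nhds ?_))))))
    exact tendsto_pi_nhds.2 fun p => tendsto_pi_nhds.2 fun m => hζ p m
  have hρ' : Tendsto (fun t => c.rho (x' t) *ᵥ R t) atTop (𝓝 0) := by
    refine tendsto_mulVec_of_tendsto_zero hRb' fun i j => ?_
    have h5 := ((continuous_rho (n := n) c i j).tendsto 0).comp hx'
    rw [rho_ofVec_zero] at h5
    exact h5
  -- Only `ρ₃` depends on `v`, so replacing `v` by `v + θ` subtracts exactly the persistent signals
  -- weighted by the last block of the parameter error.
  have hρeq : ∀ t, c.rho (x' t) *ᵥ R t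
      = c.rho (x t) *ᵥ R t - ∑ j, R t (Sum.inr j) • (c.E j *ᵥ θ t) := by
    intro t
    have h5 : R t = Sum.elim (Sum.elim (fun m => R t (Sum.inl (Sum.inl m)))
        fun p => R t (Sum.inl (Sum.inr p))) fun j => R t (Sum.inr j) := by
      ext (( _ | _) | _) <;> rfl
    have h6 : c.rho3 (x' t) *ᵥ (fun j => R t (Sum.inr j))
        = c.rho3 (x t) *ᵥ (fun j => R t (Sum.inr j))
          - ∑ j, R t (Sum.inr j) • (c.E j *ᵥ θ t) := by
      ext i
      change ∑ j, (c.E j *ᵥ (c.Nb *ᵥ c.L0 (x t).ω - ((x t).v + θ t))) i * R t (Sum.inr j)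
        = ∑ j, (c.E j *ᵥ (c.Nb *ᵥ c.L0 (x t).ω - (x t).v)) i * R t (Sum.inr j)
          - (∑ j, R t (Sum.inr j) • (c.E j *ᵥ θ t)) i
      rw [Finset.sum_apply, ← Finset.sum_sub_distrib]
      refine Finset.sum_congr rfl fun j _ => ?_
      rw [← sub_sub, mulVec_sub, Pi.sub_apply, Pi.smul_apply, smul_eq_mul]
      ring
    have h7 : c.rho1 (x' t) = c.rho1 (x t) := rfl
    have h8 : c.rho2 (x' t) = c.rho2 (x t) := rfl
    rw [h5, Controller.rho, Controller.rho, fromCols_mulVec_sumElim, fromCols_mulVec_sumElim,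
      fromCols_mulVec_sumElim, fromCols_mulVec_sumElim, ← h5, h6, h7, h8, add_sub_assoc]
  have hRX : Tendsto (fun t => ∑ j, (c.k • ((c.rho (x t))ᵀ *ᵥ (x t).ω)) (Sum.inr j) • X j t)
      atTop (𝓝 0) := by
    have h5 : ∀ j ∈ Finset.univ, Tendsto (fun t =>
        (c.k • ((c.rho (x t))ᵀ *ᵥ (x t).ω)) (Sum.inr j) • X j t) atTop (𝓝 0) := fun j _ =>
      (tendsto_pi_nhds.1 hR' (Sum.inr j)).zero_smul_isBoundedUnder_le
        (isBoundedUnder_of_eventually_le (Eventually.of_forall fun t => hXb j t))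
    simpa using! tendsto_finsetSum _ h5
  obtain ⟨a1, ha1, g1⟩ := exists_norm_mulVec_le J
  obtain ⟨a2, ha2, g2⟩ := exists_norm_mulVec_le P.δ
  have hy : Tendsto (fun t => c.k1 • c.qev (x t)) atTop (𝓝 0) := by
    -- Integration by parts: the derivative of `R_j X_j` is `R_j Eʲ θ` plus the vanishing `R_j'
    -- X_j`. Hence momentum plus these products is a bounded `W` with `W' + k₁ q_ev → 0`, while
    -- `q_ev` is slow as `ω → 0`.
    refine tendsto_zero_of_slow
      (y' := fun t => c.k1 • (c.qd4 • ((1 / 2 : ℝ) • ((skew (x t).qv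
        + (x t).q4 • (1 : Matrix (Fin 3) (Fin 3) ℝ)) *ᵥ (x t).ω))
        - skew c.qdv *ᵥ ((1 / 2 : ℝ) • ((skew (x t).qv
        + (x t).q4 • (1 : Matrix (Fin 3) (Fin 3) ℝ)) *ᵥ (x t).ω))
        - (-(1 / 2 : ℝ) * ((x t).qv ⬝ᵥ (x t).ω)) • c.qdv))
      (W := fun t => J *ᵥ (x t).ω + P.δ *ᵥ (x t).ηdot + ∑ j, R t (Sum.inr j) • X j t)
      (w := fun t => J *ᵥ α t + P.δ *ᵥ β t + ∑ j, (R t (Sum.inr j) • (c.E j *ᵥ θ t)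
        + (c.k • ((c.rho (x t))ᵀ *ᵥ (x t).ω)) (Sum.inr j) • X j t))
      (B := a1 * B + a2 * B + ∑ _j : Fin ℓ, (B + ‖parVec Ωv μ‖) * bX)
      (fun t ht => ?_) ?_ (fun t ht => ?_) (fun t ht => ?_) ?_
    · obtain ⟨hqv, hq4, -⟩ := hx t ht
      exact (((hqv.const_smul c.qd4).sub (hqv.mulVec _)).sub (hq4.smul_const _)).const_smul c.k1
    · simpa using (((hqv'.const_smul c.qd4).sub (tendsto_mulVec_zero (skew c.qdv) hqv')).sub
        (hq4'.smul_const c.qdv)).const_smul c.k1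
    · obtain ⟨-, -, -, -, hRd, -⟩ := hx t ht
      exact (((h1 t ht).mulVec J).add ((h3 t ht).mulVec P.δ)).add (HasDerivWithinAt.fun_sum
        fun j _ => (hasDerivWithinAt_pi.1 (hRd.sub_const _) (Sum.inr j)).smul
          (hX j t).hasDerivWithinAt)
    · refine (norm_add_le _ _).trans (add_le_add ((norm_add_le _ _).trans (add_le_add
        ((g1 _).trans (mul_le_mul_of_nonneg_left (hωb t ht) ha1))
        ((g2 _).trans (mul_le_mul_of_nonneg_left (hηdb t ht) ha2)))) ?_)
      refine (norm_sum_le _ _).trans (Finset.sum_le_sum fun j _ => ?_)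
      rw [norm_smul]
      exact mul_le_mul ((norm_le_pi_norm _ _).trans (hRb' t ht)) (hXb j t) (norm_nonneg _)
        ((norm_nonneg _).trans (hRb' t ht))
    · have hzη : Tendsto (fun t => imError P J c μ (θ t) (x t) + c.Nb *ᵥ (P.δ *ᵥ (x t).ηdot))
          atTop (𝓝 0) := by
        simpa using hz.add (tendsto_mulVec_zero c.Nb (tendsto_mulVec_zero P.δ hηd))
      have h5 := ((((hω.const_smul c.k2).neg.add (tendsto_mulVec_zero (P.δ * P.C * P.δᵀ) hω)).sub
        hρ').add (tendsto_mulVec_zero (c.E0 + ∑ j, Ωv j • c.E j)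
          hzη)).add hRX
      simp only [smul_zero, neg_zero, add_zero, sub_zero] at h5
      refine h5.congr' ((eventually_ge_atTop 0).mono fun t ht => ?_)
      beta_reduce
      rw [momentum_eq hJ (x t) (h4 t ht) (hout t), Finset.sum_add_distrib, hρeq]
      abel
  have h5 := hy.const_smul c.k1⁻¹
  rw [smul_zero] at h5
  refine h5.congr fun t => ?_
  rw [smul_smul, inv_mul_cancel₀ hk1.ne', one_smul]

/-- For unit quaternions and `s = ±1` the right side is `2 (1 - s q_e4)`, so convergence to `± q_d`
is read off from the scalar error. -/
theorem norm_sub_sq_eq (x : State n nμ ℓ r) (s : ℝ) :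
    (x.qv - s • c.qdv) ⬝ᵥ (x.qv - s • c.qdv) + (x.q4 - s * c.qd4) ^ 2
      = (x.qv ⬝ᵥ x.qv + x.q4 ^ 2) + s ^ 2 * (c.qdv ⬝ᵥ c.qdv + c.qd4 ^ 2) - 2 * s * qe4 c x := by
  simp only [qe4, dotProduct, Fin.sum_univ_three, Pi.sub_apply, Pi.smul_apply, smul_eq_mul]
  ring

/-- As `q_ev → 0`, the square of `q_e4` tends to one. Eventually `q_e4` has no zero, and by
continuity its sign is fixed, which selects one representative. -/
theorem tendsto_quaternion (hqd : c.qdv ⬝ᵥ c.qdv + c.qd4 ^ 2 = 1)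
    (hx : IsClosedLoopSolutionOn P J d c (Set.Ici 0) x)
    (hx0 : (x 0).qv ⬝ᵥ (x 0).qv + (x 0).q4 ^ 2 = 1)
    (hq : Tendsto (fun t => c.qev (x t)) atTop (𝓝 0)) :
    Tendsto (fun t => ((x t).qv, (x t).q4)) atTop (𝓝 (c.qdv, c.qd4)) ∨
    Tendsto (fun t => ((x t).qv, (x t).q4)) atTop (𝓝 (-c.qdv, -c.qd4)) := by
  have hu : ∀ t, 0 ≤ t → (x t).qv ⬝ᵥ (x t).qv + (x t).q4 ^ 2 = 1 := fun t ht =>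
    unit_quaternion (convex_Ici 0) (Set.mem_Ici.2 le_rfl) hx hx0 ht
  have hcont : ContinuousOn (fun t => qe4 c (x t)) (Set.Ici 0) := fun t ht =>
    (hasDerivWithinAt_qe4 hx ht).continuousWithinAt
  have hsq : ∀ t, 0 ≤ t → qe4 c (x t) ^ 2 = 1 - c.qev (x t) ⬝ᵥ c.qev (x t) := fun t ht => by
    have := qev_sq_add_qe4_sq (c := c) (x t)
    rw [hqd, hu t ht] at this
    linarith
  have hdot : Tendsto (fun t => c.qev (x t) ⬝ᵥ c.qev (x t)) atTop (𝓝 0) := by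
    have hc : Continuous fun w : Fin 3 → ℝ => w ⬝ᵥ w := by fun_prop
    simpa using! (hc.tendsto 0).comp hq
  -- convergence to the representative selected by the sign
  have key : ∀ s : ℝ, s ^ 2 = 1 → (∀ᶠ t in atTop, 0 < s * qe4 c (x t)) →
      Tendsto (fun t => ((x t).qv, (x t).q4)) atTop (𝓝 (s • c.qdv, s * c.qd4)) := by
    intro s hs hpos
    -- The positive number `s * qe4` has square `1 - |q_ev|² ≤ 1`, hence is at most one and
    -- dominates its square.
    have hsqrt : ∀ᶠ t in atTop, 1 - c.qev (x t) ⬝ᵥ c.qev (x t) ≤ s * qe4 c (x t) := by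
      filter_upwards [hpos, eventually_ge_atTop 0] with t hp ht
      have h1 : (s * qe4 c (x t)) ^ 2 = 1 - c.qev (x t) ⬝ᵥ c.qev (x t) := by
        rw [mul_pow, hs, one_mul, hsq t ht]
      have h2 := dotProduct_self_nonneg' (c.qev (x t))
      nlinarith
    have hd : ∀ᶠ t in atTop, ((x t).qv - s • c.qdv) ⬝ᵥ ((x t).qv - s • c.qdv)
        + ((x t).q4 - s * c.qd4) ^ 2 ≤ 2 * (c.qev (x t) ⬝ᵥ c.qev (x t)) := by
      filter_upwards [hsqrt, eventually_ge_atTop 0] with t h1 ht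
      rw [norm_sub_sq_eq, hu t ht, hs, hqd]
      linarith
    have h2 : Tendsto (fun t => 2 * (c.qev (x t) ⬝ᵥ c.qev (x t))) atTop (𝓝 0) := by
      simpa using hdot.const_mul 2
    have hsmall : ∀ {F : Type} [NormedAddCommGroup F] (f : ℝ → F),
        (∀ᶠ t in atTop, ‖f t‖ ^ 2 ≤ 2 * (c.qev (x t) ⬝ᵥ c.qev (x t))) →
        Tendsto f atTop (𝓝 0) := by
      intro F _ f hf
      have h3 : Tendsto (fun t => ‖f t‖ ^ 2) atTop (𝓝 0) :=
        squeeze_zero' (Eventually.of_forall fun t => sq_nonneg _) hf h2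
      have h4 := h3.sqrt
      rw [Real.sqrt_zero] at h4
      exact tendsto_zero_iff_norm_tendsto_zero.2 (h4.congr fun t => Real.sqrt_sq (norm_nonneg _))
    refine Tendsto.prodMk_nhds (tendsto_sub_nhds_zero_iff.1 (hsmall _ ?_))
      (tendsto_sub_nhds_zero_iff.1 (hsmall _ ?_))
    · filter_upwards [hd] with t ht
      have := norm_sq_le_dotProduct_self ((x t).qv - s • c.qdv)
      linarith [sq_nonneg ((x t).q4 - s * c.qd4)]
    · filter_upwards [hd] with t ht
      rw [Real.norm_eq_abs, sq_abs]
      linarith [dotProduct_self_nonneg' ((x t).qv - s • c.qdv)]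
  obtain ⟨T, hT0, hT⟩ : ∃ T : ℝ, 0 ≤ T ∧ ∀ t, T ≤ t → qe4 c (x t) ≠ 0 := by
    obtain ⟨T, hT⟩ := eventually_atTop.1 (hdot.eventually (gt_mem_nhds one_pos))
    refine ⟨max T 0, le_max_right _ _, fun t ht h0 => ?_⟩
    have h1 := hsq t ((le_max_right _ _).trans ht)
    rw [h0] at h1
    linarith [hT t ((le_max_left _ _).trans ht)]
  have hcT : ContinuousOn (fun t => qe4 c (x t)) (Set.Ici T) :=
    hcont.mono (Set.Ici_subset_Ici.2 hT0)
  rcases (hT T le_rfl).lt_or_gt with hneg | hpos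
  · right
    have h := key (-1) (by norm_num) ((eventually_ge_atTop T).mono fun t ht => ?_)
    · simpa using h
    · by_contra hcon
      obtain ⟨s, hs, hs0⟩ := (isPreconnected_Ici (a := T)).intermediate_value
        (Set.mem_Ici.2 le_rfl) (Set.mem_Ici.2 ht) hcT ⟨hneg.le, (by linarith : (0 : ℝ) ≤ _)⟩
      exact hT s hs hs0
  · left
    have h := key 1 (by norm_num) ((eventually_ge_atTop T).mono fun t ht => ?_)
    · simpa using h
    · by_contra hcon
      obtain ⟨s, hs, hs0⟩ := (isPreconnected_Ici (a := T)).intermediate_value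
        (Set.mem_Ici.2 ht) (Set.mem_Ici.2 le_rfl) hcT ⟨(by linarith : _ ≤ (0 : ℝ)), hpos.le⟩
      exact hT s hs hs0

end

section

/-! ### The closed loop as a whole -/

variable {n nμ ℓ : ℕ} {r : Fin 3 → ℕ} {P : Flex n} {J : Matrix (Fin 3) (Fin 3) ℝ}
  {d : Fin 3 → ℝ → ℝ} {c : Controller nμ ℓ r} {μ : Fin nμ → ℝ}

/-- Boundedness of `Ω` on the frequency set enters here, as a bound on `Ψ T⁻¹` that is uniform in
`σ`. -/
theorem exists_entries_le {nσ : ℕ} {S : Set (Fin nσ → ℝ)} {Ω : (Fin nσ → ℝ) → Fin ℓ → ℝ}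
    (hΩ : Bornology.IsBounded (Ω '' S)) {ι κ : Type*} [Fintype ι] [Fintype κ] (E0 : Matrix ι κ ℝ)
    (E : Fin ℓ → Matrix ι κ ℝ) :
    ∃ β : ℝ, ∀ σ ∈ S, ∀ i j, |(E0 + ∑ m, Ω σ m • E m) i j| ≤ β := by
  obtain ⟨b, hb⟩ := hΩ.exists_norm_le
  let e : ι → κ → ℝ := fun i j => |E0 i j| + ∑ m, |b| * |E m i j|
  have he : ∀ i j, 0 ≤ e i j := fun i j => by positivity
  refine ⟨∑ i, ∑ j, e i j, fun σ hσ i j => le_trans ?_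
    ((Finset.single_le_sum (f := fun j => e i j) (fun j _ => he i j) (Finset.mem_univ j)).trans
      (Finset.single_le_sum (f := fun i => ∑ j, e i j)
        (fun i _ => Finset.sum_nonneg fun j _ => he i j) (Finset.mem_univ i)))⟩
  rw [Matrix.add_apply, Matrix.sum_apply]
  refine (abs_add_le _ _).trans (add_le_add le_rfl ((Finset.abs_sum_le_sum_abs _ _).trans
    (Finset.sum_le_sum fun m _ => ?_)))
  rw [Matrix.smul_apply, smul_eq_mul, abs_mul]
  exact mul_le_mul_of_nonneg_right (((norm_le_pi_norm (Ω σ) m).trans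
    (hb _ (Set.mem_image_of_mem _ hσ))).trans (le_abs_self b)) (abs_nonneg _)

theorem eqOn_of_isClosedLoopSolution (hdet : IsUnit (J - P.δ * P.δᵀ).det)
    {x y : ℝ → State n nμ ℓ r} (hx : IsClosedLoopSolution P J d c x)
    (hy : IsClosedLoopSolution P J d c y) (h0 : x 0 = y 0) : Set.EqOn x y (Set.Ici 0) := by
  have hx' := (isClosedLoopSolutionOn_iff hdet (Set.Ici 0) x).1 hx
  have hy' := (isClosedLoopSolutionOn_iff hdet (Set.Ici 0) y).1 hy
  intro t ht
  have h := eqOn_Icc_of_contDiff (contDiff_field P J c) (forcing P J d) (T := t)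
    (fun s hs => (hx' s hs.1).mono Set.Icc_subset_Ici_self)
    (fun s hs => (hy' s hs.1).mono Set.Icc_subset_Ici_self) (congrArg State.toVec h0)
    (Set.right_mem_Icc.2 ht)
  exact congrArg State.ofVec h

theorem exists_isClosedLoopSolution (hdet : IsUnit (J - P.δ * P.δᵀ).det)
    (hdc : ∀ i, Continuous (d i)) (hd : ∀ i, ∃ B, ∀ t, |d i t| ≤ B) (x0 : State n nμ ℓ r) {B : ℝ}
    (hB : ∀ S, 0 ≤ S → ∀ x : ℝ → State n nμ ℓ r, x 0 = x0 →
      IsClosedLoopSolutionOn P J d c (Set.Icc 0 S) x → ∀ t ∈ Set.Icc 0 S, ‖(x t).toVec‖ ≤ B) :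
    ∃ x : ℝ → State n nμ ℓ r, x 0 = x0 ∧ IsClosedLoopSolution P J d c x := by
  obtain ⟨D, hD⟩ := exists_norm_forcing_le (nμ := nμ) (ℓ := ℓ) (r := r) P J d hd
  obtain ⟨X, hX0, hX⟩ := exists_solution_Ici_of_apriori (contDiff_field P J c)
    (continuous_forcing P J d hdc) hD x0.toVec (B := B) fun S hS X hX0 hX t ht =>
      hB S hS (fun t => State.ofVec (X t)) (congrArg State.ofVec hX0)
        ((isClosedLoopSolutionOn_iff hdet (Set.Icc 0 S) fun t => State.ofVec (X t)).2 hX) t ht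
  exact ⟨fun t => State.ofVec (X t), congrArg State.ofVec hX0,
    (isClosedLoopSolutionOn_iff hdet (Set.Ici 0) fun t => State.ofVec (X t)).2 hX⟩

theorem isBoundedTrajectory_of_norm_toVec_le {x : ℝ → State n nμ ℓ r} {B : ℝ}
    (hB : ∀ t, 0 ≤ t → ‖(x t).toVec‖ ≤ B) : IsBoundedTrajectory x := by
  refine ⟨B, fun t ht => ?_⟩
  have h := hB t ht
  obtain ⟨h1, h⟩ := norm_prod_le_iff.1 h
  obtain ⟨h2, h⟩ := norm_prod_le_iff.1 h
  obtain ⟨h3, h⟩ := norm_prod_le_iff.1 h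
  obtain ⟨h4, h⟩ := norm_prod_le_iff.1 h
  obtain ⟨h5, h⟩ := norm_prod_le_iff.1 h
  obtain ⟨h6, h⟩ := norm_prod_le_iff.1 h
  obtain ⟨h7, h⟩ := norm_prod_le_iff.1 h
  exact ⟨h1, h2, h3, h4, h5, h6, h7, fun p m =>
    (norm_le_pi_norm ((x t).toVec.2.2.2.2.2.2.2 p) m).trans ((norm_le_pi_norm _ p).trans h)⟩

/-- Existence, uniqueness, boundedness and tracking for a single plant, given a certificate for
the gain `k2`. -/
theorem exists_solution_of_gain (hJ : J = inertia (c.Lbar1 *ᵥ μ + c.Lbar0))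
    (hJp : J.PosDef) (hJmb : (J - P.δ * P.δᵀ).PosDef) (hK : P.K.PosDef)
    {Q : Matrix (IMIdx r) (IMIdx r) ℝ} (hQs : Q.IsSymm)
    {cQ : ℝ} (hcQ : 0 < cQ) (hQ : ∀ z, cQ * (z ⬝ᵥ z) ≤ z ⬝ᵥ (Q *ᵥ z))
    (hQM : ∀ z, z ⬝ᵥ (Q *ᵥ (c.Mb *ᵥ z)) ≤ -(z ⬝ᵥ z)) {γ : ℝ} (hγ : 0 < γ)
    (hk1 : 0 < c.k1) (hk : 0 < c.k) (hqd : c.qdv ⬝ᵥ c.qdv + c.qd4 ^ 2 = 1) {ε : ℝ} (hε : 0 < ε)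
    {Ωv : Fin ℓ → ℝ}
    (hgain : ∀ (w : Fin 3 → ℝ) (y : Fin n → ℝ) (z : IMIdx r → ℝ),
        w ⬝ᵥ (-(c.k2 • w) + (P.δ * P.C * P.δᵀ) *ᵥ w
          + (c.E0 + ∑ j, Ωv j • c.E j) *ᵥ (z + c.Nb *ᵥ (P.δ *ᵥ y))) - y ⬝ᵥ (P.C *ᵥ y)
          + 2 * γ * (z ⬝ᵥ (Q *ᵥ (c.Mb *ᵥ z + c.Mb *ᵥ (c.Nb *ᵥ (P.δ *ᵥ y)))))
        ≤ -ε * (w ⬝ᵥ w + y ⬝ᵥ y + z ⬝ᵥ z))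
    (hdc : ∀ i, Continuous (d i)) (hd : ∀ i, ∃ B, ∀ t, |d i t| ≤ B)
    {θ : ℝ → IMIdx r → ℝ} {bθ : ℝ} (hθb : ∀ t, ‖θ t‖ ≤ bθ)
    (hθ : ∀ t, HasDerivAt θ (c.Mb *ᵥ θ t + c.Nb *ᵥ fun i => d i t) t)
    (hout : ∀ t, (c.E0 + ∑ j, Ωv j • c.E j) *ᵥ θ t = fun i => d i t)
    {X : Fin ℓ → ℝ → Fin 3 → ℝ} (hX : ∀ j t, HasDerivAt (X j) (c.E j *ᵥ θ t) t)
    (hXb : ∀ j t, ‖X j t‖ ≤ bθ)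
    (x0 : State n nμ ℓ r) (hx0 : x0.qv ⬝ᵥ x0.qv + x0.q4 ^ 2 = 1) :
    ∃ x : ℝ → State n nμ ℓ r, x 0 = x0 ∧ IsClosedLoopSolution P J d c x ∧
      (∀ y : ℝ → State n nμ ℓ r, y 0 = x0 → IsClosedLoopSolution P J d c y →
        Set.EqOn y x (Set.Ici 0)) ∧
      IsBoundedTrajectory x ∧ AchievesTracking c x := by
  have hdet : IsUnit (J - P.δ * P.δᵀ).det := hJmb.det_pos.ne'.isUnit
  obtain ⟨B, ε', hε', hcert⟩ := exists_lyapunov_certificate hJ hJp hJmb hK hQs hcQ hQ hQM hγ hk1 hk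
    hqd hε hgain hθb hθ hout x0 hx0
  -- The certificate is used twice with the same bound: on each `[0, S]` to exclude escape and
  -- obtain a global solution, then on `[0, ∞)` for its asymptotics.
  obtain ⟨x, hxx0, hx⟩ := exists_isClosedLoopSolution hdet hdc hd x0 (B := B)
    fun S hS x hxx0 hx t ht => by
      obtain ⟨W, W', hW⟩ := hcert (Set.Icc 0 S) (convex_Icc _ _) (Set.left_mem_Icc.2 hS)
        Set.Icc_subset_Ici_self x hxx0 hx
      exact (hW t ht).2.2.2
  obtain ⟨W, W', hW⟩ := hcert (Set.Ici 0) (convex_Ici _) (Set.mem_Ici.2 le_rfl) subset_rfl x hxx0 hx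
  have hB : ∀ t, 0 ≤ t → ‖(x t).toVec‖ ≤ B := fun t ht => (hW t ht).2.2.2
  obtain ⟨hω, hηd, hz, hζ⟩ := tendsto_dissipated_errors hJ hdet hd hθb hθ hx hB hε'
    (fun t ht => (hW t ht).1) (fun t ht => (hW t ht).2.1) fun t ht => (hW t ht).2.2.1
  have hq := tendsto_qev hk1 hJ hout hX hXb hx hB hω hηd hz hζ
  exact ⟨x, hxx0, hx, fun y hy0 hy => eqOn_of_isClosedLoopSolution hdet hy hx (hy0.trans hxx0.symm),
    isBoundedTrajectory_of_norm_toVec_le hB, hq, hω, tendsto_modal hK hx hB hηd,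
    tendsto_quaternion hqd hx (by rw [hxx0]; exact hx0) hq⟩

end

end FlexSpacecraft

end

/-! ### The main theorem. -/

theorem theorem1 {n nμ nσ : ℕ}
    -- flexible structure
    (P : FlexSpacecraft.Flex n) (hC : P.C.PosDef) (hK : P.K.PosDef)
    -- known structure of the inertia matrix: its entries are `Lbar1 μ + Lbar0`, with `μ` unknown
    (Lbar1 : Matrix (Fin 6) (Fin nμ) ℝ) (Lbar0 : Fin 6 → ℝ)
    -- set `S` of possible unknown frequency vectors, and the exosystems
    (S : Set (Fin nσ → ℝ)) (r : Fin 3 → ℕ) (hr : ∀ i, 0 < r i)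
    (a : (i : Fin 3) → (Fin nσ → ℝ) → Fin (r i) → ℝ)
    (ha : ∀ i, ∀ σ ∈ S, FlexSpacecraft.IsExosystem (a i σ))
    -- internal model
    (M : (i : Fin 3) → Matrix (Fin (r i)) (Fin (r i)) ℝ) (N : (i : Fin 3) → Fin (r i) → ℝ)
    (hM : ∀ i, FlexSpacecraft.IsHurwitz (M i))
    (hMN : ∀ i, FlexSpacecraft.IsControllable (M i) (N i)) :
    -- every multi-tone signal solves an exosystem which depends only on its frequencies
    (∀ (m : ℕ) (b : Fin m → ℝ), ∃ (r' : ℕ) (a' : Fin r' → ℝ), 0 < r' ∧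
      FlexSpacecraft.IsExosystem a' ∧ ∀ (C0 : ℝ) (C l : Fin m → ℝ),
        FlexSpacecraft.SolvesExosystem a' (FlexSpacecraft.multiTone C0 C b l)) ∧
    -- the matrices `T(σ)` and a parametrization of `Ψ T(σ)⁻¹` exist
    (∀ i, ∀ σ ∈ S, ∃! T, FlexSpacecraft.IsSylvesterSol (a i σ) (M i) (N i) T) ∧
    (∃ (ℓ : ℕ) (E0 : Matrix (Fin 3) (FlexSpacecraft.IMIdx r) ℝ)
      (E : Fin ℓ → Matrix (Fin 3) (FlexSpacecraft.IMIdx r) ℝ) (Ω : (Fin nσ → ℝ) → Fin ℓ → ℝ),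
      FlexSpacecraft.IsParametrization S a M N E0 E Ω) ∧
    -- the control law built on any such parametrization solves the problem
    ∀ (ℓ : ℕ) (E0 : Matrix (Fin 3) (FlexSpacecraft.IMIdx r) ℝ)
      (E : Fin ℓ → Matrix (Fin 3) (FlexSpacecraft.IMIdx r) ℝ) (Ω : (Fin nσ → ℝ) → Fin ℓ → ℝ),
      FlexSpacecraft.IsParametrization S a M N E0 E Ω →
      ∀ S' : Set (Fin nσ → ℝ), S' ⊆ S → Bornology.IsBounded (Ω '' S') →
      ∃ κ : ℝ, 0 < κ ∧ ∀ k1 k2 k : ℝ, 0 < k1 → κ ≤ k2 → 0 < k →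
      ∀ (qdv : Fin 3 → ℝ) (qd4 : ℝ), qdv ⬝ᵥ qdv + qd4 ^ 2 = 1 →
      ∀ c : FlexSpacecraft.Controller nμ ℓ r,
        c = { k1 := k1, k2 := k2, k := k, Lbar1 := Lbar1, Lbar0 := Lbar0, M := M, N := N,
              E0 := E0, E := E, qdv := qdv, qd4 := qd4 } →
      -- unknown inertia parameters
      ∀ (μ : Fin nμ → ℝ) (J : Matrix (Fin 3) (Fin 3) ℝ),
        J = FlexSpacecraft.inertia (Lbar1 *ᵥ μ + Lbar0) → J.PosDef → (J - P.δ * P.δᵀ).PosDef →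
      -- unknown disturbance
      ∀ σ ∈ S', ∀ d : Fin 3 → ℝ → ℝ, (∀ i, FlexSpacecraft.IsMultiTone (d i)) →
        (∀ i, FlexSpacecraft.SolvesExosystem (a i σ) (d i)) →
      -- initial state
      ∀ x0 : FlexSpacecraft.State n nμ ℓ r, x0.qv ⬝ᵥ x0.qv + x0.q4 ^ 2 = 1 →
      ∃ x : ℝ → FlexSpacecraft.State n nμ ℓ r,
        x 0 = x0 ∧ FlexSpacecraft.IsClosedLoopSolution P J d c x ∧
        (∀ y : ℝ → FlexSpacecraft.State n nμ ℓ r, y 0 = x0 →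
          FlexSpacecraft.IsClosedLoopSolution P J d c y → Set.EqOn y x (Set.Ici 0)) ∧
        FlexSpacecraft.IsBoundedTrajectory x ∧ FlexSpacecraft.AchievesTracking c x := by
  refine ⟨fun m b => FlexSpacecraft.exists_exosystem b,
    fun i σ hσ => FlexSpacecraft.existsUnique_isSylvesterSol (hr i) (ha i σ hσ) (hM i) (hMN i),
    FlexSpacecraft.exists_isParametrization hr ha hM hMN, fun ℓ E0 E Ω hP S' hS' hΩ => ?_⟩
  obtain ⟨Q, hQs, ⟨cQ, hcQ, hQ⟩, hQM⟩ := FlexSpacecraft.exists_lyapunov_blockDiagonal' hM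
  obtain ⟨β, hβ⟩ := FlexSpacecraft.exists_entries_le hΩ E0 E
  -- All constants are fixed before `μ`, `J`, `σ`, the disturbance and the initial state are
  -- introduced; only the uniform bound `β` on `Ψ T⁻¹` has been used.
  obtain ⟨κ, γ, ε, hκ, hγ, hε, hgain⟩ :=
    FlexSpacecraft.exists_gain hC P.δ hQM (FlexSpacecraft.blockCols N) β
  refine ⟨κ, hκ, ?_⟩
  intro k1 k2 k hk1 hk2 hk qdv qd4 hqd c hc μ J hJ hJp hJmb σ hσ d hd hs x0 hx0
  obtain ⟨θ, X, B, hθ, hθb, hout, hX, hXb⟩ :=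
    hP.exists_steadyState hr ha hM hMN (hS' hσ) hd hs
  have hg := hgain _ (hβ σ hσ) k2 hk2
  obtain ⟨rfl, rfl, rfl, rfl, rfl, rfl, rfl, rfl, rfl, rfl, rfl⟩ :
      c.k1 = k1 ∧ c.k2 = k2 ∧ c.k = k ∧ c.Lbar1 = Lbar1 ∧ c.Lbar0 = Lbar0 ∧ c.M = M ∧ c.N = N ∧
        c.E0 = E0 ∧ c.E = E ∧ c.qdv = qdv ∧ c.qd4 = qd4 := by
    rw [hc]; exact ⟨rfl, rfl, rfl, rfl, rfl, rfl, rfl, rfl, rfl, rfl, rfl⟩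
  exact FlexSpacecraft.exists_solution_of_gain hJ hJp hJmb hK hQs hcQ hQ hQM hγ hk1 hk hqd hε
    hg (fun i => (hd i).continuous)
    (fun i => by simpa using (hd i).exists_bound 0) hθb hθ hout hX hXb x0 hx0
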